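/- **Setting.** Let $G$ be a finite-dimensional real Lie group with Lie algebra $\mathfrak g$, let $J_1,\dots,J_d$ be a basis of $\mathfrak g$ with dual basis $P^1,\dots,P^d$, let $n,g\ge 0$ be integers and $\hbar\in\mathbb R\setminus\{0\}$. Write $\mathrm{Ad}^*(x)_a{}^b=\langle P^b,\mathrm{Ad}(x)J_a\rangle$ for $x\in G$, and sum over repeated Lie algebra indices. Label the components of $u\in G^{n+2g}$ by the partially ordered set $M_1<\dots<M_n<A_1,B_1<\dots<A_g,B_g$ ($A_i,B_i$ incomparable), and on the component $u_X$ let $J_a^{R_X}F=\frac{d}{dt}|_{0}F(\dots,u_Xe^{tJ_a},\dots)$ and $J_a^{L_X}F=\frac{d}{dt}|_{0}F(\dots,e^{-tJ_a}u_X,\dots)$. Expressions such as $\mathrm{Ad}^*(u_X)_a{}^b$ are regarded as smooth functions of $u$. **Classical flower algebra.** Let $\mathcal F_{\mathbb C}=S\big(\bigoplus_{k=1}^{n+2g}\mathfrak g\big)\otimes C^\infty(G^{n+2g},\mathbb C)$, the polynomials in the generators $j^X_a$ with coefficients in $C^\infty(G^{n+2g},\mathbb C)$, and let $\mathcal F^{(0)}_{\mathbb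 C}\oplus\mathcal F^{(1)}_{\mathbb C}$ be its subspace of elements of degree at most $1$ in the $j^X_a$. Its Poisson brackets between generators and functions are $$\{j_a^{M_i},F\}=-(J_a^{R_{M_i}}+J_a^{L_{M_i}})F-R^{M_i}_aF,$$ $$\{j_a^{A_i},F\}=-(J_a^{R_{A_i}}+J_a^{L_{A_i}})F-(J_a^{R_{B_i}}+J_a^{L_{B_i}})F-\mathrm{Ad}^*(u_{B_i}^{-1}u_{A_i})_a{}^bJ_b^{R_{B_i}}F-R^{A_i}_aF,$$ $$\{j_a^{B_i},F\}=-J_a^{L_{A_i}}F-(J_a^{R_{B_i}}+J_a^{L_{B_i}})F-R^{B_i}_aF,$$ where $R^X_aF=(\delta_a^b-\mathrm{Ad}^*(u_X)_a{}^b)\sum_{Y>X}(J_b^{R_Y}+J_b^{L_Y})F$. **Action.** The group $G\ltimes C^\infty(G)$, with $C^\infty(G)=C^\infty(G,\mathbb R)$, has the multiplication $(h_1,f_1)(h_2,f_2)=(h_1h_2,\,f_1+f_2\circ \mathrm{Ad}_{h_1^{-1}})$, where $\mathrm{Ad}_h(x)=hxh^{-1}$. The element $(h,f)$ acts on $\mathcal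 F_{\mathbb C}$ by the algebra homomorphism $$F\mapsto F\circ \mathrm{Ad}_{h^{-1}}^{\,n+2g},\qquad j^X_a\mapsto \mathrm{Ad}^*(h)_a{}^b\big(j^X_b+\{j^X_b,\,f\circ\Phi_\infty\}\big),$$ where $\mathrm{Ad}_h^{\,n+2g}$ is the simultaneous conjugation of all components by $h$ and $$\Phi_\infty(u)=u_{K_g}\cdots u_{K_1}u_{M_n}\cdots u_{M_1},\qquad u_{K_i}=u_{B_i}u_{A_i}^{-1}u_{B_i}^{-1}u_{A_i}.$$ It preserves $\mathcal F^{(0)}_{\mathbb C}\oplus\mathcal F^{(1)}_{\mathbb C}$. **Quantum flower algebra.** Let $\hat{\mathcal F}$ be the associative unital complex algebra $U\big(\bigoplus_{k=1}^{n+2g}\mathfrak g\big)\ltimes C^\infty(G^{n+2g},\mathbb C)$: it is the vector space $U\otimes C^\infty(G^{n+2g},\mathbb C)$, the copies of $\mathfrak g$ are generated by $k^X_a$ with $[k^X_a,k^Y_b]=-i\hbar\,\delta_{XY}f_{ab}{}^c k^X_c$ in $U$, where $[J_a,J_b]=f_{ab}{}^cJ_c$, and for $\xi,\eta\in\bigoplus\mathfrak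 g$ $$(\xi\otimes F)(\eta\otimes K)=\xi\eta\otimes FK+i\hbar\;\eta\otimes F\{\xi,K\},$$ where, with only the displayed components of $u$ changed, $$\{k^{M_i}_a,K\}=-\tfrac{d}{dt}|_0K(e^{-tJ_a}u_{M_i}e^{tJ_a}),\qquad \{k^{B_i}_a,K\}=-\tfrac{d}{dt}|_0K(u_{B_i}e^{tJ_a}),$$ $$\{k^{A_i}_a,K\}=-\tfrac{d}{dt}|_0K(u_{A_i}e^{tJ_a},\;u_{A_i}e^{tJ_a}u_{A_i}^{-1}u_{B_i}).$$ The decoupled generators are $j^{M_i'}_a=k^{M_i}_a$, $j^{B_i'}_a=k^{B_i}_a$ and $j^{A_i'}_a=k^{A_i}_a+k^{B_i}_a$. Let $\hat{\mathcal F}^{(1)}\subset\hat{\mathcal F}$ be the span of the elements $\theta\otimes F$ with $\theta\in U$ of degree at most $1$; it is a Lie algebra under the commutator. **The map $Q|_{01}$.** The linear map $Q|_{01}:\mathcal F^{(0)}_{\mathbb C}\oplus\mathcal F^{(1)}_{\mathbb C}\to\hat{\mathcal F}^{(1)}$ is the identity on functions and, after the $j^X_a$ have been expressed through the decoupled generators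 by $$j^{M_i}_a=j^{M_i'}_a+(\delta_a^b-\mathrm{Ad}^*(u_{M_i})_a{}^b)\Big(\sum_{k=i+1}^nj_b^{M_k'}+\sum_{k=1}^gT^k_b\Big),$$ $$j^{X_i}_a=j^{X_i'}_a-\mathrm{Ad}^*(u_{A_i}^{-1})_a{}^b(j_b^{A_i'}-j_b^{B_i'})+(\delta_a^b-\mathrm{Ad}^*(u_{X_i})_a{}^b)\sum_{k=i+1}^gT^k_b\qquad(X=A,B),$$ $$T^k_b=\big(\delta_b^c-\mathrm{Ad}^*(u_{A_k}^{-1})_b{}^c\big)j_c^{A_k'}+\big(\mathrm{Ad}^*(u_{A_k}^{-1})_b{}^c-\mathrm{Ad}^*(u_{B_k}^{-1}u_{A_k})_b{}^c\big)j_c^{B_k'},$$ sends $\sum F\,j^{X'}_a$ to the same expression in $\hat{\mathcal F}$ with all functions ordered to the left of the generators. **Theorem.** The map $Q|_{01}$ is a linear isomorphism onto $\hat{\mathcal F}^{(1)}$. For every $(h,f)\in G\ltimes C^\infty(G)$ the map $$\widehat{(h,f)}=Q|_{01}\circ(h,f)\circ Q|_{01}^{-1}:\hat{\mathcal F}^{(1)}\to\hat{\mathcal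 F}^{(1)}$$ is a Lie algebra automorphism of $\hat{\mathcal F}^{(1)}$. It extends canonically to an algebra automorphism of $\hat{\mathcal F}$: exactly one algebra endomorphism of $\hat{\mathcal F}$ restricts to $\widehat{(h,f)}$ on $\hat{\mathcal F}^{(1)}$, and it is bijective. These extensions define an action of the group $G\ltimes C^\infty(G)$ on $\hat{\mathcal F}$ by algebra automorphisms. -/

import Mathlib

open scoped TensorProduct DirectSum Manifold ContDiff Topology

set_option linter.unusedSectionVars false

attribute [local instance 100] LieRing.ofAssociativeRing

noncomputable section

/-! ## The semidirect product algebra `U(L) ⋉ A` -/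

/-- A subalgebra of `U(L)` that contains `L` is everything. -/
theorem UniversalEnvelopingAlgebra.mem_of_ι_mem {K L : Type*} [CommRing K] [LieRing L]
    [LieAlgebra K L] (S : Subalgebra K (UniversalEnvelopingAlgebra K L))
    (hι : ∀ ξ : L, UniversalEnvelopingAlgebra.ι K ξ ∈ S) (θ : UniversalEnvelopingAlgebra K L) :
    θ ∈ S := by
  let f : UniversalEnvelopingAlgebra K L →ₐ[K] S :=
    UniversalEnvelopingAlgebra.lift K
      { toFun := fun ξ => ⟨UniversalEnvelopingAlgebra.ι K ξ, hι ξ⟩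
        map_add' := fun ξ η => Subtype.ext (map_add _ _ _)
        map_smul' := fun c ξ => Subtype.ext (map_smul _ _ _)
        map_lie' := fun {ξ η} => Subtype.ext (LieHom.map_lie _ _ _) }
  have hf : S.val.comp f = AlgHom.id K _ := by
    refine UniversalEnvelopingAlgebra.hom_ext K (LieHom.ext fun ξ => ?_)
    exact congrArg Subtype.val (UniversalEnvelopingAlgebra.lift_ι_apply K _ ξ)
  have h2 : (f θ : UniversalEnvelopingAlgebra K L) = θ := DFunLike.congr_fun hf θ
  exact h2 ▸ (f θ).2

section Smash

variable {K L A : Type*} [CommRing K] [LieRing L] [LieAlgebra K L] [CommRing A] [Algebra K A]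

/-- For a Lie algebra `L` acting on a commutative algebra `A` by derivations `D`, the vector space
`U(L) ⊗ A` underlying the semidirect product algebra `U(L) ⋉ A`. -/
def SmashProduct (_D : L →ₗ⁅K⁆ Derivation K A A) : Type _ :=
  UniversalEnvelopingAlgebra K L ⊗[K] A

namespace SmashProduct

variable (D : L →ₗ⁅K⁆ Derivation K A A)

instance : AddCommGroup (SmashProduct D) :=
  inferInstanceAs (AddCommGroup (UniversalEnvelopingAlgebra K L ⊗[K] A))

instance : Module K (SmashProduct D) :=
  inferInstanceAs (Module K (UniversalEnvelopingAlgebra K L ⊗[K] A))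

/-- The element `θ ⊗ F`. -/
def tmul (θ : UniversalEnvelopingAlgebra K L) (F : A) : SmashProduct D :=
  TensorProduct.tmul K θ F

/-- Multiplication by `1 ⊗ F` from the left: `θ ⊗ K ↦ θ ⊗ F K`. -/
def mulFun : A →ₗ[K] Module.End K (SmashProduct D) :=
  LinearMap.lTensorHom (R := K) (UniversalEnvelopingAlgebra K L) ∘ₗ LinearMap.mul K A

/-- Multiplication by `ξ ⊗ 1` from the left, for `ξ ∈ L`: `θ ⊗ K ↦ ξ θ ⊗ K + θ ⊗ D_ξ K`. -/
def mulGen (ξ : L) : Module.End K (SmashProduct D) :=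
  LinearMap.rTensor A (LinearMap.mulLeft K (UniversalEnvelopingAlgebra.ι K ξ)) +
    LinearMap.lTensor (UniversalEnvelopingAlgebra K L) (D ξ : A →ₗ[K] A)

theorem mulFun_tmul (F : A) (θ : UniversalEnvelopingAlgebra K L) (G : A) :
    mulFun D F (tmul D θ G) = tmul D θ (F * G) := rfl

theorem mulGen_tmul (ξ : L) (θ : UniversalEnvelopingAlgebra K L) (G : A) :
    mulGen D ξ (tmul D θ G) =
      tmul D (UniversalEnvelopingAlgebra.ι K ξ * θ) G + tmul D θ (D ξ G) := rfl

@[elab_as_elim]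
theorem induction_on {p : SmashProduct D → Prop} (x : SmashProduct D) (h0 : p 0)
    (ht : ∀ θ F, p (tmul D θ F)) (ha : ∀ x y, p x → p y → p (x + y)) : p x :=
  TensorProduct.induction_on x h0 ht ha

theorem hom_ext {M : Type*} [AddCommGroup M] [Module K M] {f g : SmashProduct D →ₗ[K] M}
    (h : ∀ θ F, f (tmul D θ F) = g (tmul D θ F)) : f = g :=
  TensorProduct.ext' h

theorem tmul_add (θ : UniversalEnvelopingAlgebra K L) (F G : A) :
    tmul D θ (F + G) = tmul D θ F + tmul D θ G := TensorProduct.tmul_add _ _ _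

theorem add_tmul (θ χ : UniversalEnvelopingAlgebra K L) (F : A) :
    tmul D (θ + χ) F = tmul D θ F + tmul D χ F := TensorProduct.add_tmul _ _ _

theorem sub_tmul (θ χ : UniversalEnvelopingAlgebra K L) (F : A) :
    tmul D (θ - χ) F = tmul D θ F - tmul D χ F := TensorProduct.sub_tmul _ _ _

theorem tmul_sub (θ : UniversalEnvelopingAlgebra K L) (F G : A) :
    tmul D θ (F - G) = tmul D θ F - tmul D θ G := TensorProduct.tmul_sub _ _ _

theorem smul_tmul (c : K) (θ : UniversalEnvelopingAlgebra K L) (F : A) :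
    tmul D (c • θ) F = c • tmul D θ F := TensorProduct.smul_tmul' _ _ _

theorem tmul_smul (c : K) (θ : UniversalEnvelopingAlgebra K L) (F : A) :
    tmul D θ (c • F) = c • tmul D θ F := TensorProduct.tmul_smul _ _ _

/-- `ξ ↦ mulGen ξ` as a Lie algebra homomorphism. -/
def mulGenHom : L →ₗ⁅K⁆ Module.End K (SmashProduct D) where
  toFun := mulGen D
  map_add' ξ η := by
    refine hom_ext D fun θ F => ?_
    simp only [mulGen_tmul, LinearMap.add_apply, map_add, add_mul, add_tmul, Derivation.add_apply,
      tmul_add]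
    abel
  map_smul' c ξ := by
    refine hom_ext D fun θ F => ?_
    simp only [mulGen_tmul, LinearMap.smul_apply, map_smul, smul_mul_assoc, smul_tmul,
      Derivation.smul_apply, tmul_smul, RingHom.id_apply, smul_add]
  map_lie' := by
    intro ξ η
    refine hom_ext D fun θ F => ?_
    simp only [mulGen_tmul, LieRing.of_associative_ring_bracket, LinearMap.sub_apply,
      Module.End.mul_apply, map_add, LieHom.map_lie, Derivation.commutator_apply, sub_mul,
      sub_tmul, tmul_sub, mul_assoc]
    abel

/-- Multiplication by `θ ⊗ 1` from the left, for `θ ∈ U(L)`. -/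
def mulU : UniversalEnvelopingAlgebra K L →ₐ[K] Module.End K (SmashProduct D) :=
  UniversalEnvelopingAlgebra.lift K (mulGenHom D)

theorem mulU_ι (ξ : L) : mulU D (UniversalEnvelopingAlgebra.ι K ξ) = mulGen D ξ :=
  UniversalEnvelopingAlgebra.lift_ι_apply K (mulGenHom D) ξ

/-- The multiplication: `(θ ⊗ F) · y = (1 ⊗ F) · ((θ ⊗ 1) · y)`. -/
def mulHom : SmashProduct D →ₗ[K] Module.End K (SmashProduct D) :=
  TensorProduct.lift
    (((LinearMap.mul K (Module.End K (SmashProduct D))).flip ∘ₗ (mulU D).toLinearMap).compl₂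
      (mulFun D))

instance : Mul (SmashProduct D) := ⟨fun x y => mulHom D x y⟩

instance : One (SmashProduct D) := ⟨tmul D 1 1⟩

theorem mul_def (x y : SmashProduct D) : x * y = mulHom D x y := rfl

theorem one_def : (1 : SmashProduct D) = tmul D 1 1 := rfl

theorem mulHom_tmul (θ : UniversalEnvelopingAlgebra K L) (F : A) :
    mulHom D (tmul D θ F) = mulFun D F * mulU D θ := rfl

theorem mulFun_mul (F G : A) : mulFun D (F * G) = mulFun D F * mulFun D G := by
  refine hom_ext D fun θ H => ?_
  simp only [Module.End.mul_apply, mulFun_tmul, mul_assoc]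

theorem mulFun_one : mulFun D 1 = 1 := by
  refine hom_ext D fun θ H => ?_
  simp only [Module.End.one_apply, mulFun_tmul, one_mul]

theorem mulHom_mulFun (F : A) (y : SmashProduct D) :
    mulHom D (mulFun D F y) = mulFun D F * mulHom D y := by
  induction y using induction_on with
  | h0 => simp
  | ht θ G => rw [mulFun_tmul, mulHom_tmul, mulHom_tmul, mulFun_mul, mul_assoc]
  | ha x y hx hy => simp only [map_add, hx, hy, mul_add]

theorem mulGen_mulFun (ξ : L) (F : A) :
    mulGen D ξ * mulFun D F = mulFun D F * mulGen D ξ + mulFun D (D ξ F) := by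
  refine hom_ext D fun θ H => ?_
  simp only [Module.End.mul_apply, mulFun_tmul, mulGen_tmul, LinearMap.add_apply, map_add,
    Derivation.leibniz, smul_eq_mul, tmul_add]
  rw [mul_comm H]
  abel

theorem mulHom_mulU (θ : UniversalEnvelopingAlgebra K L) (y : SmashProduct D) :
    mulHom D (mulU D θ y) = mulU D θ * mulHom D y := by
  let S : Subalgebra K (UniversalEnvelopingAlgebra K L) :=
    { carrier := {θ | ∀ y, mulHom D (mulU D θ y) = mulU D θ * mulHom D y}
      mul_mem' := by
        intro a b ha hb y
        rw [map_mul, Module.End.mul_apply, ha, hb, mul_assoc]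
      add_mem' := by
        intro a b ha hb y
        rw [map_add, LinearMap.add_apply, map_add, ha, hb, add_mul]
      algebraMap_mem' := by
        intro r y
        rw [AlgHom.commutes, Module.algebraMap_end_apply, map_smul, Algebra.smul_def] }
  have hι : ∀ ξ : L, UniversalEnvelopingAlgebra.ι K ξ ∈ S := by
    intro ξ y
    rw [mulU_ι]
    induction y using induction_on with
    | h0 => simp
    | ht χ G =>
      rw [mulGen_tmul, map_add, mulHom_tmul, mulHom_tmul, mulHom_tmul, map_mul, mulU_ι,
        ← mul_assoc, ← mul_assoc, mulGen_mulFun, add_mul]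
    | ha x y hx hy => simp only [map_add, hx, hy, mul_add]
  exact UniversalEnvelopingAlgebra.mem_of_ι_mem S hι θ y

theorem mulHom_mulHom (x y : SmashProduct D) :
    mulHom D (mulHom D x y) = mulHom D x * mulHom D y := by
  induction x using induction_on with
  | h0 => simp
  | ht θ F =>
    rw [mulHom_tmul, Module.End.mul_apply, mulHom_mulFun, mulHom_mulU, mul_assoc]
  | ha x y hx hy => simp only [map_add, LinearMap.add_apply, hx, hy, add_mul]

theorem mulU_one (θ : UniversalEnvelopingAlgebra K L) : mulU D θ (tmul D 1 1) = tmul D θ 1 := by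
  let T : Subalgebra K (UniversalEnvelopingAlgebra K L) :=
    { carrier := {θ | ∀ χ, mulU D θ (tmul D χ 1) = tmul D (θ * χ) 1}
      mul_mem' := by
        intro a b ha hb χ
        rw [map_mul, Module.End.mul_apply, hb, ha, mul_assoc]
      add_mem' := by
        intro a b ha hb χ
        rw [map_add, LinearMap.add_apply, ha, hb, add_mul, add_tmul]
      algebraMap_mem' := by
        intro r χ
        rw [AlgHom.commutes, Module.algebraMap_end_apply, ← smul_tmul, Algebra.smul_def] }
  have hι : ∀ ξ : L, UniversalEnvelopingAlgebra.ι K ξ ∈ T := by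
    intro ξ χ
    rw [mulU_ι, mulGen_tmul, Derivation.map_one_eq_zero]
    rw [show tmul D χ (0 : A) = 0 from TensorProduct.tmul_zero _ _, add_zero]
  have h3 := UniversalEnvelopingAlgebra.mem_of_ι_mem T hι θ 1
  rw [h3, mul_one]

instance : Ring (SmashProduct D) where
  __ := (inferInstance : AddCommGroup (SmashProduct D))
  left_distrib x y z := by simp only [mul_def, map_add]
  right_distrib x y z := by simp only [mul_def, map_add, LinearMap.add_apply]
  zero_mul x := by simp only [mul_def, map_zero, LinearMap.zero_apply]
  mul_zero x := by simp only [mul_def, map_zero]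
  mul_assoc x y z := by
    simp only [mul_def, mulHom_mulHom, Module.End.mul_apply]
  one_mul x := by
    rw [mul_def, one_def, mulHom_tmul, map_one (mulU D), mulFun_one, mul_one, Module.End.one_apply]
  mul_one x := by
    rw [mul_def, one_def]
    induction x using induction_on with
    | h0 => simp
    | ht θ F => rw [mulHom_tmul, Module.End.mul_apply, mulU_one, mulFun_tmul, mul_one]
    | ha x y hx hy => simp only [map_add, LinearMap.add_apply, hx, hy]

instance : Algebra K (SmashProduct D) :=
  Algebra.ofModule
    (fun c x y => by simp only [mul_def, map_smul, LinearMap.smul_apply])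
    (fun c x y => by simp only [mul_def, map_smul])

/-- The elements `1 ⊗ F`. -/
def ofFun (F : A) : SmashProduct D := tmul D 1 F

/-- The elements `ξ ⊗ 1`, `ξ ∈ L`. -/
def ofLie (ξ : L) : SmashProduct D := tmul D (UniversalEnvelopingAlgebra.ι K ξ) 1

/-- The defining multiplication law `(ξ ⊗ F)(η ⊗ G) = ξη ⊗ FG + η ⊗ F D_ξ G`. -/
theorem tmul_mul_tmul (ξ η : L) (F G : A) :
    tmul D (UniversalEnvelopingAlgebra.ι K ξ) F * tmul D (UniversalEnvelopingAlgebra.ι K η) G =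
      tmul D (UniversalEnvelopingAlgebra.ι K ξ * UniversalEnvelopingAlgebra.ι K η) (F * G) +
        tmul D (UniversalEnvelopingAlgebra.ι K η) (F * D ξ G) := by
  rw [mul_def, mulHom_tmul, mulU_ι, Module.End.mul_apply, mulGen_tmul, map_add, mulFun_tmul,
    mulFun_tmul]

end SmashProduct

end Smash

section Smash

variable {K L A : Type*} [CommRing K] [LieRing L] [LieAlgebra K L] [CommRing A] [Algebra K A]

/-- The canonical filtration of `U(L)`: noncommutative polynomials of degree at most `k` in the
elements of `L`. -/
def UniversalEnvelopingAlgebra.filtration (K L : Type*) [CommRing K] [LieRing L] [LieAlgebra K L]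
    (k : ℕ) : Submodule K (UniversalEnvelopingAlgebra K L) :=
  (1 ⊔ LinearMap.range (UniversalEnvelopingAlgebra.ι K : L →ₗ⁅K⁆ _).toLinearMap) ^ k

namespace SmashProduct

variable (D : L →ₗ⁅K⁆ Derivation K A A)

/-- The filtration of `U(L) ⋉ A` with `k`-th term `U(L)^(k) ⊗ A`. -/
def filtration (k : ℕ) : Submodule K (SmashProduct D) :=
  Submodule.span K
    {x | ∃ θ ∈ UniversalEnvelopingAlgebra.filtration K L k, ∃ F : A, x = tmul D θ F}

theorem ofFun_mem (F : A) : ofFun D F ∈ filtration D 1 :=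
  Submodule.subset_span ⟨1, by
    rw [UniversalEnvelopingAlgebra.filtration, pow_one]
    exact Submodule.mem_sup_left (Submodule.one_le.mp le_rfl), F, rfl⟩

theorem tmul_ι_mem (ξ : L) (F : A) :
    tmul D (UniversalEnvelopingAlgebra.ι K ξ) F ∈ filtration D 1 :=
  Submodule.subset_span ⟨_, by
    rw [UniversalEnvelopingAlgebra.filtration, pow_one]
    exact Submodule.mem_sup_right ⟨ξ, rfl⟩, F, rfl⟩

theorem filtration_one_le {p : Submodule K (SmashProduct D)} (h0 : ∀ F, ofFun D F ∈ p)
    (h1 : ∀ ξ F, tmul D (UniversalEnvelopingAlgebra.ι K ξ) F ∈ p) : filtration D 1 ≤ p := by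
  refine Submodule.span_le.mpr ?_
  rintro _ ⟨θ, hθ, F, rfl⟩
  rw [UniversalEnvelopingAlgebra.filtration, pow_one] at hθ
  obtain ⟨a, ha, b, ⟨ξ, rfl⟩, rfl⟩ := Submodule.mem_sup.mp hθ
  obtain ⟨c, rfl⟩ := Submodule.mem_one.mp ha
  rw [SetLike.mem_coe, add_tmul, Algebra.algebraMap_eq_smul_one, smul_tmul]
  exact p.add_mem (p.smul_mem _ (h0 F)) (h1 ξ F)

theorem ofFun_mul_tmul (F G : A) (θ : UniversalEnvelopingAlgebra K L) :
    ofFun D F * tmul D θ G = tmul D θ (F * G) := by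
  rw [mul_def, ofFun, mulHom_tmul, map_one (mulU D), mul_one, mulFun_tmul]

theorem tmul_ι_mul_ofFun (ξ : L) (F G : A) :
    tmul D (UniversalEnvelopingAlgebra.ι K ξ) F * ofFun D G =
      tmul D (UniversalEnvelopingAlgebra.ι K ξ) (F * G) + ofFun D (F * D ξ G) := by
  rw [mul_def, ofFun, ofFun, mulHom_tmul, mulU_ι, Module.End.mul_apply, mulGen_tmul, map_add,
    mulFun_tmul, mulFun_tmul, mul_one]

theorem lie_mem_filtration_one {x y : SmashProduct D} (hx : x ∈ filtration D 1)
    (hy : y ∈ filtration D 1) : ⁅x, y⁆ ∈ filtration D 1 := by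
  have key : filtration D 1 ≤
      { carrier := {x | ∀ y ∈ filtration D 1, ⁅x, y⁆ ∈ filtration D 1}
        add_mem' := fun ha hb y hy => by
          rw [add_lie]; exact add_mem (ha y hy) (hb y hy)
        zero_mem' := fun y _ => by rw [zero_lie]; exact zero_mem _
        smul_mem' := fun c x hx y hy => by
          rw [smul_lie]; exact Submodule.smul_mem _ _ (hx y hy) } := by
    refine filtration_one_le D (fun F y hy => ?_) (fun ξ F y hy => ?_)
    · revert y
      change filtration D 1 ≤ (filtration D 1).comap (LieAlgebra.ad K _ (ofFun D F))
      refine filtration_one_le D (fun G => ?_) (fun η G => ?_)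
      · rw [Submodule.mem_comap, LieAlgebra.ad_apply, LieRing.of_associative_ring_bracket]
        have h : ofFun D F * ofFun D G - ofFun D G * ofFun D F = 0 := by
          change ofFun D F * tmul D 1 G - ofFun D G * tmul D 1 F = 0
          rw [ofFun_mul_tmul, ofFun_mul_tmul, mul_comm F G, sub_self]
        rw [h]; exact zero_mem _
      · rw [Submodule.mem_comap, LieAlgebra.ad_apply, LieRing.of_associative_ring_bracket, ofFun_mul_tmul, tmul_ι_mul_ofFun]
        exact sub_mem (tmul_ι_mem D _ _) (add_mem (tmul_ι_mem D _ _) (ofFun_mem D _))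
    · revert y
      change filtration D 1 ≤ (filtration D 1).comap
        (LieAlgebra.ad K _ (tmul D (UniversalEnvelopingAlgebra.ι K ξ) F))
      refine filtration_one_le D (fun G => ?_) (fun η G => ?_)
      · rw [Submodule.mem_comap, LieAlgebra.ad_apply, LieRing.of_associative_ring_bracket, ofFun_mul_tmul, tmul_ι_mul_ofFun]
        exact sub_mem (add_mem (tmul_ι_mem D _ _) (ofFun_mem D _)) (tmul_ι_mem D _ _)
      · rw [Submodule.mem_comap, LieAlgebra.ad_apply, LieRing.of_associative_ring_bracket, tmul_mul_tmul, tmul_mul_tmul, mul_comm G F,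
          add_sub_add_comm, ← sub_tmul, ← LieRing.of_associative_ring_bracket,
          ← LieHom.map_lie]
        exact add_mem (tmul_ι_mem D _ _) (sub_mem (tmul_ι_mem D _ _) (tmul_ι_mem D _ _))
  exact key hx y hy

/-- The first filtration step, as a Lie algebra with respect to the commutator. -/
def degreeLeOne : LieSubalgebra K (SmashProduct D) :=
  { filtration D 1 with lie_mem' := fun hx hy => lie_mem_filtration_one D hx hy }

end SmashProduct

end Smash

/-! ## Rescaling the bracket of a Lie algebra -/

/-- The module `L` with the Lie bracket `c • [x, y]`. -/
def ScaledLie {K : Type*} (_c : K) (L : Type*) : Type _ := L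

namespace ScaledLie

variable {K : Type*} [CommRing K] (c : K) (L : Type*) [LieRing L] [LieAlgebra K L]

instance : AddCommGroup (ScaledLie c L) := inferInstanceAs (AddCommGroup L)

instance : Module K (ScaledLie c L) := inferInstanceAs (Module K L)

/-- The identity map `L → ScaledLie c L`. -/
def of : L ≃ₗ[K] ScaledLie c L := LinearEquiv.refl K L

instance : Bracket (ScaledLie c L) (ScaledLie c L) :=
  ⟨fun x y => of c L (c • ⁅(of c L).symm x, (of c L).symm y⁆)⟩

theorem bracket_def (x y : ScaledLie c L) :
    ⁅x, y⁆ = of c L (c • ⁅(of c L).symm x, (of c L).symm y⁆) := rfl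

instance : LieRing (ScaledLie c L) where
  add_lie x y z := by simp only [bracket_def, map_add, add_lie, smul_add]
  lie_add x y z := by simp only [bracket_def, map_add, lie_add, smul_add]
  lie_self x := by simp only [bracket_def, lie_self, smul_zero, map_zero]
  leibniz_lie x y z := by
    simp only [bracket_def, LinearEquiv.symm_apply_apply, ← map_add, lie_smul, smul_lie,
      ← smul_add]
    rw [← leibniz_lie]

instance : LieAlgebra K (ScaledLie c L) where
  lie_smul t x y := by
    simp only [bracket_def, map_smul, lie_smul, smul_comm c t]

end ScaledLie

/-! ## Finite powers of a manifold -/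

section Pi

variable {E : Type*} [NormedAddCommGroup E] [NormedSpace ℝ E]
  {G : Type*} [TopologicalSpace G] [ChartedSpace E G] {ι : Type*} [Fintype ι]

/-- The model with corners of the manifold `ι → G`, where `G` is modelled on `E`. -/
abbrev powModel (E : Type*) [NormedAddCommGroup E] [NormedSpace ℝ E] (ι : Type*) [Fintype ι] :
    ModelWithCorners ℝ (ι → E) (ModelPi fun _ : ι => E) :=
  ModelWithCorners.pi fun _ : ι => 𝓘(ℝ, E)

theorem contMDiff_pow_proj (i : ι) :
    ContMDiff (powModel E ι) 𝓘(ℝ, E) ∞ (fun u : ι → G => u i) := by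
  intro x
  rw [contMDiffAt_iff]
  refine ⟨(continuous_apply i).continuousAt, ?_⟩
  have hp : ContDiff ℝ ∞ (fun v : ι → E => v i) := contDiff_apply ℝ E i
  refine hp.contDiffWithinAt.congr_of_eventuallyEq (f₁ := _) ?_ ?_
  · have h1 : ∀ᶠ v in 𝓝 (extChartAt (powModel E ι) x x),
        v i ∈ (extChartAt 𝓘(ℝ, E) (x i)).target :=
      (continuous_apply i).continuousAt.eventually
        (extChartAt_target_mem_nhds (I := 𝓘(ℝ, E)) (x i))
    refine (h1.filter_mono nhdsWithin_le_nhds).mono fun v hv => ?_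
    exact (extChartAt 𝓘(ℝ, E) (x i)).right_inv hv
  · exact (extChartAt 𝓘(ℝ, E) (x i)).right_inv (mem_extChartAt_target (I := 𝓘(ℝ, E)) (x i))

theorem contMDiff_powMk {E' : Type*} [NormedAddCommGroup E'] [NormedSpace ℝ E'] {H' : Type*}
    [TopologicalSpace H'] {J : ModelWithCorners ℝ E' H'} {M : Type*} [TopologicalSpace M]
    [ChartedSpace H' M] {f : M → ι → G}
    (hf : ∀ i, ContMDiff J 𝓘(ℝ, E) ∞ fun x => f x i) :
    ContMDiff J (powModel E ι) ∞ f := by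
  intro x
  rw [contMDiffAt_iff]
  refine ⟨continuousAt_pi.mpr fun i => (hf i x).continuousAt, ?_⟩
  refine contDiffWithinAt_pi.mpr fun i => ?_
  exact (contMDiffAt_iff.mp (hf i x)).2

/-- Replacing one component is smooth. -/
theorem contMDiff_update [DecidableEq ι] {E' : Type*} [NormedAddCommGroup E'] [NormedSpace ℝ E']
    {H' : Type*} [TopologicalSpace H'] {J : ModelWithCorners ℝ E' H'} {M : Type*}
    [TopologicalSpace M] [ChartedSpace H' M] {f : M → ι → G} {g : M → G}
    (hf : ContMDiff J (powModel E ι) ∞ f) (hg : ContMDiff J 𝓘(ℝ, E) ∞ g) (i : ι) :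
    ContMDiff J (powModel E ι) ∞ fun x => Function.update (f x) i (g x) := by
  refine contMDiff_powMk fun j => ?_
  by_cases h : j = i
  · subst h; simpa using hg
  · simp only [Function.update_of_ne h]
    exact (contMDiff_pow_proj j).comp hf

theorem isManifold_pow [IsManifold 𝓘(ℝ, E) ∞ G] : IsManifold (powModel E ι) ∞ (ι → G) := by
  refine isManifold_of_contDiffOn _ _ _ ?_
  rintro _ _ ⟨e, he, rfl⟩ ⟨e', he', rfl⟩
  refine contDiffOn_pi.mpr fun i => ?_
  have h := (contDiffGroupoid ∞ 𝓘(ℝ, E)).compatible (he i trivial) (he' i trivial)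
  rw [contDiffGroupoid, mem_groupoid_of_pregroupoid] at h
  have h1 : ContDiffOn ℝ ∞ (fun v : ι → E => v i) Set.univ := (contDiff_apply ℝ E i).contDiffOn
  refine h.1.comp (h1.mono (Set.subset_univ _)) ?_
  rintro v ⟨hv, -⟩
  exact ⟨⟨hv.1 i trivial, hv.2 i trivial⟩, ⟨v i, rfl⟩⟩

end Pi

/-! ## Derivatives along one-parameter directions in a Lie group -/

theorem inTangentCoordinates_const_fun {E : Type*} [NormedAddCommGroup E] [NormedSpace ℝ E]
    {G : Type*} [TopologicalSpace G] [ChartedSpace E G] {M : Type*} [IsManifold 𝓘(ℝ, E) 1 G] (p : G)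
    (g : M → ℂ)
    (ϕ : M → E →L[ℝ] ℂ) (x₀ x : M) :
    inTangentCoordinates 𝓘(ℝ, E) 𝓘(ℝ, ℂ) (fun _ => p) g ϕ x₀ x = ϕ x := by
  rw [inTangentCoordinates_eq (x₀ := x₀) (x := x) (fun _ => p) g ϕ (mem_chart_source E p)
    (by rw [chartAt_self_eq]; trivial)]
  ext v
  change (tangentBundleCore 𝓘(ℝ, ℂ) ℂ).coordChange _ _ _
    (ϕ x ((tangentBundleCore 𝓘(ℝ, E) G).coordChange _ _ _ v)) = ϕ x v
  rw [(tangentBundleCore 𝓘(ℝ, E) G).coordChange_self _ _ (mem_chart_source E p),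
    tangentBundleCore_coordChange_model_space]
  rfl

section Deriv

variable {E : Type*} [NormedAddCommGroup E] [NormedSpace ℝ E]
  {G : Type*} [TopologicalSpace G] [ChartedSpace E G] [Group G] [LieGroup 𝓘(ℝ, E) ∞ G]
  {E' : Type*} [NormedAddCommGroup E'] [NormedSpace ℝ E'] {H' : Type*}
    [TopologicalSpace H'] {J : ModelWithCorners ℝ E' H'} {M : Type*} [TopologicalSpace M]
    [ChartedSpace H' M]

/-- The derivative at the unit, `d/dt|₀ φ(e^{ta})`, of a function on a Lie group. -/
def derivOne (φ : G → ℂ) (a : GroupLieAlgebra 𝓘(ℝ, E) G) : ℂ :=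
  mfderiv 𝓘(ℝ, E) 𝓘(ℝ, ℂ) φ (1 : G) a

theorem contMDiff_derivOne [IsManifold J 1 M] {Φ : M → G → ℂ}
    (hΦ : ContMDiff (J.prod 𝓘(ℝ, E)) 𝓘(ℝ, ℂ) ∞ (Function.uncurry Φ))
    (a : GroupLieAlgebra 𝓘(ℝ, E) G) :
    ContMDiff J 𝓘(ℝ, ℂ) ∞ fun x => derivOne (Φ x) a := by
  intro x₀
  have : IsManifold 𝓘(ℝ, E) 1 G := inferInstance
  have h := ContMDiffAt.mfderiv (I := 𝓘(ℝ, E)) (I' := 𝓘(ℝ, ℂ)) (J := J) (m := ∞) (n := ∞)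
    (x₀ := x₀) Φ (fun _ => (1 : G)) (hΦ (x₀, 1)) contMDiffAt_const (by simp)
  let a' : E := a
  have h2 := h.clm_apply (contMDiffAt_const (c := a'))
  refine h2.congr_of_eventuallyEq (Filter.Eventually.of_forall fun x => ?_)
  exact (DFunLike.congr_fun (inTangentCoordinates_const_fun (E := E) (G := G) (1 : G) (fun x => Φ x 1)
    (fun x => (mfderiv 𝓘(ℝ, E) 𝓘(ℝ, ℂ) (Φ x) (1 : G) :)) x₀ x) a').symm

end Deriv

/-! ## The Lie bracket of left-invariant derivatives -/

section Bracket

instance lieGroup_minSmoothness (E : Type*) [NormedAddCommGroup E] [NormedSpace ℝ E]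
    (G : Type*) [TopologicalSpace G] [ChartedSpace E G] [Group G] [LieGroup 𝓘(ℝ, E) ∞ G] :
    LieGroup 𝓘(ℝ, E) (minSmoothness ℝ 3) G := by
  rw [minSmoothness_of_isRCLikeNormedField]
  infer_instance

theorem fderiv_fderiv_apply {E : Type*} [NormedAddCommGroup E] [NormedSpace ℝ E] {ψ : E → ℂ}
    {W : E → E} {x : E} (hψ : ContDiffAt ℝ 2 ψ x) (hW : DifferentiableAt ℝ W x) (v : E) :
    fderiv ℝ (fun y => fderiv ℝ ψ y (W y)) x v =
      fderiv ℝ (fderiv ℝ ψ) x v (W x) + fderiv ℝ ψ x (fderiv ℝ W x v) := by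
  have h1 : DifferentiableAt ℝ (fderiv ℝ ψ) x :=
    (hψ.fderiv_right (m := 1) (by norm_num)).differentiableAt (by norm_num)
  rw [(h1.hasFDerivAt.clm_apply hW.hasFDerivAt).fderiv]
  simp [add_comm]

variable {E : Type*} [NormedAddCommGroup E] [NormedSpace ℝ E]
  {G : Type*} [TopologicalSpace G] [ChartedSpace E G] [Group G] [LieGroup 𝓘(ℝ, E) ∞ G]

theorem derivOne_eq_fderiv {φ : G → ℂ} (hφ : MDifferentiableAt 𝓘(ℝ, E) 𝓘(ℝ, ℂ) φ 1) (a : E) :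
    derivOne (E := E) φ a = fderiv ℝ (φ ∘ (extChartAt 𝓘(ℝ, E) (1 : G)).symm)
      (extChartAt 𝓘(ℝ, E) (1 : G) 1) a := by
  refine (DFunLike.congr_fun hφ.mfderiv a).trans ?_
  simp only [modelWithCornersSelf_coe, Set.range_id, fderivWithin_univ]
  rfl

theorem contDiffAt_comp_chart_symm {φ : G → ℂ} (hφ : ContMDiff 𝓘(ℝ, E) 𝓘(ℝ, ℂ) ∞ φ) {x : E}
    (hx : x ∈ (extChartAt 𝓘(ℝ, E) (1 : G)).target) :
    ContDiffAt ℝ ∞ (φ ∘ (extChartAt 𝓘(ℝ, E) (1 : G)).symm) x := by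
  have h1 := (contMDiffOn_extChartAt_symm (I := 𝓘(ℝ, E)) (n := ∞) (1 : G)).contMDiffAt
    ((isOpen_extChartAt_target (I := 𝓘(ℝ, E)) (1 : G)).mem_nhds hx)
  exact contMDiffAt_iff_contDiffAt.mp ((hφ _).comp x h1)

theorem derivOne_mul_left_eq {φ : G → ℂ} (hφ : ContMDiff 𝓘(ℝ, E) 𝓘(ℝ, ℂ) ∞ φ) {x : E}
    (hx : x ∈ (extChartAt 𝓘(ℝ, E) (1 : G)).target) (b : GroupLieAlgebra 𝓘(ℝ, E) G) :
    derivOne (fun h => φ ((extChartAt 𝓘(ℝ, E) (1 : G)).symm x * h)) b =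
      fderiv ℝ (φ ∘ (extChartAt 𝓘(ℝ, E) (1 : G)).symm) x
        (VectorField.mpullbackWithin 𝓘(ℝ, E) 𝓘(ℝ, E) (extChartAt 𝓘(ℝ, E) (1 : G)).symm
          (mulInvariantVectorField b) (Set.range 𝓘(ℝ, E)) x) := by
  set σ := (extChartAt 𝓘(ℝ, E) (1 : G)).symm
  have hd : ∀ y, MDifferentiableAt 𝓘(ℝ, E) 𝓘(ℝ, ℂ) φ y := fun y =>
    (hφ y).mdifferentiableAt (by simp)
  have hσ : MDifferentiableWithinAt 𝓘(ℝ, E) 𝓘(ℝ, E) σ (Set.range 𝓘(ℝ, E)) x :=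
    mdifferentiableWithinAt_extChartAt_symm hx
  have h1 : derivOne (fun h => φ (σ x * h)) b =
      mfderiv 𝓘(ℝ, E) 𝓘(ℝ, ℂ) φ (σ x) (mulInvariantVectorField b (σ x)) := by
    have key : ∀ y z : G, y = z → HasMFDerivAt 𝓘(ℝ, E) 𝓘(ℝ, ℂ) φ z
        (mfderiv 𝓘(ℝ, E) 𝓘(ℝ, ℂ) φ y : E →L[ℝ] ℂ) := by
      rintro y _ rfl
      exact (hd y).hasMFDerivAt
    have h := (key (σ x) (σ x * 1) (mul_one _).symm).comp (1 : G)
      ((contMDiff_mul_left (I := 𝓘(ℝ, E)) (n := ∞) (a := σ x)).mdifferentiableAt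
        (by simp)).hasMFDerivAt
    exact DFunLike.congr_fun h.mfderiv b
  have h2 : fderiv ℝ (φ ∘ σ) x = (mfderiv 𝓘(ℝ, E) 𝓘(ℝ, ℂ) φ (σ x)).comp
      (mfderivWithin 𝓘(ℝ, E) 𝓘(ℝ, E) σ (Set.range 𝓘(ℝ, E)) x) := by
    have h := (hd (σ x)).hasMFDerivAt.comp_hasMFDerivWithinAt x hσ.hasMFDerivWithinAt
    let A : E →L[ℝ] ℂ := (mfderiv 𝓘(ℝ, E) 𝓘(ℝ, ℂ) φ (σ x)).comp
      (mfderivWithin 𝓘(ℝ, E) 𝓘(ℝ, E) σ (Set.range 𝓘(ℝ, E)) x)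
    have h' : HasFDerivWithinAt (φ ∘ σ) A (Set.range 𝓘(ℝ, E)) x :=
      hasMFDerivWithinAt_iff_hasFDerivWithinAt.mp h
    exact (h'.hasFDerivAt (by simp)).fderiv
  have h3 := @isInvertible_mfderivWithin_extChartAt_symm ℝ _ E _ _ E _ 𝓘(ℝ, E) G _ _ _ 1 x hx
  rw [h1, h2]
  have h4 : ∀ (B : E →L[ℝ] E) (w : E), B.IsInvertible → B (B.inverse w) = w :=
    fun B w hB => hB.self_apply_inverse w
  exact congrArg (mfderiv 𝓘(ℝ, E) 𝓘(ℝ, ℂ) φ (σ x))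
    (h4 (mfderivWithin 𝓘(ℝ, E) 𝓘(ℝ, E) σ (Set.range 𝓘(ℝ, E)) x :)
      (mulInvariantVectorField b (σ x)) h3).symm

/-- `φ ↦ (d/dt φ(· e^{ta}))|₁` turns the Lie bracket into the commutator. -/
theorem derivOne_bracket [CompleteSpace E] {φ : G → ℂ} (hφ : ContMDiff 𝓘(ℝ, E) 𝓘(ℝ, ℂ) ∞ φ)
    (a b : GroupLieAlgebra 𝓘(ℝ, E) G) :
    derivOne (fun g => derivOne (fun h => φ (g * h)) b) a -
      derivOne (fun g => derivOne (fun h => φ (g * h)) a) b = derivOne φ ⁅a, b⁆ := by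
  set σ := (extChartAt 𝓘(ℝ, E) (1 : G)).symm with hσ
  set e := extChartAt 𝓘(ℝ, E) (1 : G) 1 with he
  let W : GroupLieAlgebra 𝓘(ℝ, E) G → E → E := fun b =>
    VectorField.mpullbackWithin 𝓘(ℝ, E) 𝓘(ℝ, E) σ (mulInvariantVectorField b)
      (Set.range 𝓘(ℝ, E))
  have hd : ∀ y, MDifferentiableAt 𝓘(ℝ, E) 𝓘(ℝ, ℂ) φ y := fun y =>
    (hφ y).mdifferentiableAt (by simp)
  have hset : (extChartAt 𝓘(ℝ, E) (1 : G)).symm ⁻¹' Set.univ ∩ Set.range 𝓘(ℝ, E) = Set.univ := by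
    simp
  have hW : ∀ b, DifferentiableAt ℝ (W b) e := by
    intro b
    have h := MDifferentiableWithinAt.differentiableWithinAt_mpullbackWithin_vectorField
      (I := 𝓘(ℝ, E)) (s := Set.univ) (x := (1 : G))
      (mdifferentiableAt_mulInvariantVectorField b).mdifferentiableWithinAt
    rw [hset] at h
    exact differentiableWithinAt_univ.mp h
  have hWe : ∀ b, W b e = b := by
    intro b
    have h1 : (extChartAt 𝓘(ℝ, E) (1 : G)).symm e = 1 := extChartAt_to_inv (1 : G)
    have h2 : (mulInvariantVectorField b (σ e) : E) = b := by
      rw [hσ, h1]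
      have h4 : (fun h : G => (1 : G) * h) = id := by ext; simp
      change (mfderiv 𝓘(ℝ, E) 𝓘(ℝ, E) (fun h : G => (1 : G) * h) (1 : G) : E → E) b = b
      rw [h4, mfderiv_id]
      rfl
    have h3 := mfderivWithin_extChartAt_symm_inverse_apply (I := 𝓘(ℝ, E)) (x := (1 : G)) b
    refine Eq.trans ?_ h3
    exact congrArg _ h2
  have hmul : ContMDiff (𝓘(ℝ, E).prod 𝓘(ℝ, E)) 𝓘(ℝ, ℂ) ∞ fun p : G × G => φ (p.1 * p.2) :=
    hφ.comp (contMDiff_mul 𝓘(ℝ, E) ∞)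
  have hsm : ∀ b, ContMDiff 𝓘(ℝ, E) 𝓘(ℝ, ℂ) ∞ fun g => derivOne (fun h => φ (g * h)) b :=
    fun b => contMDiff_derivOne (Φ := fun g h => φ (g * h)) hmul b
  have hψ : ContDiffAt ℝ ∞ (φ ∘ σ) e :=
    contDiffAt_comp_chart_symm hφ (mem_extChartAt_target (I := 𝓘(ℝ, E)) (1 : G))
  have key : ∀ a b : GroupLieAlgebra 𝓘(ℝ, E) G,
      derivOne (fun g => derivOne (fun h => φ (g * h)) b) a =
        fderiv ℝ (fderiv ℝ (φ ∘ σ)) e (W a e) (W b e) +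
          fderiv ℝ (φ ∘ σ) e (fderiv ℝ (W b) e (W a e)) := by
    intro a b
    rw [← fderiv_fderiv_apply (hψ.of_le (by norm_cast)) (hW b), hWe]
    refine (derivOne_eq_fderiv ((hsm b 1).mdifferentiableAt (by simp)) a).trans ?_
    have : ((fun g => derivOne (fun h => φ (g * h)) b) ∘ σ) =ᶠ[𝓝 e]
        fun y => fderiv ℝ (φ ∘ σ) y (W b y) := by
      filter_upwards [extChartAt_target_mem_nhds (I := 𝓘(ℝ, E)) (1 : G)] with x hx
      exact derivOne_mul_left_eq hφ hx b
    rw [this.fderiv_eq]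
  have hsymm : fderiv ℝ (fderiv ℝ (φ ∘ σ)) e (W a e) (W b e) =
      fderiv ℝ (fderiv ℝ (φ ∘ σ)) e (W b e) (W a e) :=
    (hψ.isSymmSndFDerivAt (by simp; norm_cast)).eq _ _
  rw [key, key, hsymm, add_sub_add_left_eq_sub, ← map_sub]
  refine Eq.trans ?_ (derivOne_eq_fderiv (hd 1) (⁅a, b⁆ : GroupLieAlgebra 𝓘(ℝ, E) G)).symm
  congr 1
  have hid : ∀ (B : E →L[ℝ] E) (w : E), B = ContinuousLinearMap.id ℝ E → B.inverse w = w := by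
    rintro _ w rfl
    rw [ContinuousLinearMap.inverse_id]
    rfl
  refine Eq.trans ?_ (hid (mfderiv 𝓘(ℝ, E) 𝓘(ℝ, E) (extChartAt 𝓘(ℝ, E) (1 : G)) (1 : G) :)
    (VectorField.lieBracketWithin ℝ (W a) (W b)
      ((extChartAt 𝓘(ℝ, E) (1 : G)).symm ⁻¹' Set.univ ∩ Set.range 𝓘(ℝ, E)) e)
    mfderiv_extChartAt_self).symm
  rw [hset, VectorField.lieBracketWithin_univ, VectorField.lieBracket]

end Bracket

section Commute

theorem fderiv_partial_comm {E : Type*} [NormedAddCommGroup E] [NormedSpace ℝ E] {Ψ : E × E → ℂ}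
    {e : E} (hΨ : ContDiffAt ℝ ∞ Ψ (e, e)) (a b : E) :
    fderiv ℝ (fun x => fderiv ℝ (fun y => Ψ (x, y)) e b) e a =
      fderiv ℝ (fun y => fderiv ℝ (fun x => Ψ (x, y)) e a) e b := by
  have h1 : DifferentiableAt ℝ (fderiv ℝ Ψ) (e, e) :=
    ((hΨ.of_le (by norm_cast : (2 : WithTop ℕ∞) ≤ ∞)).fderiv_right (m := 1)
      (by norm_num)).differentiableAt (by norm_num)
  have hev : ∀ᶠ p in 𝓝 (e, e), DifferentiableAt ℝ Ψ p := by
    filter_upwards [(hΨ.of_le (by norm_cast : (1 : WithTop ℕ∞) ≤ ∞)).eventually (by simp)] with p hp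
    exact hp.differentiableAt (by norm_num)
  have hl : HasFDerivAt (fun x : E => (x, e)) (ContinuousLinearMap.inl ℝ E E) e :=
    hasFDerivAt_prodMk_left e e
  have hr : HasFDerivAt (fun y : E => (e, y)) (ContinuousLinearMap.inr ℝ E E) e :=
    hasFDerivAt_prodMk_right e e
  have e1 : (fun x => fderiv ℝ (fun y => Ψ (x, y)) e b) =ᶠ[𝓝 e]
      fun x => fderiv ℝ Ψ (x, e) (0, b) := by
    filter_upwards [hl.continuousAt.eventually hev] with x hx
    have := HasFDerivAt.comp (f := fun y => (x, y)) (g := Ψ) e hx.hasFDerivAt (hasFDerivAt_prodMk_right x e)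
    exact DFunLike.congr_fun this.fderiv b
  have e2 : (fun y => fderiv ℝ (fun x => Ψ (x, y)) e a) =ᶠ[𝓝 e]
      fun y => fderiv ℝ Ψ (e, y) (a, 0) := by
    filter_upwards [hr.continuousAt.eventually hev] with y hy
    have := HasFDerivAt.comp (f := fun x => (x, y)) (g := Ψ) e hy.hasFDerivAt (hasFDerivAt_prodMk_left e y)
    exact DFunLike.congr_fun this.fderiv a
  rw [e1.fderiv_eq, e2.fderiv_eq]
  have d1 := HasFDerivAt.comp (f := fun x => (x, e)) (g := fderiv ℝ Ψ) e h1.hasFDerivAt hl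
  have d2 := HasFDerivAt.comp (f := fun y => (e, y)) (g := fderiv ℝ Ψ) e h1.hasFDerivAt hr
  have q1 := (d1.clm_apply (hasFDerivAt_const ((0 : E), b) e)).fderiv
  have q2 := (d2.clm_apply (hasFDerivAt_const (a, (0 : E)) e)).fderiv
  refine (DFunLike.congr_fun q1 a).trans (Eq.trans ?_ (DFunLike.congr_fun q2 b).symm)
  have := (hΨ.isSymmSndFDerivAt (by simp; norm_cast)).eq (a, 0) (0, b)
  simpa using this

variable {E : Type*} [NormedAddCommGroup E] [NormedSpace ℝ E]
  {G : Type*} [TopologicalSpace G] [ChartedSpace E G] [Group G] [LieGroup 𝓘(ℝ, E) ∞ G]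

/-- Derivatives in different variables commute. -/
theorem derivOne_comm {Φ : G → G → ℂ}
    (hΦ : ContMDiff (𝓘(ℝ, E).prod 𝓘(ℝ, E)) 𝓘(ℝ, ℂ) ∞ (Function.uncurry Φ))
    (a b : GroupLieAlgebra 𝓘(ℝ, E) G) :
    derivOne (fun g => derivOne (Φ g) b) a =
      derivOne (fun h => derivOne (fun g => Φ g h) a) b := by
  set σ := (extChartAt 𝓘(ℝ, E) (1 : G)).symm with hσ
  set e := extChartAt 𝓘(ℝ, E) (1 : G) 1 with he
  have hσe : σ e = 1 := extChartAt_to_inv (1 : G)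
  have h1 : ∀ g, ContMDiff 𝓘(ℝ, E) 𝓘(ℝ, ℂ) ∞ (Φ g) := fun g =>
    hΦ.comp (contMDiff_const.prodMk contMDiff_id)
  have hswap : ContMDiff (𝓘(ℝ, E).prod 𝓘(ℝ, E)) 𝓘(ℝ, ℂ) ∞
      (Function.uncurry fun h g => Φ g h) :=
    hΦ.comp (contMDiff_snd.prodMk contMDiff_fst)
  have h2 : ∀ h, ContMDiff 𝓘(ℝ, E) 𝓘(ℝ, ℂ) ∞ (fun g => Φ g h) := fun h =>
    hΦ.comp (contMDiff_id.prodMk contMDiff_const)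
  have d1 : ContMDiff 𝓘(ℝ, E) 𝓘(ℝ, ℂ) ∞ fun g => derivOne (Φ g) b := contMDiff_derivOne hΦ b
  have d2 : ContMDiff 𝓘(ℝ, E) 𝓘(ℝ, ℂ) ∞ fun h => derivOne (fun g => Φ g h) a :=
    contMDiff_derivOne hswap a
  have hσs : ContMDiffAt 𝓘(ℝ, E) 𝓘(ℝ, E) ∞ σ e :=
    (contMDiffOn_extChartAt_symm (I := 𝓘(ℝ, E)) (n := ∞) (1 : G)).contMDiffAt
      (extChartAt_target_mem_nhds (I := 𝓘(ℝ, E)) (1 : G))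
  have hΨ : ContDiffAt ℝ ∞ (fun p : E × E => Φ (σ p.1) (σ p.2)) (e, e) := by
    have hp : ContMDiffAt 𝓘(ℝ, E × E) (𝓘(ℝ, E).prod 𝓘(ℝ, E)) ∞
        (fun p : E × E => (σ p.1, σ p.2)) (e, e) := by
      refine ContMDiffAt.prodMk ?_ ?_
      · exact ContMDiffAt.comp (e, e) (g := σ) (f := Prod.fst) hσs
          (contDiff_fst.contMDiff.contMDiffAt)
      · exact ContMDiffAt.comp (e, e) (g := σ) (f := Prod.snd) hσs
          (contDiff_snd.contMDiff.contMDiffAt)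
    exact contMDiffAt_iff_contDiffAt.mp ((hΦ _).comp (e, e) hp)
  have k1 := (derivOne_eq_fderiv ((d1 1).mdifferentiableAt (by simp)) a)
  have k2 := (derivOne_eq_fderiv ((d2 1).mdifferentiableAt (by simp)) b)
  refine k1.trans (Eq.trans ?_ k2.symm)
  have f1 : (fun g => derivOne (Φ g) b) ∘ σ =
      fun x => fderiv ℝ (fun y => Φ (σ x) (σ y)) e b := by
    funext x
    exact derivOne_eq_fderiv ((h1 (σ x) 1).mdifferentiableAt (by simp)) b
  have f2 : (fun h => derivOne (fun g => Φ g h) a) ∘ σ =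
      fun y => fderiv ℝ (fun x => Φ (σ x) (σ y)) e a := by
    funext y
    exact derivOne_eq_fderiv ((h2 (σ y) 1).mdifferentiableAt (by simp)) a
  rw [f1, f2]
  exact fderiv_partial_comm hΨ a b

end Commute

section Calculus

variable {E : Type*} [NormedAddCommGroup E] [NormedSpace ℝ E]
  {G : Type*} [TopologicalSpace G] [ChartedSpace E G] [Group G] [LieGroup 𝓘(ℝ, E) ∞ G]

theorem derivOne_add_fun {φ ψ : G → ℂ} (hφ : ContMDiff 𝓘(ℝ, E) 𝓘(ℝ, ℂ) ∞ φ)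
    (hψ : ContMDiff 𝓘(ℝ, E) 𝓘(ℝ, ℂ) ∞ ψ) (a : GroupLieAlgebra 𝓘(ℝ, E) G) :
    derivOne (fun h => φ h + ψ h) a = derivOne φ a + derivOne ψ a := by
  have h1 := ((hφ 1).mdifferentiableAt (by simp)).hasMFDerivAt.add
    ((hψ 1).mdifferentiableAt (by simp)).hasMFDerivAt
  exact DFunLike.congr_fun h1.mfderiv a

theorem derivOne_mul_fun {φ ψ : G → ℂ} (hφ : ContMDiff 𝓘(ℝ, E) 𝓘(ℝ, ℂ) ∞ φ)
    (hψ : ContMDiff 𝓘(ℝ, E) 𝓘(ℝ, ℂ) ∞ ψ) (a : GroupLieAlgebra 𝓘(ℝ, E) G) :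
    derivOne (fun h => φ h * ψ h) a = φ 1 * derivOne ψ a + ψ 1 * derivOne φ a := by
  have h1 := ((hφ 1).mdifferentiableAt (by simp)).hasMFDerivAt.mul
    ((hψ 1).mdifferentiableAt (by simp)).hasMFDerivAt
  exact DFunLike.congr_fun h1.mfderiv a

theorem derivOne_const_fun (c : ℂ) (a : GroupLieAlgebra 𝓘(ℝ, E) G) :
    derivOne (fun _ : G => c) a = 0 := by
  exact DFunLike.congr_fun (mfderiv_const (I := 𝓘(ℝ, E)) (I' := 𝓘(ℝ, ℂ)) (c := c)) a

theorem derivOne_const_mul {φ : G → ℂ} (c : ℂ) (hφ : ContMDiff 𝓘(ℝ, E) 𝓘(ℝ, ℂ) ∞ φ)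
    (a : GroupLieAlgebra 𝓘(ℝ, E) G) :
    derivOne (fun h => c * φ h) a = c * derivOne φ a := by
  rw [derivOne_mul_fun (φ := fun _ => c) contMDiff_const hφ, derivOne_const_fun]
  ring

theorem derivOne_add_vec (φ : G → ℂ) (a b : GroupLieAlgebra 𝓘(ℝ, E) G) :
    derivOne φ (a + b) = derivOne φ a + derivOne φ b :=
  map_add (mfderiv 𝓘(ℝ, E) 𝓘(ℝ, ℂ) φ (1 : G)) a b

theorem derivOne_smul_vec (φ : G → ℂ) (r : ℝ) (a : GroupLieAlgebra 𝓘(ℝ, E) G) :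
    derivOne φ (r • a) = (r : ℂ) * derivOne φ a :=
  (map_smul (mfderiv 𝓘(ℝ, E) 𝓘(ℝ, ℂ) φ (1 : G)) r a).trans (Complex.real_smul)

end Calculus

/-! ## Smooth functions on powers of a Lie group -/

section SmoothFun

variable (E : Type*) [NormedAddCommGroup E] [NormedSpace ℝ E]
  (G : Type*) [TopologicalSpace G] [ChartedSpace E G] (ι : Type*) [Fintype ι]

/-- The smooth complex-valued functions on `G^ι`. -/
def smoothSubalgebra : Subalgebra ℂ ((ι → G) → ℂ) where
  carrier := {F | ContMDiff (powModel E ι) 𝓘(ℝ, ℂ) ∞ F}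
  mul_mem' hF hK := contDiff_mul.contMDiff.comp (hF.prodMk_space hK)
  add_mem' hF hK := contDiff_add.contMDiff.comp (hF.prodMk_space hK)
  algebraMap_mem' _ := contMDiff_const

/-- The algebra `C^∞(G^ι, ℂ)`. -/
def SmoothFun : Type _ := smoothSubalgebra E G ι

namespace SmoothFun

instance : CommRing (SmoothFun E G ι) := inferInstanceAs (CommRing (smoothSubalgebra E G ι))

instance : Algebra ℂ (SmoothFun E G ι) := inferInstanceAs (Algebra ℂ (smoothSubalgebra E G ι))

variable {E G ι}

instance : CoeFun (SmoothFun E G ι) fun _ => (ι → G) → ℂ := ⟨Subtype.val⟩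

/-- A smooth function, as an element of `C^∞(G^ι, ℂ)`. -/
def mk (F : (ι → G) → ℂ) (hF : ContMDiff (powModel E ι) 𝓘(ℝ, ℂ) ∞ F) : SmoothFun E G ι := ⟨F, hF⟩

theorem smooth (F : SmoothFun E G ι) :
    ContMDiff (M := ι → G) (M' := ℂ) (powModel E ι) 𝓘(ℝ, ℂ) ∞ F := F.2

theorem ext {F K : SmoothFun E G ι} (h : ∀ u, F u = K u) : F = K := Subtype.ext (funext h)

@[simp] theorem mk_apply (F : (ι → G) → ℂ) (hF) (u : ι → G) : mk (E := E) F hF u = F u := rfl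

@[simp] theorem add_apply (F K : SmoothFun E G ι) (u : ι → G) : (F + K) u = F u + K u := rfl

@[simp] theorem mul_apply (F K : SmoothFun E G ι) (u : ι → G) : (F * K) u = F u * K u := rfl

@[simp] theorem sub_apply (F K : SmoothFun E G ι) (u : ι → G) : (F - K) u = F u - K u := rfl

@[simp] theorem smul_apply (c : ℂ) (F : SmoothFun E G ι) (u : ι → G) : (c • F) u = c * F u := rfl

end SmoothFun

variable {E G ι}

variable [Group G] [LieGroup 𝓘(ℝ, E) ∞ G]

variable (E G ι) in
/-- A smooth family of maps `G^ι → G^ι`, parametrised by `G`, that is the identity at `1 ∈ G`. -/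
structure SmoothFamily where
  /-- The family of maps. -/
  map : (ι → G) → G → ι → G
  smooth : ContMDiff ((powModel E ι).prod 𝓘(ℝ, E)) (powModel E ι) ∞ (Function.uncurry map)
  map_one : ∀ u, map u 1 = u

namespace SmoothFamily

theorem smooth_curry (Φ : SmoothFamily E G ι) (F : SmoothFun E G ι) (u : ι → G) :
    ContMDiff 𝓘(ℝ, E) 𝓘(ℝ, ℂ) ∞ fun h => F (Φ.map u h) :=
  F.smooth.comp (Φ.smooth.comp (contMDiff_const.prodMk contMDiff_id))

/-- The derivation `F ↦ (u ↦ d/dt|₀ F(Φ(u, e^{ta})))` of `C^∞(G^ι, ℂ)`. -/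
def deriv (Φ : SmoothFamily E G ι) (a : GroupLieAlgebra 𝓘(ℝ, E) G) :
    Derivation ℂ (SmoothFun E G ι) (SmoothFun E G ι) :=
  Derivation.mk'
    { toFun := fun F => SmoothFun.mk (fun u => derivOne (fun h => F (Φ.map u h)) a) (by
        have : IsManifold 𝓘(ℝ, E) ∞ G := inferInstance
        have : IsManifold (powModel E ι) ∞ (ι → G) := isManifold_pow
        have : IsManifold (powModel E ι) 1 (ι → G) := IsManifold.of_le (n := ∞) (by simp)
        exact contMDiff_derivOne (Φ := fun u h => F (Φ.map u h))
          (F.smooth.comp Φ.smooth) a)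
      map_add' := fun F K => SmoothFun.ext fun u =>
        derivOne_add_fun (Φ.smooth_curry F u) (Φ.smooth_curry K u) a
      map_smul' := fun c F => SmoothFun.ext fun u =>
        derivOne_const_mul c (Φ.smooth_curry F u) a }
    fun F K => SmoothFun.ext fun u => by
      refine (derivOne_mul_fun (Φ.smooth_curry F u) (Φ.smooth_curry K u) a).trans ?_
      simp only [Φ.map_one]
      rfl

theorem deriv_apply (Φ : SmoothFamily E G ι) (a : GroupLieAlgebra 𝓘(ℝ, E) G)
    (F : SmoothFun E G ι) (u : ι → G) :
    Φ.deriv a F u = derivOne (fun h => F (Φ.map u h)) a := rfl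

/-- `deriv`, as a linear map in the direction. -/
def derivLin (Φ : SmoothFamily E G ι) :
    GroupLieAlgebra 𝓘(ℝ, E) G →ₗ[ℝ] Derivation ℂ (SmoothFun E G ι) (SmoothFun E G ι) where
  toFun := Φ.deriv
  map_add' a b := Derivation.ext fun _ => SmoothFun.ext fun _ => derivOne_add_vec _ a b
  map_smul' r a := Derivation.ext fun _ => SmoothFun.ext fun _ => derivOne_smul_vec _ r a

theorem deriv_lie [CompleteSpace E] (Φ : SmoothFamily E G ι)
    (hΦ : ∀ u g h, Φ.map (Φ.map u g) h = Φ.map u (g * h)) (a b : GroupLieAlgebra 𝓘(ℝ, E) G) :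
    Φ.deriv ⁅a, b⁆ = ⁅Φ.deriv a, Φ.deriv b⁆ :=
  Derivation.ext fun F => SmoothFun.ext fun u => by
    have h1 := derivOne_bracket (Φ.smooth_curry F u) a b
    refine h1.symm.trans ?_
    rw [Derivation.commutator_apply]
    change _ = derivOne (fun g => derivOne (fun h => F (Φ.map (Φ.map u g) h)) b) a -
      derivOne (fun g => derivOne (fun h => F (Φ.map (Φ.map u g) h)) a) b
    simp only [hΦ]

theorem deriv_comm (Φ Ψ : SmoothFamily E G ι)
    (h : ∀ u g h, Ψ.map (Φ.map u g) h = Φ.map (Ψ.map u h) g) (a b : GroupLieAlgebra 𝓘(ℝ, E) G) :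
    ⁅Φ.deriv a, Ψ.deriv b⁆ = 0 :=
  Derivation.ext fun F => SmoothFun.ext fun u => by
    rw [Derivation.commutator_apply]
    refine sub_eq_zero.mpr ?_
    have hs : ContMDiff (𝓘(ℝ, E).prod 𝓘(ℝ, E)) 𝓘(ℝ, ℂ) ∞
        (Function.uncurry fun g h => F (Ψ.map (Φ.map u g) h)) :=
      F.smooth.comp (Ψ.smooth.comp
        ((Φ.smooth.comp (contMDiff_const.prodMk contMDiff_fst)).prodMk contMDiff_snd))
    refine (derivOne_comm hs a b).trans ?_
    simp only [h]
    rfl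

end SmoothFamily

end SmoothFun

/-! ## The adjoint representation -/

section Adjoint

variable {E : Type*} [NormedAddCommGroup E] [NormedSpace ℝ E]
  {G : Type*} [TopologicalSpace G] [ChartedSpace E G] [Group G]

/-- The adjoint representation `Ad(g) : 𝔤 → 𝔤`, the derivative at `1` of conjugation by `g`. -/
def adRep (g : G) : GroupLieAlgebra 𝓘(ℝ, E) G →L[ℝ] GroupLieAlgebra 𝓘(ℝ, E) G :=
  (mfderiv 𝓘(ℝ, E) 𝓘(ℝ, E) (fun x : G => g * x * g⁻¹) (1 : G) : E →L[ℝ] E)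

theorem inTangentCoordinates_const_const [IsManifold 𝓘(ℝ, E) 1 G] {M : Type*} (p q : G)
    (ϕ : M → E →L[ℝ] E) (x₀ x : M) :
    inTangentCoordinates 𝓘(ℝ, E) 𝓘(ℝ, E) (fun _ => p) (fun _ => q) ϕ x₀ x = ϕ x := by
  rw [inTangentCoordinates_eq (x₀ := x₀) (x := x) (fun _ => p) (fun _ => q) ϕ
    (mem_chart_source E p) (mem_chart_source E q)]
  ext v
  change (tangentBundleCore 𝓘(ℝ, E) G).coordChange _ _ _
    (ϕ x ((tangentBundleCore 𝓘(ℝ, E) G).coordChange _ _ _ v)) = ϕ x v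
  rw [(tangentBundleCore 𝓘(ℝ, E) G).coordChange_self (achart E p) p (mem_chart_source E p),
    (tangentBundleCore 𝓘(ℝ, E) G).coordChange_self (achart E q) q (mem_chart_source E q)]

theorem contMDiff_adRep [LieGroup 𝓘(ℝ, E) ∞ G] :
    ContMDiff (M' := E →L[ℝ] E) 𝓘(ℝ, E) 𝓘(ℝ, E →L[ℝ] E) ∞
      (fun g : G => (adRep g : E →L[ℝ] E)) := by
  intro x₀
  have : IsManifold 𝓘(ℝ, E) ∞ G := inferInstance
  have : IsManifold 𝓘(ℝ, E) 1 G := IsManifold.of_le (n := ∞) (by simp)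
  have hc : ContMDiff (𝓘(ℝ, E).prod 𝓘(ℝ, E)) 𝓘(ℝ, E) ∞
      (Function.uncurry fun g x : G => g * x * g⁻¹) :=
    (contMDiff_fst.mul contMDiff_snd).mul contMDiff_fst.inv
  have h := ContMDiffAt.mfderiv (I := 𝓘(ℝ, E)) (I' := 𝓘(ℝ, E)) (J := 𝓘(ℝ, E)) (m := ∞) (n := ∞)
    (x₀ := x₀) (fun g x : G => g * x * g⁻¹) (fun _ => (1 : G)) (hc (x₀, 1)) contMDiffAt_const
    (by simp)
  have h1 : (fun g : G => g * 1 * g⁻¹) = fun _ => 1 := by funext g; simp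
  refine h.congr_of_eventuallyEq (Filter.Eventually.of_forall fun x => ?_)
  have h2 := inTangentCoordinates_const_const (E := E) (1 : G) 1
    (fun g : G => (adRep g : E →L[ℝ] E)) x₀ x
  exact ((congrArg (fun q => inTangentCoordinates 𝓘(ℝ, E) 𝓘(ℝ, E) (fun _ : G => (1 : G)) q
    (fun g : G => (adRep g : E →L[ℝ] E)) x₀ x) h1).trans h2).symm

end Adjoint

/-! ## The generators of the flower algebra -/

/-- The index set `{M_1, …, M_n, A_1, …, A_g, B_1, …, B_g}`. -/
abbrev Gen (n g : ℕ) : Type := Fin n ⊕ (Fin g ⊕ Fin g)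

namespace Gen

variable {n g : ℕ}

/-- The index `M_i`. -/
abbrev M (i : Fin n) : Gen n g := Sum.inl i

/-- The index `A_j`. -/
abbrev A (j : Fin g) : Gen n g := Sum.inr (Sum.inl j)

/-- The index `B_j`. -/
abbrev B (j : Fin g) : Gen n g := Sum.inr (Sum.inr j)

/-- The position in the partial order `M_1 < … < M_n < A_1, B_1 < … < A_g, B_g`. -/
def pos : Gen n g → ℕ
  | Sum.inl i => i
  | Sum.inr (Sum.inl j) => n + j
  | Sum.inr (Sum.inr j) => n + j

/-- The indices `Y > X`. -/
def above (X : Gen n g) : Finset (Gen n g) := Finset.univ.filter fun Y => pos X < pos Y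

end Gen

open Gen

/-! ## Direct sums of copies of a Lie algebra -/

/-- The direct sum of copies of `L`, labelled by the finite set `ι`. -/
def PowLie (ι L : Type*) : Type _ := ι → L

namespace PowLie

variable {ι L : Type*}

/-- The component labelled by `i`. -/
def comp (x : PowLie ι L) (i : ι) : L := x i

variable [LieRing L]

instance : LieRing (PowLie ι L) where
  __ := (inferInstanceAs (AddCommGroup (ι → L)) : AddCommGroup (PowLie ι L))
  bracket x y := fun i => ⁅x i, y i⁆
  add_lie _ _ _ := funext fun _ => add_lie _ _ _
  lie_add _ _ _ := funext fun _ => lie_add _ _ _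
  lie_self _ := funext fun _ => lie_self _
  leibniz_lie _ _ _ := funext fun _ => leibniz_lie _ _ _

instance {K : Type*} [CommRing K] [LieAlgebra K L] : LieAlgebra K (PowLie ι L) where
  __ := (inferInstanceAs (Module K (ι → L)) : Module K (PowLie ι L))
  lie_smul _ _ _ := funext fun _ => LieAlgebra.lie_smul _ _ _

/-- The element `x` of the copy labelled by `i`. -/
def single [DecidableEq ι] (i : ι) (x : L) : PowLie ι L := Pi.single i x

end PowLie

section Families

variable (E : Type*) [NormedAddCommGroup E] [NormedSpace ℝ E]
  (G : Type*) [TopologicalSpace G] [ChartedSpace E G] [Group G] [LieGroup 𝓘(ℝ, E) ∞ G]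
  {n g : ℕ}

/-- Right multiplication of the component `u_X`; its derivative is the left-invariant vector field
`J^{R_X}`. -/
def rightFamily (X : Gen n g) : SmoothFamily E G (Gen n g) where
  map u h := Function.update u X (u X * h)
  smooth := contMDiff_update contMDiff_fst
    (((contMDiff_pow_proj X).comp contMDiff_fst).mul contMDiff_snd) X
  map_one u := by simp

/-- Inverse left multiplication of the component `u_X`; its derivative is the right-invariant vector
field `J^{L_X}`. -/
def leftFamily (X : Gen n g) : SmoothFamily E G (Gen n g) where
  map u h := Function.update u X (h⁻¹ * u X)
  smooth := contMDiff_update contMDiff_fst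
    (contMDiff_snd.inv.mul ((contMDiff_pow_proj X).comp contMDiff_fst)) X
  map_one u := by simp

/-- The one-component group actions of the decoupled flower algebra: conjugation of `u_{M_i}`,
`(u_{A_j}, u_{B_j}) ↦ (u_{A_j} h, u_{A_j} h u_{A_j}⁻¹ u_{B_j})`, and
`(u_{A_j}, u_{B_j}) ↦ (u_{A_j}, u_{B_j} h)`. -/
def decoupledFamily : Gen n g → SmoothFamily E G (Gen n g)
  | Sum.inl i =>
    { map := fun u h => Function.update u (M i) (h⁻¹ * u (M i) * h)
      smooth := contMDiff_update contMDiff_fst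
        ((contMDiff_snd.inv.mul ((contMDiff_pow_proj _).comp contMDiff_fst)).mul contMDiff_snd) _
      map_one := fun u => by simp }
  | Sum.inr (Sum.inl j) =>
    { map := fun u h => Function.update (Function.update u (A j) (u (A j) * h)) (B j)
        (u (A j) * h * (u (A j))⁻¹ * u (B j))
      smooth := by
        have hA : ContMDiff ((powModel E (Gen n g)).prod 𝓘(ℝ, E)) 𝓘(ℝ, E) ∞
            fun p : (Gen n g → G) × G => p.1 (A j) := (contMDiff_pow_proj _).comp contMDiff_fst
        have hB : ContMDiff ((powModel E (Gen n g)).prod 𝓘(ℝ, E)) 𝓘(ℝ, E) ∞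
            fun p : (Gen n g → G) × G => p.1 (B j) := (contMDiff_pow_proj _).comp contMDiff_fst
        exact contMDiff_update (contMDiff_update contMDiff_fst (hA.mul contMDiff_snd) _)
          (((hA.mul contMDiff_snd).mul hA.inv).mul hB) _
      map_one := fun u => by simp }
  | Sum.inr (Sum.inr j) => rightFamily E G (B j)

theorem decoupledFamily_act (X : Gen n g) (u : Gen n g → G) (h k : G) :
    (decoupledFamily E G X).map ((decoupledFamily E G X).map u h) k =
      (decoupledFamily E G X).map u (h * k) := by
  rcases X with i | j | j <;> funext Y
  · by_cases hY : Y = M i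
    · subst hY; simp [decoupledFamily, mul_assoc]
    · simp [decoupledFamily, Function.update_of_ne hY]
  · by_cases hB : Y = B j
    · subst hB; simp [decoupledFamily, mul_assoc]
    · by_cases hA : Y = A j
      · subst hA; simp [decoupledFamily, mul_assoc]
      · simp [decoupledFamily, Function.update_of_ne hA, Function.update_of_ne hB]
  · by_cases hY : Y = B j
    · subst hY; simp [decoupledFamily, rightFamily, mul_assoc]
    · simp [decoupledFamily, rightFamily, Function.update_of_ne hY]

theorem decoupledFamily_comm {X Y : Gen n g} (hXY : X ≠ Y) (u : Gen n g → G) (h k : G) :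
    (decoupledFamily E G Y).map ((decoupledFamily E G X).map u h) k =
      (decoupledFamily E G X).map ((decoupledFamily E G Y).map u k) h := by
  rcases X with i | j | j <;> rcases Y with i' | j' | j' <;> funext Z <;>
    rcases Z with l | l | l <;>
    simp [decoupledFamily, rightFamily, Function.update_apply] at hXY ⊢ <;> grind

variable (n g) in
/-- The derivations `F ↦ V_x F = Σ_X V_{x_X} F` of `C^∞(G^{n+2g}, ℂ)`, for `x ∈ ⊕ 𝔤`, where the
copy of `𝔤` labelled by `X` acts through the decoupled group action labelled by `X`. -/
def decoupledDeriv [CompleteSpace E] : PowLie (Gen n g) (GroupLieAlgebra 𝓘(ℝ, E) G) →ₗ[ℝ]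
    Derivation ℂ (SmoothFun E G (Gen n g)) (SmoothFun E G (Gen n g)) where
  toFun x := ∑ X, (decoupledFamily E G X).derivLin (x.comp X)
  map_add' x y := by
    rw [← Finset.sum_add_distrib]
    exact Finset.sum_congr rfl fun X _ => map_add (decoupledFamily E G X).derivLin (x.comp X) (y.comp X)
  map_smul' r x := by
    rw [RingHom.id_apply, Finset.smul_sum]
    exact Finset.sum_congr rfl fun X _ => map_smul (decoupledFamily E G X).derivLin r (x.comp X)

theorem decoupledDeriv_apply [CompleteSpace E]
    (x : PowLie (Gen n g) (GroupLieAlgebra 𝓘(ℝ, E) G)) :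
    decoupledDeriv E G n g x = ∑ X, (decoupledFamily E G X).deriv (x.comp X) := rfl

theorem decoupledDeriv_lie [CompleteSpace E]
    (x y : PowLie (Gen n g) (GroupLieAlgebra 𝓘(ℝ, E) G)) :
    decoupledDeriv E G n g ⁅x, y⁆ =
      ⁅decoupledDeriv E G n g x, decoupledDeriv E G n g y⁆ := by
  simp only [decoupledDeriv_apply, sum_lie, lie_sum]
  refine Finset.sum_congr rfl fun X _ => ?_
  rw [Finset.sum_eq_single X]
  · exact SmoothFamily.deriv_lie _ (decoupledFamily_act E G X) _ _
  · intro Y _ hY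
    exact SmoothFamily.deriv_comm _ _ (decoupledFamily_comm E G hY) (x.comp Y) (y.comp X)
  · simp

end Families

/-! ## The quantum flower algebra -/

theorem LinearMap.liftBaseChange_lie {P N : Type*} [LieRing P] [LieAlgebra ℝ P] [LieRing N]
    [LieAlgebra ℂ N] [Module ℝ N] [IsScalarTower ℝ ℂ N] (V : P →ₗ[ℝ] N)
    (hV : ∀ x y, V ⁅x, y⁆ = ⁅V x, V y⁆) (x y : ℂ ⊗[ℝ] P) :
    V.liftBaseChange ℂ ⁅x, y⁆ = ⁅V.liftBaseChange ℂ x, V.liftBaseChange ℂ y⁆ := by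
  induction x using TensorProduct.induction_on with
  | zero => simp
  | add x x' hx hx' => simp only [add_lie, map_add, hx, hx']
  | tmul z x =>
    induction y using TensorProduct.induction_on with
    | zero =>
      have h : ⁅z ⊗ₜ[ℝ] x, (0 : ℂ ⊗[ℝ] P)⁆ = 0 :=
        lie_zero (L := ℂ ⊗[ℝ] P) (M := ℂ ⊗[ℝ] P) _
      rw [h, map_zero, lie_zero]
    | add y y' hy hy' =>
      have h : ⁅z ⊗ₜ[ℝ] x, y + y'⁆ = ⁅z ⊗ₜ[ℝ] x, y⁆ + ⁅z ⊗ₜ[ℝ] x, y'⁆ :=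
        LieRing.lie_add _ _ _
      rw [h, map_add, map_add, hy, hy', lie_add]
    | tmul w y =>
      simp only [LieAlgebra.ExtendScalars.bracket_tmul, LinearMap.liftBaseChange_tmul, hV, smul_lie,
        lie_smul, smul_smul, mul_comm z w]

section Quantum

variable {E : Type*} [NormedAddCommGroup E] [NormedSpace ℝ E] [CompleteSpace E]
  {G : Type*} [TopologicalSpace G] [ChartedSpace E G] [Group G] [LieGroup 𝓘(ℝ, E) ∞ G]
  {n g : ℕ}

variable (E G n g) in
/-- The complexification of `⨁_{k=1}^{n+2g} 𝔤`. -/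
abbrev FlowerLie : Type _ := ℂ ⊗[ℝ] PowLie (Gen n g) (GroupLieAlgebra 𝓘(ℝ, E) G)

variable (E G n g) in
/-- The complex-linear extension of `decoupledDeriv`. -/
def decoupledDerivC :
    FlowerLie E G n g →ₗ[ℂ] Derivation ℂ (SmoothFun E G (Gen n g)) (SmoothFun E G (Gen n g)) :=
  (decoupledDeriv E G n g).liftBaseChange ℂ

theorem decoupledDerivC_lie (x y : FlowerLie E G n g) :
    decoupledDerivC E G n g ⁅x, y⁆ = ⁅decoupledDerivC E G n g x, decoupledDerivC E G n g y⁆ :=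
  LinearMap.liftBaseChange_lie (decoupledDeriv E G n g) (decoupledDeriv_lie E G) x y

variable (E G n g) in
/-- The action `F ↦ iħ {ξ, F} = -iħ V_ξ F` of the Lie algebra `⨁ 𝔤`, with commutator
`[ξ, η] = -iħ [ξ, η]_{⨁ 𝔤}`, on `C^∞(G^{n+2g}, ℂ)`. -/
def quantumDeriv (ħ : ℝ) : ScaledLie (-(Complex.I * ħ)) (FlowerLie E G n g) →ₗ⁅ℂ⁆
    Derivation ℂ (SmoothFun E G (Gen n g)) (SmoothFun E G (Gen n g)) where
  toLinearMap := (-(Complex.I * (ħ : ℂ))) •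
    (decoupledDerivC E G n g ∘ₗ (ScaledLie.of (-(Complex.I * (ħ : ℂ))) _).symm.toLinearMap)
  map_lie' := by
    intro x y
    change (-(Complex.I * (ħ : ℂ))) • decoupledDerivC E G n g
        ((-(Complex.I * (ħ : ℂ))) • ⁅(ScaledLie.of _ _).symm x, (ScaledLie.of _ _).symm y⁆) =
      ⁅(-(Complex.I * (ħ : ℂ))) • decoupledDerivC E G n g ((ScaledLie.of _ _).symm x),
        (-(Complex.I * (ħ : ℂ))) • decoupledDerivC E G n g ((ScaledLie.of _ _).symm y)⁆
    rw [map_smul, decoupledDerivC_lie, smul_lie, lie_smul]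

variable (E G n g) in
/-- The quantum flower algebra `U(⨁ 𝔤) ⋉ C^∞(G^{n+2g}, ℂ)`. -/
abbrev QuantumFlower (ħ : ℝ) : Type _ := SmashProduct (quantumDeriv E G n g ħ)

variable (E G n g) in
/-- The Lie subalgebra of elements of degree at most one. -/
abbrev QuantumFlowerOne (ħ : ℝ) : LieSubalgebra ℂ (QuantumFlower E G n g ħ) :=
  SmashProduct.degreeLeOne (quantumDeriv E G n g ħ)

end Quantum

/-! ## Functions on `G^{n+2g}` -/

section Words

variable (E : Type*) [NormedAddCommGroup E] [NormedSpace ℝ E]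
  (G : Type*) [TopologicalSpace G] [ChartedSpace E G] [Group G] [LieGroup 𝓘(ℝ, E) ∞ G]
  (n g : ℕ)

/-- Smooth maps `G^{n+2g} → G`, a group under pointwise multiplication. -/
abbrev Word : Type _ := C^∞⟮powModel E (Gen n g), Gen n g → G; 𝓘(ℝ, E), G⟯

variable {n g}

/-- The map `u ↦ u_X`. -/
def uComp (X : Gen n g) : Word E G n g := ⟨fun u => u X, contMDiff_pow_proj X⟩

/-- `u_{K_j} = u_{B_j} u_{A_j}⁻¹ u_{B_j}⁻¹ u_{A_j}`. -/
def uK (j : Fin g) : Word E G n g :=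
  uComp E G (B j) * (uComp E G (A j))⁻¹ * (uComp E G (B j))⁻¹ * uComp E G (A j)

variable (n g) in
/-- `Φ_∞(u) = u_{K_g} ⋯ u_{K_1} u_{M_n} ⋯ u_{M_1}`. -/
def uTotal : Word E G n g :=
  (List.ofFn fun j : Fin g => uK E G j.rev).prod *
    (List.ofFn fun i : Fin n => uComp E G (M i.rev)).prod

end Words

section Functions

variable {E : Type*} [NormedAddCommGroup E] [NormedSpace ℝ E]
  {G : Type*} [TopologicalSpace G] [ChartedSpace E G] [Group G]
  {n g : ℕ} {κ : Type*}

/-- The matrix entries `Ad^*(x)_a^b = ⟨P^b, Ad(x) J_a⟩`, for a basis `J_a` of `𝔤` with dual basis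
`P^a`. -/
def coAd (J : Module.Basis κ ℝ (GroupLieAlgebra 𝓘(ℝ, E) G)) (x : G) (a b : κ) : ℝ :=
  J.coord b (adRep x (J a))

theorem contMDiff_coAd [FiniteDimensional ℝ E] [LieGroup 𝓘(ℝ, E) ∞ G]
    (J : Module.Basis κ ℝ (GroupLieAlgebra 𝓘(ℝ, E) G)) (a b : κ) :
    ContMDiff 𝓘(ℝ, E) 𝓘(ℝ, ℂ) ∞ fun x : G => (coAd J x a b : ℂ) := by
  let v : E := J a
  let ℓ : E →ₗ[ℝ] ℝ := J.coord b
  let L : (E →L[ℝ] E) →L[ℝ] ℂ := Complex.ofRealCLM ∘L (LinearMap.toContinuousLinearMap ℓ) ∘L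
    (ContinuousLinearMap.apply ℝ E v)
  exact L.contMDiff.comp (contMDiff_adRep (E := E) (G := G))

variable [FiniteDimensional ℝ E] [LieGroup 𝓘(ℝ, E) ∞ G]

/-- The function `u ↦ Ad^*(w(u))_a^b`. -/
def coAdFun (J : Module.Basis κ ℝ (GroupLieAlgebra 𝓘(ℝ, E) G)) (w : Word E G n g) (a b : κ) :
    SmoothFun E G (Gen n g) :=
  SmoothFun.mk (fun u => (coAd J (w u) a b : ℂ)) ((contMDiff_coAd J a b).comp w.contMDiff)

/-- The Kronecker symbol `δ_a^b`. -/
def kron [DecidableEq κ] (a b : κ) : SmoothFun E G (Gen n g) := if a = b then 1 else 0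

variable (E G n g) in
/-- `F ↦ F ∘ Ad_{h⁻¹}^{n+2g}`. -/
def conjPullback (h : G) : SmoothFun E G (Gen n g) →ₐ[ℂ] SmoothFun E G (Gen n g) where
  toFun F := SmoothFun.mk (fun u => F fun X => h⁻¹ * u X * h) (F.smooth.comp
    (contMDiff_powMk fun X => (contMDiff_const.mul (contMDiff_pow_proj X)).mul contMDiff_const))
  map_one' := rfl
  map_mul' _ _ := rfl
  map_zero' := rfl
  map_add' _ _ := rfl
  commutes' _ := rfl

/-- The function `f ∘ Φ_∞`. -/
def compTotal (f : C^∞⟮𝓘(ℝ, E), G; ℝ⟯) : SmoothFun E G (Gen n g) :=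
  SmoothFun.mk (fun u => (f (uTotal E G n g u) : ℂ))
    (Complex.ofRealCLM.contMDiff.comp (f.contMDiff.comp (uTotal E G n g).contMDiff))

end Functions

/-! ## The classical flower algebra -/

section Subst

/-- The algebra homomorphism that acts on coefficients by `φ` and sends the generator labelled by
`i` to `p i`. -/
def substHom {σ : Type*} {R : Type*} [CommRing R] [Algebra ℂ R] (φ : R →ₐ[ℂ] R)
    (p : σ → MvPolynomial σ R) : MvPolynomial σ R →ₐ[ℂ] MvPolynomial σ R :=
  { MvPolynomial.eval₂Hom (MvPolynomial.C.comp (φ : R →+* R)) p with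
    commutes' := fun z => by
      change MvPolynomial.eval₂ _ _ (algebraMap ℂ (MvPolynomial σ R) z) = _
      rw [IsScalarTower.algebraMap_apply ℂ R (MvPolynomial σ R), MvPolynomial.algebraMap_eq,
        MvPolynomial.eval₂_C]
      simp }

theorem substHom_mem {σ : Type*} {R : Type*} [CommRing R] [Algebra ℂ R] (φ : R →ₐ[ℂ] R)
    {p : σ → MvPolynomial σ R} (hp : ∀ i, p i ∈ MvPolynomial.restrictTotalDegree σ R 1)
    {q : MvPolynomial σ R} (hq : q ∈ MvPolynomial.restrictTotalDegree σ R 1) :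
    substHom φ p q ∈ MvPolynomial.restrictTotalDegree σ R 1 := by
  have h : substHom φ p q = ∑ d ∈ q.support,
      MvPolynomial.C (φ (q.coeff d)) * ∏ i ∈ d.support, p i ^ d i := MvPolynomial.eval₂_eq _ _ _
  rw [h]
  refine sum_mem fun d hd => ?_
  rw [MvPolynomial.mem_restrictTotalDegree] at hq ⊢
  refine (MvPolynomial.totalDegree_mul _ _).trans ?_
  rw [MvPolynomial.totalDegree_C, zero_add]
  refine (MvPolynomial.totalDegree_finsetProd _ _).trans ?_
  refine le_trans (Finset.sum_le_sum (g := d) fun i _ => ?_) ((MvPolynomial.le_totalDegree hd).trans hq)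
  refine (MvPolynomial.totalDegree_pow _ _).trans ?_
  exact (Nat.mul_le_mul_left _ ((MvPolynomial.mem_restrictTotalDegree _ _ _).mp (hp i))).trans_eq
    (mul_one _)

theorem X_mem_restrictTotalDegree {σ R : Type*} [CommRing R] (i : σ) :
    (MvPolynomial.X i : MvPolynomial σ R) ∈ MvPolynomial.restrictTotalDegree σ R 1 := by
  rw [MvPolynomial.mem_restrictTotalDegree]
  rcases subsingleton_or_nontrivial R with h | h
  · rw [Subsingleton.elim (MvPolynomial.X i : MvPolynomial σ R) 0]
    simp
  · simp

theorem C_mem_restrictTotalDegree {σ R : Type*} [CommRing R] (r : R) :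
    (MvPolynomial.C r : MvPolynomial σ R) ∈ MvPolynomial.restrictTotalDegree σ R 1 := by
  rw [MvPolynomial.mem_restrictTotalDegree]
  simp

end Subst

section Classical

variable {E : Type*} [NormedAddCommGroup E] [NormedSpace ℝ E] [FiniteDimensional ℝ E]
  {G : Type*} [TopologicalSpace G] [ChartedSpace E G] [Group G] [LieGroup 𝓘(ℝ, E) ∞ G]
  {n g : ℕ} {κ : Type*} [Fintype κ] [DecidableEq κ]

variable (E G n g κ) in
/-- The complexified flower algebra `S(⨁ 𝔤) ⊗ C^∞(G^{n+2g}, ℂ)`: polynomials in generators `j^X_a`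
with coefficients in `C^∞(G^{n+2g}, ℂ)`. -/
abbrev ClassicalFlower : Type _ := MvPolynomial (Gen n g × κ) (SmoothFun E G (Gen n g))

variable (E G n g κ) in
/-- The elements of degree at most one in the generators. -/
abbrev ClassicalFlowerOne : Submodule ℂ (ClassicalFlower E G n g κ) :=
  (MvPolynomial.restrictTotalDegree (Gen n g × κ) (SmoothFun E G (Gen n g)) 1).restrictScalars ℂ

variable (J : Module.Basis κ ℝ (GroupLieAlgebra 𝓘(ℝ, E) G))

/-- The vector field `J^{R_X}_a`. -/
def vecR (X : Gen n g) (a : κ) : Derivation ℂ (SmoothFun E G (Gen n g)) (SmoothFun E G (Gen n g)) :=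
  (rightFamily E G X).deriv (J a)

/-- The vector field `J^{L_X}_a`. -/
def vecL (X : Gen n g) (a : κ) : Derivation ℂ (SmoothFun E G (Gen n g)) (SmoothFun E G (Gen n g)) :=
  (leftFamily E G X).deriv (J a)

/-- `(δ_a^b - Ad^*(u_X)_a^b) ∑_{Y > X} (J^{R_Y}_b + J^{L_Y}_b) F`. -/
def bracketTail (X : Gen n g) (a : κ) (F : SmoothFun E G (Gen n g)) : SmoothFun E G (Gen n g) :=
  ∑ b, (kron a b - coAdFun J (uComp E G X) a b) * ∑ Y ∈ X.above, (vecR J Y b F + vecL J Y b F)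

/-- The Poisson brackets `{j^X_a ⊗ 1, 1 ⊗ F}` of the flower algebra. -/
def bracketJF : Gen n g → κ → SmoothFun E G (Gen n g) → SmoothFun E G (Gen n g)
  | Sum.inl i, a, F =>
    -(vecR J (M i) a F + vecL J (M i) a F) - bracketTail J (M i) a F
  | Sum.inr (Sum.inl j), a, F =>
    -(vecR J (A j) a F + vecL J (A j) a F) - (vecR J (B j) a F + vecL J (B j) a F)
      - ∑ b, coAdFun J ((uComp E G (B j))⁻¹ * uComp E G (A j)) a b * vecR J (B j) b F
      - bracketTail J (A j) a F
  | Sum.inr (Sum.inr j), a, F =>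
    -vecL J (A j) a F - (vecR J (B j) a F + vecL J (B j) a F) - bracketTail J (B j) a F

/-- The image `Ad^*(h)_a^b (j^X_b + {j^X_b, f ∘ Φ_∞})` of `j^X_a` under `(h, f)`. -/
def actionGen (h : G) (f : C^∞⟮𝓘(ℝ, E), G; ℝ⟯) (i : Gen n g × κ) : ClassicalFlower E G n g κ :=
  ∑ b, (coAd J h i.2 b : ℂ) •
    (MvPolynomial.X (i.1, b) + MvPolynomial.C (bracketJF J i.1 b (compTotal f)))

theorem actionGen_mem (h : G) (f : C^∞⟮𝓘(ℝ, E), G; ℝ⟯) (i : Gen n g × κ) :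
    actionGen J h f i ∈ ClassicalFlowerOne E G n g κ :=
  sum_mem fun _ _ => Submodule.smul_mem _ _
    (add_mem (X_mem_restrictTotalDegree _) (C_mem_restrictTotalDegree _))

/-- The action of `(h, f)` on the flower algebra. -/
def action (h : G) (f : C^∞⟮𝓘(ℝ, E), G; ℝ⟯) :
    ClassicalFlower E G n g κ →ₐ[ℂ] ClassicalFlower E G n g κ :=
  substHom (conjPullback E G n g h) (actionGen J h f)

/-- The action of `(h, f)` on the elements of degree at most one. -/
def actionOne (h : G) (f : C^∞⟮𝓘(ℝ, E), G; ℝ⟯) :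
    ClassicalFlowerOne E G n g κ →ₗ[ℂ] ClassicalFlowerOne E G n g κ :=
  (action J h f).toLinearMap.restrict fun _ hq => substHom_mem _ (actionGen_mem J h f) hq

variable (E G) in
/-- The decoupled generator `j^{X'}_a`, as a variable of the polynomial algebra. -/
def jPrime (X : Gen n g) (a : κ) : ClassicalFlower E G n g κ := MvPolynomial.X (X, a)

/-- `(δ_b^c - Ad^*(u_{A_k}⁻¹)_b^c) j_c^{A'_k}
  + (Ad^*(u_{A_k}⁻¹)_b^c - Ad^*(u_{B_k}⁻¹ u_{A_k})_b^c) j_c^{B'_k}`. -/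
def handleTerm (k : Fin g) (b : κ) : ClassicalFlower E G n g κ :=
  ∑ c, ((kron b c - coAdFun (n := n) J (uComp E G (A k))⁻¹ b c) • jPrime E G (A k : Gen n g) c +
    (coAdFun (n := n) J (uComp E G (A k))⁻¹ b c -
      coAdFun (n := n) J ((uComp E G (B k))⁻¹ * uComp E G (A k)) b c) •
        jPrime E G (B k : Gen n g) c)

/-- The generators `j^X_a` of the flower algebra in terms of the decoupled generators. -/
def decoupleGen : Gen n g × κ → ClassicalFlower E G n g κ
  | (Sum.inl i, a) => jPrime E G (M i) a +
      ∑ b, (kron a b - coAdFun (n := n) (g := g) J (uComp E G (M i)) a b) •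
        ((∑ k ∈ Finset.Ioi i, jPrime E G (M k) b) + ∑ k : Fin g, handleTerm J k b)
  | (Sum.inr (Sum.inl i), a) => jPrime E G (A i) a -
      (∑ b, coAdFun (n := n) J (uComp E G (A i))⁻¹ a b •
        (jPrime E G (A i : Gen n g) b - jPrime E G (B i) b)) +
      ∑ b, (kron a b - coAdFun (n := n) J (uComp E G (A i)) a b) •
        ∑ k ∈ Finset.Ioi i, handleTerm (n := n) J k b
  | (Sum.inr (Sum.inr i), a) => jPrime E G (B i) a -
      (∑ b, coAdFun (n := n) J (uComp E G (A i))⁻¹ a b •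
        (jPrime E G (A i : Gen n g) b - jPrime E G (B i) b)) +
      ∑ b, (kron a b - coAdFun (n := n) J (uComp E G (B i)) a b) •
        ∑ k ∈ Finset.Ioi i, handleTerm (n := n) J k b

theorem decoupleGen_mem (i : Gen n g × κ) :
    decoupleGen J i ∈
      MvPolynomial.restrictTotalDegree (Gen n g × κ) (SmoothFun E G (Gen n g)) 1 := by
  have hj : ∀ (X : Gen n g) (a : κ), jPrime E G X a ∈
      MvPolynomial.restrictTotalDegree (Gen n g × κ) (SmoothFun E G (Gen n g)) 1 :=
    fun X a => X_mem_restrictTotalDegree _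
  have hh : ∀ (k : Fin g) (b : κ), handleTerm (n := n) J k b ∈
      MvPolynomial.restrictTotalDegree (Gen n g × κ) (SmoothFun E G (Gen n g)) 1 :=
    fun k b => sum_mem fun c _ =>
      add_mem (Submodule.smul_mem _ _ (hj _ _)) (Submodule.smul_mem _ _ (hj _ _))
  rcases i with ⟨i | i | i, a⟩
  · exact add_mem (hj _ _) (sum_mem fun b _ => Submodule.smul_mem _ _
      (add_mem (sum_mem fun k _ => hj _ _) (sum_mem fun k _ => hh _ _)))
  · exact add_mem (sub_mem (hj _ _) (sum_mem fun b _ => Submodule.smul_mem _ _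
      (sub_mem (hj _ _) (hj _ _)))) (sum_mem fun b _ => Submodule.smul_mem _ _
      (sum_mem fun k _ => hh _ _))
  · exact add_mem (sub_mem (hj _ _) (sum_mem fun b _ => Submodule.smul_mem _ _
      (sub_mem (hj _ _) (hj _ _)))) (sum_mem fun b _ => Submodule.smul_mem _ _
      (sum_mem fun k _ => hh _ _))

/-- The map that expresses an element of the flower algebra, given as a polynomial in the `j^X_a`,
as a polynomial in the decoupled generators `j^{X'}_a`. -/
def decouple : ClassicalFlower E G n g κ →ₐ[ℂ] ClassicalFlower E G n g κ :=
  substHom (AlgHom.id ℂ _) (decoupleGen J)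

/-- `decouple` on the elements of degree at most one. -/
def decoupleOne : ClassicalFlowerOne E G n g κ →ₗ[ℂ] ClassicalFlowerOne E G n g κ :=
  (decouple J).toLinearMap.restrict fun _ hq => substHom_mem _ (decoupleGen_mem J) hq

end Classical

/-! ## The quantisation map on elements of degree at most one -/

theorem SmashProduct.ofFun_mul_mem {K L A : Type*} [CommRing K] [LieRing L] [LieAlgebra K L]
    [CommRing A] [Algebra K A] (D : L →ₗ⁅K⁆ Derivation K A A) (F : A) {x : SmashProduct D}
    (hx : x ∈ SmashProduct.filtration D 1) : ofFun D F * x ∈ SmashProduct.filtration D 1 := by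
  revert x
  change SmashProduct.filtration D 1 ≤
    (SmashProduct.filtration D 1).comap (LinearMap.mulLeft K (ofFun D F))
  refine filtration_one_le D (fun G => ?_) (fun η G => ?_)
  · change ofFun D F * tmul D 1 G ∈ filtration D 1
    rw [ofFun_mul_tmul]
    exact ofFun_mem D _
  · change ofFun D F * tmul D (UniversalEnvelopingAlgebra.ι K η) G ∈ filtration D 1
    rw [ofFun_mul_tmul]
    exact tmul_ι_mem D _ _

/-- Finite-dimensional real normed spaces are complete. -/
instance finiteDimensional_completeSpace (E : Type*) [NormedAddCommGroup E] [NormedSpace ℝ E]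
    [FiniteDimensional ℝ E] : CompleteSpace E :=
  FiniteDimensional.complete ℝ E

section Quantise

variable {E : Type*} [NormedAddCommGroup E] [NormedSpace ℝ E] [FiniteDimensional ℝ E]
  {G : Type*} [TopologicalSpace G] [ChartedSpace E G] [Group G] [LieGroup 𝓘(ℝ, E) ∞ G]
  {n g : ℕ} {κ : Type*} [Fintype κ] [DecidableEq κ] (ħ : ℝ)
  (J : Module.Basis κ ℝ (GroupLieAlgebra 𝓘(ℝ, E) G))

/-- The generator of the quantum flower algebra given by `J_a` in the copy of `𝔤` labelled by
`X`. -/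
def kHat (X : Gen n g) (a : κ) : QuantumFlower E G n g ħ :=
  SmashProduct.ofLie _ (ScaledLie.of _ _ (1 ⊗ₜ[ℝ] PowLie.single X (J a)))

/-- The quantum generators `j^{X'}_a`: the copies of `𝔤` have the generators `j^{M'_i}`,
`j^{A'_i} - j^{B'_i}` and `j^{B'_i}`. -/
def jHat : Gen n g × κ → QuantumFlower E G n g ħ
  | (Sum.inl i, a) => kHat ħ J (M i) a
  | (Sum.inr (Sum.inl i), a) => kHat ħ J (A i) a + kHat ħ J (B i) a
  | (Sum.inr (Sum.inr i), a) => kHat ħ J (B i) a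

theorem kHat_mem (X : Gen n g) (a : κ) : kHat ħ J X a ∈ SmashProduct.filtration _ 1 :=
  SmashProduct.tmul_ι_mem _ _ _

theorem jHat_mem (i : Gen n g × κ) : jHat ħ J i ∈ SmashProduct.filtration _ 1 := by
  rcases i with ⟨i | i | i, a⟩
  · exact kHat_mem ħ J _ _
  · exact add_mem (kHat_mem ħ J _ _) (kHat_mem ħ J _ _)
  · exact kHat_mem ħ J _ _

/-- The linear map underlying `quantise`. -/
def quantiseAux : ClassicalFlowerOne E G n g κ →ₗ[ℂ] QuantumFlower E G n g ħ where
  toFun p := SmashProduct.ofFun _ (p.1.coeff 0) +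
    ∑ i, SmashProduct.ofFun _ (p.1.coeff (Finsupp.single i 1)) * jHat ħ J i
  map_add' p q := by
    simp only [SmashProduct.ofFun, Submodule.coe_add, MvPolynomial.coeff_add,
      SmashProduct.tmul_add, add_mul, Finset.sum_add_distrib]
    abel
  map_smul' c p := by
    simp only [SmashProduct.ofFun, Submodule.coe_smul, MvPolynomial.coeff_smul,
      SmashProduct.tmul_smul, smul_mul_assoc, ← Finset.smul_sum, ← smul_add, RingHom.id_apply]

theorem quantiseAux_mem (p : ClassicalFlowerOne E G n g κ) :
    quantiseAux ħ J p ∈ QuantumFlowerOne E G n g ħ :=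
  add_mem (SmashProduct.ofFun_mem _ _)
    (sum_mem fun i _ => SmashProduct.ofFun_mul_mem _ _ (jHat_mem ħ J i))

/-- The map that sends functions to functions and `∑ F j^{X'}_a` to `∑ F j^{X'}_a`, with the
functions ordered to the left. -/
def quantise : ClassicalFlowerOne E G n g κ →ₗ[ℂ] QuantumFlowerOne E G n g ħ where
  toFun p := ⟨quantiseAux ħ J p, quantiseAux_mem ħ J p⟩
  map_add' p q := Subtype.ext (map_add (quantiseAux ħ J) p q)
  map_smul' c p := Subtype.ext (map_smul (quantiseAux ħ J) c p)

/-- The map `Q|_{01}`, from the elements of degree at most one of the classical flower algebra to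
those of the quantum flower algebra. -/
def Q01 : ClassicalFlowerOne E G n g κ →ₗ[ℂ] QuantumFlowerOne E G n g ħ :=
  quantise ħ J ∘ₗ decoupleOne J

end Quantise

/-! ## The group `G ⋉ C^∞(G)` -/

section Group

variable (E : Type*) [NormedAddCommGroup E] [NormedSpace ℝ E]
  (G : Type*) [TopologicalSpace G] [ChartedSpace E G] [Group G] [LieGroup 𝓘(ℝ, E) ∞ G]

/-- `f ↦ f ∘ Ad_{h⁻¹}`, with `Ad_h` denoting conjugation by `h`. -/
def conjFun (h : G) (f : C^∞⟮𝓘(ℝ, E), G; ℝ⟯) : C^∞⟮𝓘(ℝ, E), G; ℝ⟯ :=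
  ⟨fun x => f (h⁻¹ * x * h),
    f.contMDiff.comp ((contMDiff_const.mul contMDiff_id).mul contMDiff_const)⟩

/-- The action of `G` on the additive group `C^∞(G)`. -/
def conjAction : G →* MulAut (Multiplicative C^∞⟮𝓘(ℝ, E), G; ℝ⟯) where
  toFun h :=
    { toFun := fun f => Multiplicative.ofAdd (conjFun E G h f.toAdd)
      invFun := fun f => Multiplicative.ofAdd (conjFun E G h⁻¹ f.toAdd)
      left_inv := fun f => ContMDiffMap.ext fun x => by
        change f.toAdd (h⁻¹ * (h⁻¹⁻¹ * x * h⁻¹) * h) = f.toAdd x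
        congr 1
        group
      right_inv := fun f => ContMDiffMap.ext fun x => by
        change f.toAdd (h⁻¹⁻¹ * (h⁻¹ * x * h) * h⁻¹) = f.toAdd x
        congr 1
        group
      map_mul' := fun _ _ => rfl }
  map_one' := MulEquiv.ext fun f => ContMDiffMap.ext fun x => by
    change f.toAdd (1⁻¹ * x * 1) = f.toAdd x
    congr 1
    group
  map_mul' h k := MulEquiv.ext fun f => ContMDiffMap.ext fun x => by
    change f.toAdd ((h * k)⁻¹ * x * (h * k)) = f.toAdd (k⁻¹ * (h⁻¹ * x * h) * k)
    congr 1
    group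

/-- The group `G ⋉ C^∞(G)`, with multiplication
`(h₁, f₁) (h₂, f₂) = (h₁ h₂, f₁ + f₂ ∘ Ad_{h₁⁻¹})`. -/
abbrev SymGroup : Type _ := Multiplicative C^∞⟮𝓘(ℝ, E), G; ℝ⟯ ⋊[conjAction E G] G

variable {E G}

/-- The element `(h, f)`. -/
def SymGroup.mk (h : G) (f : C^∞⟮𝓘(ℝ, E), G; ℝ⟯) : SymGroup E G := ⟨Multiplicative.ofAdd f, h⟩

theorem SymGroup.mk_mul_mk (h₁ h₂ : G) (f₁ f₂ : C^∞⟮𝓘(ℝ, E), G; ℝ⟯) :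
    SymGroup.mk h₁ f₁ * SymGroup.mk h₂ f₂ = SymGroup.mk (h₁ * h₂) (f₁ + conjFun E G h₁ f₂) := rfl

end Group

end

/-! The transported action is a composite of two explicit automorphisms of the quantum flower
algebra, so no commutator of two generators ever has to be computed.

Let $\psi = f\circ\Phi_\infty/(i\hbar)$. The image $\hat\jmath$ of a coupled generator under
$Q|_{01}$ satisfies $[\hat\jmath, F] = i\hbar\{j,F\}$ for every function $F$ (`jCoupled_mul_ofFun`).
Since $\{j,\cdot\}$ obeys the chain rule for the exponential, $e^{-\psi}\hat\jmath e^{\psi} =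
\hat\jmath + e^{-\psi}[\hat\jmath,e^{\psi}] = \hat\jmath + \{j, f\circ\Phi_\infty\}$
(`gaugeAut_jCoupled`). So $(1,f)$ is an inner automorphism, which fixes all functions. The element
$(h,0)$ is simultaneous conjugation: $\mathrm{Ad}(h)$ on all copies of $\mathfrak g$ together with
the pullback of functions is compatible with the semidirect product, and it acts on the $\hat\jmath$
by the constant matrix $\mathrm{Ad}^*(h)$ (`conjAut_jCoupled`). The composite agrees with the
transported action in degree at most one (`symAut_Q01`). Elements of that degree generate the
algebra, hence uniqueness. The group law follows because $\Phi_\infty$ is equivariant under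
conjugation (`conjAut_gaugeAut`), and invertibility follows from the group law.

$Q|_{01}$ is linear over the functions. It is onto because the system that couples the generators is
triangular for the order of the indices and can be solved downwards for the decoupled generators
(`mem_of_coupled_mem`). It is injective because the unit and the decoupled generators are linearly
independent over the functions (`quantum_linearIndependent`), and the coupling, as a surjective
endomorphism of a finite free module over a commutative ring, is injective. Independence comes from
a representation of $U$ by left-invariant differential operators, so the Poincaré–Birkhoff–Witt
theorem is not needed.

The coupling formulas are written once, as `coupled`, for an arbitrary module in which the decoupled
generators take values. They are then used for polynomials, quantum generators, vector fields, pairs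
of these, and coordinate vectors. Their compatibility with semilinear maps and submodules replaces
separate index computations. -/

noncomputable section

open Gen

open scoped Matrix.Module

/-! ### Generators and endomorphisms of the semidirect product algebra -/

section SmashGeneral

variable {K L A : Type*} [CommRing K] [LieRing L] [LieAlgebra K L] [CommRing A] [Algebra K A]

namespace SmashProduct

variable (D : L →ₗ⁅K⁆ Derivation K A A)

/-- `F ↦ 1 ⊗ F`, as an algebra homomorphism. -/
def ofFunHom : A →ₐ[K] SmashProduct D where
  toFun := ofFun D
  map_one' := rfl
  map_mul' F G := (ofFun_mul_tmul D F G 1).symm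
  map_zero' := TensorProduct.tmul_zero _ _
  map_add' F G := tmul_add D 1 F G
  commutes' c := by
    rw [Algebra.algebraMap_eq_smul_one, Algebra.algebraMap_eq_smul_one, one_def]
    exact tmul_smul D c 1 1

@[simp] theorem ofFunHom_apply (F : A) : ofFunHom D F = ofFun D F := rfl

theorem ofFun_mul (F G : A) : ofFun D (F * G) = ofFun D F * ofFun D G := map_mul (ofFunHom D) F G

theorem ofFun_add (F G : A) : ofFun D (F + G) = ofFun D F + ofFun D G := map_add (ofFunHom D) F G

theorem ofFun_one : ofFun D 1 = 1 := rfl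

theorem tmul_eq_ofFun_mul (θ : UniversalEnvelopingAlgebra K L) (F : A) :
    tmul D θ F = ofFun D F * tmul D θ 1 := by
  rw [ofFun_mul_tmul, mul_one]

/-- `θ ↦ θ ⊗ 1`, as an algebra homomorphism. -/
def ofU : UniversalEnvelopingAlgebra K L →ₐ[K] SmashProduct D where
  toFun θ := tmul D θ 1
  map_one' := rfl
  map_mul' θ χ := by
    rw [mul_def, mulHom_tmul, mulFun_one, one_mul, ← mulU_one D χ, ← Module.End.mul_apply,
      ← map_mul, mulU_one]
  map_zero' := TensorProduct.zero_tmul _ _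
  map_add' θ χ := add_tmul D θ χ 1
  commutes' c := by
    rw [Algebra.algebraMap_eq_smul_one, Algebra.algebraMap_eq_smul_one, one_def]
    exact smul_tmul D c 1 1

theorem ofU_ι (ξ : L) : ofU D (UniversalEnvelopingAlgebra.ι K ξ) = ofLie D ξ := rfl

theorem ofLie_add (ξ η : L) : ofLie D (ξ + η) = ofLie D ξ + ofLie D η := by
  rw [← ofU_ι, ← ofU_ι, ← ofU_ι, map_add, map_add]

theorem ofLie_smul (c : K) (ξ : L) : ofLie D (c • ξ) = c • ofLie D ξ := by
  rw [← ofU_ι, ← ofU_ι, map_smul, map_smul]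

/-- `ξ ↦ ξ ⊗ 1`, as a linear map. -/
def ofLieLin : L →ₗ[K] SmashProduct D where
  toFun := ofLie D
  map_add' := ofLie_add D
  map_smul' := ofLie_smul D

@[simp] theorem ofLieLin_apply (ξ : L) : ofLieLin D ξ = ofLie D ξ := rfl

theorem ofLie_mul_ofFun (ξ : L) (F : A) :
    ofLie D ξ * ofFun D F = ofFun D F * ofLie D ξ + ofFun D (D ξ F) := by
  rw [ofLie, tmul_ι_mul_ofFun, ofFun_mul_tmul, one_mul, one_mul, mul_one]

/-- Every $\theta\otimes F$ is the product of $1\otimes F$ and $\theta\otimes 1$, and $U(L)$ is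
generated by $L$. This is the source of the uniqueness of extensions. -/
theorem algHom_ext {B : Type*} [Ring B] [Algebra K B] {f f' : SmashProduct D →ₐ[K] B}
    (h0 : ∀ F, f (ofFun D F) = f' (ofFun D F)) (h1 : ∀ ξ, f (ofLie D ξ) = f' (ofLie D ξ)) :
    f = f' := by
  have hU : f.comp (ofU D) = f'.comp (ofU D) :=
    UniversalEnvelopingAlgebra.hom_ext K (LieHom.ext h1)
  refine AlgHom.ext fun x => ?_
  induction x using induction_on with
  | h0 => simp
  | ht θ F =>
    rw [tmul_eq_ofFun_mul, map_mul, map_mul, h0]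
    exact congrArg _ (DFunLike.congr_fun hU θ)
  | ha x y hx hy => rw [map_add, map_add, hx, hy]

section Map

variable {D} (α : L →ₗ⁅K⁆ L) (φ : A →ₐ[K] A)

/-- The algebra homomorphism `U(L) → U(L)` induced by a Lie algebra homomorphism. -/
def mapU : UniversalEnvelopingAlgebra K L →ₐ[K] UniversalEnvelopingAlgebra K L :=
  UniversalEnvelopingAlgebra.lift K ((UniversalEnvelopingAlgebra.ι K).comp α)

theorem mapU_ι (ξ : L) : mapU α (UniversalEnvelopingAlgebra.ι K ξ) =
    UniversalEnvelopingAlgebra.ι K (α ξ) :=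
  UniversalEnvelopingAlgebra.lift_ι_apply K _ ξ

variable (D) in
/-- The linear map underlying `SmashProduct.map`. -/
def mapLin : SmashProduct D →ₗ[K] SmashProduct D :=
  TensorProduct.map (mapU α).toLinearMap φ.toLinearMap

theorem mapLin_tmul (θ : UniversalEnvelopingAlgebra K L) (F : A) :
    mapLin D α φ (tmul D θ F) = tmul D (mapU α θ) (φ F) := rfl

theorem mapLin_mulFun (F : A) (y : SmashProduct D) :
    mapLin D α φ (mulFun D F y) = mulFun D (φ F) (mapLin D α φ y) := by
  induction y using induction_on with
  | h0 => simp
  | ht θ G => rw [mulFun_tmul, mapLin_tmul, mapLin_tmul, mulFun_tmul, map_mul]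
  | ha x y hx hy => simp only [map_add, hx, hy]

variable (hφ : ∀ ξ F, φ (D ξ F) = D (α ξ) (φ F))
include hφ

theorem mapLin_mulGen (ξ : L) (y : SmashProduct D) :
    mapLin D α φ (mulGen D ξ y) = mulGen D (α ξ) (mapLin D α φ y) := by
  induction y using induction_on with
  | h0 => simp
  | ht θ G =>
    rw [mulGen_tmul, map_add, mapLin_tmul, mapLin_tmul, mapLin_tmul, mulGen_tmul, map_mul, mapU_ι,
      hφ]
  | ha x y hx hy => simp only [map_add, hx, hy]

/-- The $\theta$ for which the identity holds for all $y$ form a subalgebra of $U(L)$, so it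
suffices to treat $\theta\in L$, where the compatibility `hφ` of $\alpha$ and $\varphi$ enters. -/
theorem mapLin_mulU (θ : UniversalEnvelopingAlgebra K L) (y : SmashProduct D) :
    mapLin D α φ (mulU D θ y) = mulU D (mapU α θ) (mapLin D α φ y) := by
  let S : Subalgebra K (UniversalEnvelopingAlgebra K L) :=
    { carrier := {θ | ∀ y, mapLin D α φ (mulU D θ y) = mulU D (mapU α θ) (mapLin D α φ y)}
      mul_mem' := by
        intro a b ha hb y
        rw [map_mul, map_mul, map_mul, Module.End.mul_apply, Module.End.mul_apply, ha, hb]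
      add_mem' := by
        intro a b ha hb y
        rw [map_add, map_add, map_add, LinearMap.add_apply, LinearMap.add_apply, map_add, ha, hb]
      algebraMap_mem' := by
        intro r y
        rw [AlgHom.commutes, AlgHom.commutes, AlgHom.commutes, Module.algebraMap_end_apply,
          Module.algebraMap_end_apply, map_smul] }
  refine UniversalEnvelopingAlgebra.mem_of_ι_mem S (fun ξ y => ?_) θ y
  rw [mapU_ι, mulU_ι, mulU_ι, mapLin_mulGen α φ hφ]

theorem mapLin_mul (x y : SmashProduct D) :
    mapLin D α φ (x * y) = mapLin D α φ x * mapLin D α φ y := by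
  induction x using induction_on with
  | h0 => simp
  | ht θ F =>
    rw [mapLin_tmul, mul_def, mul_def, mulHom_tmul, mulHom_tmul, Module.End.mul_apply,
      Module.End.mul_apply, mapLin_mulFun, mapLin_mulU α φ hφ]
  | ha x y hx hy => simp only [map_add, add_mul, hx, hy]

/-- The algebra endomorphism of `U(L) ⋉ A` induced by compatible endomorphisms of `L` and `A`. -/
def map : SmashProduct D →ₐ[K] SmashProduct D :=
  AlgHom.ofLinearMap (mapLin D α φ)
    (by rw [one_def, mapLin_tmul, map_one, map_one]) (mapLin_mul α φ hφ)

theorem map_ofFun (F : A) : map α φ hφ (ofFun D F) = ofFun D (φ F) := by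
  change mapLin D α φ (tmul D 1 F) = _
  rw [mapLin_tmul, map_one]
  rfl

theorem map_ofLie (ξ : L) : map α φ hφ (ofLie D ξ) = ofLie D (α ξ) := by
  change mapLin D α φ (tmul D _ 1) = _
  rw [mapLin_tmul, map_one, mapU_ι]
  rfl

end Map

end SmashProduct

end SmashGeneral

/-! ### Derivatives at the unit and the adjoint representation -/

section OneParameter

variable {E : Type*} [NormedAddCommGroup E] [NormedSpace ℝ E]
  {G : Type*} [TopologicalSpace G] [ChartedSpace E G] [Group G] [LieGroup 𝓘(ℝ, E) ∞ G]

/-- The differential of $\Phi$ at $(1,1)$, applied to $(a,a)$, is the sum of the two partial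
derivatives. This splits the decoupled actions, which use the parameter in several places, into
left- and right-invariant fields. -/
theorem derivOne_diag {Φ : G → G → ℂ}
    (hΦ : ContMDiff (𝓘(ℝ, E).prod 𝓘(ℝ, E)) 𝓘(ℝ, ℂ) ∞ (Function.uncurry Φ))
    (a : GroupLieAlgebra 𝓘(ℝ, E) G) :
    derivOne (fun h => Φ h h) a = derivOne (fun h => Φ h 1) a + derivOne (Φ 1) a := by
  have h1 : MDifferentiableAt (𝓘(ℝ, E).prod 𝓘(ℝ, E)) 𝓘(ℝ, ℂ) (Function.uncurry Φ) ((1 : G), (1 : G)) :=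
    (hΦ _).mdifferentiableAt (by simp)
  have h2 := HasMFDerivAt.comp (f := fun h : G => (h, h)) (1 : G) h1.hasMFDerivAt
    ((hasMFDerivAt_id (I := 𝓘(ℝ, E)) (1 : G)).prodMk (hasMFDerivAt_id (1 : G)))
  refine (DFunLike.congr_fun h2.mfderiv a).trans ?_
  let a' : TangentSpace 𝓘(ℝ, E) (1 : G) := a
  let p : TangentSpace (𝓘(ℝ, E).prod 𝓘(ℝ, E)) ((1 : G), (1 : G)) := (a', a')
  exact mfderiv_prod_eq_add_apply (v := p) h1

theorem derivOne_comp_of_map_one {φ : G → ℂ} (hφ : ContMDiff 𝓘(ℝ, E) 𝓘(ℝ, ℂ) ∞ φ) {ψ : G → G}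
    (hψ : ContMDiff 𝓘(ℝ, E) 𝓘(ℝ, E) ∞ ψ) (h1 : ψ 1 = 1) (a : GroupLieAlgebra 𝓘(ℝ, E) G) :
    derivOne (fun x => φ (ψ x)) a =
      derivOne φ ((mfderiv 𝓘(ℝ, E) 𝓘(ℝ, E) ψ (1 : G) : E →L[ℝ] E) a) := by
  -- The point `ψ 1` equals `1` only propositionally, so the derivative at `1` is restated at an
  -- arbitrary `z = 1` before the chain rule is applied.
  have key : ∀ z : G, z = 1 → HasMFDerivAt 𝓘(ℝ, E) 𝓘(ℝ, ℂ) φ z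
      (mfderiv 𝓘(ℝ, E) 𝓘(ℝ, ℂ) φ (1 : G) : E →L[ℝ] ℂ) := by
    rintro _ rfl
    exact ((hφ 1).mdifferentiableAt (by simp)).hasMFDerivAt
  have h := (key (ψ 1) h1).comp (1 : G) ((hψ 1).mdifferentiableAt (by simp)).hasMFDerivAt
  exact DFunLike.congr_fun h.mfderiv a

theorem contMDiff_conj (x : G) : ContMDiff 𝓘(ℝ, E) 𝓘(ℝ, E) ∞ fun h : G => x * h * x⁻¹ :=
  (contMDiff_const.mul contMDiff_id).mul contMDiff_const

theorem derivOne_conj {φ : G → ℂ} (hφ : ContMDiff 𝓘(ℝ, E) 𝓘(ℝ, ℂ) ∞ φ) (x : G)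
    (a : GroupLieAlgebra 𝓘(ℝ, E) G) :
    derivOne (fun h => φ (x * h * x⁻¹)) a = derivOne φ (adRep x a) :=
  derivOne_comp_of_map_one hφ (contMDiff_conj x) (by simp) a

/-- Along the diagonal, $\varphi(h^{-1}k)$ is constant, so its two partial derivatives cancel. -/
theorem derivOne_inv {φ : G → ℂ} (hφ : ContMDiff 𝓘(ℝ, E) 𝓘(ℝ, ℂ) ∞ φ)
    (a : GroupLieAlgebra 𝓘(ℝ, E) G) :
    derivOne (fun h => φ h⁻¹) a = -derivOne φ a := by
  have h := derivOne_diag (Φ := fun h k => φ (h⁻¹ * k))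
    (hφ.comp (contMDiff_fst.inv.mul contMDiff_snd)) a
  simp only [inv_mul_cancel, mul_one, inv_one, one_mul, derivOne_const_fun] at h
  exact eq_neg_of_add_eq_zero_left h.symm

theorem derivOne_sum_vec {ι : Type*} (φ : G → ℂ) (s : Finset ι)
    (v : ι → GroupLieAlgebra 𝓘(ℝ, E) G) :
    derivOne φ (∑ i ∈ s, v i) = ∑ i ∈ s, derivOne φ (v i) :=
  map_sum (mfderiv 𝓘(ℝ, E) 𝓘(ℝ, ℂ) φ (1 : G)) v s

theorem adRep_one (a : GroupLieAlgebra 𝓘(ℝ, E) G) : adRep (1 : G) a = a := by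
  have h : (fun x : G => 1 * x * 1⁻¹) = id := by ext; simp
  change (mfderiv 𝓘(ℝ, E) 𝓘(ℝ, E) (fun x : G => 1 * x * 1⁻¹) (1 : G) : E → E) a = a
  rw [h, mfderiv_id]
  rfl

theorem adRep_mul (x y : G) (a : GroupLieAlgebra 𝓘(ℝ, E) G) :
    adRep (x * y) a = adRep x (adRep y a) := by
  have key : ∀ z : G, z = 1 → HasMFDerivAt 𝓘(ℝ, E) 𝓘(ℝ, E) (fun h : G => x * h * x⁻¹) z
      (adRep x : E →L[ℝ] E) := by
    rintro _ rfl
    exact ((contMDiff_conj x 1).mdifferentiableAt (by simp)).hasMFDerivAt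
  have h := (key (y * 1 * y⁻¹) (by simp)).comp (1 : G)
    ((contMDiff_conj (E := E) y 1).mdifferentiableAt (by simp)).hasMFDerivAt
  have h2 : ((fun h : G => x * h * x⁻¹) ∘ fun h : G => y * h * y⁻¹) =
      fun h => (x * y) * h * (x * y)⁻¹ := by
    funext h; simp [mul_assoc]
  rw [h2] at h
  exact DFunLike.congr_fun h.mfderiv a

variable [FiniteDimensional ℝ E]

/-- Every real linear functional on the Lie algebra is the derivative of a smooth function. -/
theorem exists_derivOne_eq (ℓ : GroupLieAlgebra 𝓘(ℝ, E) G →ₗ[ℝ] ℝ) :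
    ∃ φ : G → ℂ, ContMDiff 𝓘(ℝ, E) 𝓘(ℝ, ℂ) ∞ φ ∧
      ∀ a : GroupLieAlgebra 𝓘(ℝ, E) G, derivOne φ a = ℓ a := by
  -- Extending a cut-off function by zero requires a Hausdorff space. For $G$ this is automatic: the
  -- charts give `T1Space`, and a topological group with that property is Hausdorff.
  have : IsTopologicalGroup G := topologicalGroup_of_lieGroup 𝓘(ℝ, E) ∞
  have : T1Space G := ChartedSpace.t1Space E G
  have : IsManifold 𝓘(ℝ, E) ∞ G := inferInstance
  -- The function is $\ell$ read in the chart at the unit and cut off by `b`. Since `b` is $1$ near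
  -- the unit, the cutoff does not change the derivative there.
  let b : SmoothBumpFunction 𝓘(ℝ, E) (1 : G) := Classical.arbitrary _
  let e := extChartAt 𝓘(ℝ, E) (1 : G)
  let ℓ' : E →ₗ[ℝ] ℝ := ℓ
  let ℓ₁ : E →L[ℝ] ℂ := Complex.ofRealCLM ∘L LinearMap.toContinuousLinearMap ℓ'
  let ψ : G → ℂ := fun x => ℓ₁ (e x)
  have hψ : ContMDiffOn 𝓘(ℝ, E) 𝓘(ℝ, ℂ) ∞ ψ (chartAt E (1 : G)).source :=
    ℓ₁.contMDiff.comp_contMDiffOn (contMDiffOn_extChartAt (I := 𝓘(ℝ, E)) (x := (1 : G)))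
  refine ⟨fun x => b x • ψ x, b.contMDiff_smul hψ, fun a => ?_⟩
  refine (derivOne_eq_fderiv ((b.contMDiff_smul hψ 1).mdifferentiableAt (by simp)) a).trans ?_
  have h1 : ((fun x => b x • ψ x) ∘ e.symm) =ᶠ[𝓝 (e 1)] ℓ₁ := by
    have hc : ContinuousAt e.symm (e 1) := continuousAt_extChartAt_symm (I := 𝓘(ℝ, E)) (1 : G)
    have he : e.symm (e 1) = 1 := extChartAt_to_inv (1 : G)
    have hb : ∀ᶠ x in 𝓝 (e.symm (e 1)), b x = 1 := by
      rw [he]; exact b.eventuallyEq_one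
    filter_upwards [hc.eventually hb, extChartAt_target_mem_nhds (I := 𝓘(ℝ, E)) (1 : G)] with y hy hy'
    simp only [Function.comp_apply, ψ]
    rw [hy, e.right_inv hy']
    simp
  refine (congrArg (fun T : E →L[ℝ] ℂ => T a) (h1.fderiv_eq.trans ℓ₁.fderiv)).trans ?_
  rfl

/-- Coordinates with respect to a basis are themselves derivatives of smooth functions. Identities
in the Lie algebra can therefore be tested on functions. -/
theorem eq_of_derivOne_eq {a b : GroupLieAlgebra 𝓘(ℝ, E) G}
    (h : ∀ φ : G → ℂ, ContMDiff 𝓘(ℝ, E) 𝓘(ℝ, ℂ) ∞ φ → derivOne φ a = derivOne φ b) : a = b := by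
  have : FiniteDimensional ℝ (GroupLieAlgebra 𝓘(ℝ, E) G) := inferInstanceAs (FiniteDimensional ℝ E)
  refine (Module.finBasis ℝ (GroupLieAlgebra 𝓘(ℝ, E) G)).ext_elem fun i => ?_
  obtain ⟨φ, hφ, hd⟩ := exists_derivOne_eq (E := E) (G := G)
    ((Module.finBasis ℝ (GroupLieAlgebra 𝓘(ℝ, E) G)).coord i)
  have h1 := h φ hφ
  rw [hd, hd] at h1
  exact_mod_cast h1

/-- Tested on functions, the bracket is the commutator of left-invariant derivatives, and pullback
along conjugation by $x$ intertwines these derivatives. -/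
theorem adRep_lie [CompleteSpace E] (x : G) (a b : GroupLieAlgebra 𝓘(ℝ, E) G) :
    adRep x ⁅a, b⁆ = (⁅adRep x a, adRep x b⁆ : GroupLieAlgebra 𝓘(ℝ, E) G) := by
  refine eq_of_derivOne_eq fun φ hφ => ?_
  have hL : ∀ g : G, ContMDiff 𝓘(ℝ, E) 𝓘(ℝ, ℂ) ∞ fun h => φ (g * h) := fun g =>
    hφ.comp contMDiff_mul_left
  have hs : ∀ b : GroupLieAlgebra 𝓘(ℝ, E) G,
      ContMDiff 𝓘(ℝ, E) 𝓘(ℝ, ℂ) ∞ fun g => derivOne (fun h => φ (g * h)) b :=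
    fun b => contMDiff_derivOne (Φ := fun g h => φ (g * h)) (hφ.comp (contMDiff_mul 𝓘(ℝ, E) ∞)) b
  have hc : ContMDiff 𝓘(ℝ, E) 𝓘(ℝ, ℂ) ∞ fun h => φ (x * h * x⁻¹) := hφ.comp (contMDiff_conj x)
  rw [← derivOne_conj hφ, ← derivOne_bracket hc, ← derivOne_bracket hφ]
  -- Because $x(gh)x^{-1} = (xgx^{-1})(xhx^{-1})$, each of the two derivatives picks up one factor
  -- $\mathrm{Ad}(x)$.
  have key : ∀ a b : GroupLieAlgebra 𝓘(ℝ, E) G,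
      derivOne (fun g => derivOne (fun h => φ (x * (g * h) * x⁻¹)) b) a =
        derivOne (fun g => derivOne (fun h => φ (g * h)) (adRep x b)) (adRep x a) := by
    intro a b
    rw [← derivOne_conj (hs _)]
    congr 1
    funext g
    rw [← derivOne_conj (hL _)]
    congr 1
    funext h
    congr 1
    group
  rw [key, key]

end OneParameter

/-! ### Matrices of the adjoint representation and the decoupled vector fields -/

section VectorFields

variable {E : Type*} [NormedAddCommGroup E] [NormedSpace ℝ E] [FiniteDimensional ℝ E]
  {G : Type*} [TopologicalSpace G] [ChartedSpace E G] [Group G] [LieGroup 𝓘(ℝ, E) ∞ G]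
  {n g : ℕ} {κ : Type*} [Fintype κ] [DecidableEq κ]
  (J : Module.Basis κ ℝ (GroupLieAlgebra 𝓘(ℝ, E) G))

theorem adRep_basis (x : G) (a : κ) : adRep x (J a) = ∑ b, coAd J x a b • J b :=
  (J.sum_repr _).symm

theorem coAd_mul (x y : G) (a b : κ) :
    coAd J (x * y) a b = ∑ c, coAd J y a c * coAd J x c b := by
  rw [coAd, adRep_mul, adRep_basis J y, map_sum, map_sum]
  refine Finset.sum_congr rfl fun c _ => ?_
  rw [map_smul, map_smul]
  rfl

/-- The matrix `Ad^*(w)_a^b` of functions. -/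
def coAdMat (w : Word E G n g) : Matrix κ κ (SmoothFun E G (Gen n g)) :=
  Matrix.of (coAdFun J w)

theorem SmoothFun.sum_apply {ι ι' : Type*} [Fintype ι] (s : Finset ι')
    (F : ι' → SmoothFun E G ι) (u : ι → G) : (∑ i ∈ s, F i) u = ∑ i ∈ s, F i u := by
  induction s using Finset.cons_induction with
  | empty => rfl
  | cons i s hi ih => rw [Finset.sum_cons, Finset.sum_cons, SmoothFun.add_apply, ih]

/-- The row index labels the argument of $\mathrm{Ad}$ and the column index its value, hence the
reversed order. -/
theorem coAdMat_mul (v w : Word E G n g) : coAdMat J (v * w) = coAdMat J w * coAdMat J v := by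
  ext a b
  refine SmoothFun.ext fun u => ?_
  rw [Matrix.mul_apply, SmoothFun.sum_apply]
  change ((coAd J (v u * w u) a b : ℝ) : ℂ) = ∑ c, (coAd J (w u) a c : ℂ) * (coAd J (v u) c b : ℂ)
  rw [coAd_mul]
  push_cast
  rfl

theorem kron_eq_one_apply (a b : κ) :
    (kron a b : SmoothFun E G (Gen n g)) = (1 : Matrix κ κ (SmoothFun E G (Gen n g))) a b := by
  rw [kron, Matrix.one_apply]

theorem contMDiff_update_const (u : Gen n g → G) (X : Gen n g) :
    ContMDiff 𝓘(ℝ, E) (powModel E (Gen n g)) ∞ fun x : G => Function.update u X x :=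
  contMDiff_update contMDiff_const contMDiff_id X

theorem vecR_apply (X : Gen n g) (a : κ) (F : SmoothFun E G (Gen n g)) (u : Gen n g → G) :
    vecR J X a F u = derivOne (fun h => F (Function.update u X (u X * h))) (J a) := rfl

theorem vecL_apply (X : Gen n g) (a : κ) (F : SmoothFun E G (Gen n g)) (u : Gen n g → G) :
    vecL J X a F u = derivOne (fun h => F (Function.update u X (h⁻¹ * u X))) (J a) := rfl

theorem Derivation.smoothFun_sum_smul_apply
    (c : κ → SmoothFun E G (Gen n g))
    (V : κ → Derivation ℂ (SmoothFun E G (Gen n g)) (SmoothFun E G (Gen n g)))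
    (F : SmoothFun E G (Gen n g)) (u : Gen n g → G) :
    (∑ b, c b • V b) F u = ∑ b, c b u * V b F u := by
  have h : (∑ b, c b • V b) F = ∑ b, c b * V b F := by
    change Derivation.coeFnAddMonoidHom (∑ b, c b • V b) F = _
    rw [map_sum, Finset.sum_apply]
    rfl
  rw [h, SmoothFun.sum_apply]
  rfl

theorem derivOne_conj_basis {φ : G → ℂ} (hφ : ContMDiff 𝓘(ℝ, E) 𝓘(ℝ, ℂ) ∞ φ) (x : G) (a : κ) :
    derivOne (fun h => φ (x * h * x⁻¹)) (J a) =
      ∑ b, (coAd J x a b : ℂ) * derivOne φ (J b) := by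
  rw [derivOne_conj hφ, adRep_basis, derivOne_sum_vec]
  exact Finset.sum_congr rfl fun b _ => derivOne_smul_vec _ _ _

/-- From $h^{-1}u = u\,(u^{-1}h^{-1}u)$: a right-invariant field is a left-invariant one with the
direction rotated by $\mathrm{Ad}(u^{-1})$ and reversed. With it, all fields are expressed through
`vecR`. -/
theorem vecL_eq (X : Gen n g) : vecL J X = -(coAdMat J (uComp E G X)⁻¹ • vecR J X) := by
  funext a
  refine Derivation.ext fun F => SmoothFun.ext fun u => ?_
  have h := Derivation.smoothFun_sum_smul_apply (fun b => coAdFun J (uComp E G X)⁻¹ a b)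
    (fun b => vecR J X b) F u
  refine Eq.trans ?_ (congrArg Neg.neg h.symm)
  have hs : ContMDiff 𝓘(ℝ, E) 𝓘(ℝ, ℂ) ∞ fun h => F (Function.update u X (u X * h)) :=
    (rightFamily E G X).smooth_curry F u
  have hi : ContMDiff 𝓘(ℝ, E) 𝓘(ℝ, ℂ) ∞ fun h : G => F (Function.update u X (u X * h⁻¹)) :=
    hs.comp contMDiff_id.inv
  have h1 := derivOne_conj_basis J hs (u X)⁻¹ a
  have h2 := derivOne_inv (φ := fun k => F (Function.update u X (u X * ((u X)⁻¹ * k * (u X)⁻¹⁻¹))))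
    (hs.comp (contMDiff_conj (u X)⁻¹)) (J a)
  rw [vecL_apply]
  refine Eq.trans ?_ (h2.trans (congrArg Neg.neg h1))
  congr 1
  funext h
  group

theorem decoupledFamily_deriv_M (i : Fin n) (a : κ) :
    (decoupledFamily E G (M i : Gen n g)).deriv (J a) = vecR J (M i) a + vecL J (M i) a := by
  refine Derivation.ext fun F => SmoothFun.ext fun u => ?_
  have hs : ContMDiff (𝓘(ℝ, E).prod 𝓘(ℝ, E)) 𝓘(ℝ, ℂ) ∞
      (Function.uncurry fun k h : G => F (Function.update u (M i) (h⁻¹ * u (M i) * k))) :=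
    F.smooth.comp ((contMDiff_update_const u _).comp
      ((contMDiff_snd.inv.mul contMDiff_const).mul contMDiff_fst))
  refine (derivOne_diag hs (J a)).trans ?_
  change _ = vecR J (M i) a F u + vecL J (M i) a F u
  rw [vecR_apply, vecL_apply]
  simp only [inv_one, one_mul, mul_one]

/-- The motion of the second component is $u_A h u_A^{-1}u_B = u_B\cdot whw^{-1}$ with $w =
u_B^{-1}u_A$, so it is a right translation in the direction $\mathrm{Ad}(w)J_a$. -/
theorem decoupledFamily_deriv_A (j : Fin g) (a : κ) :
    (decoupledFamily E G (A j : Gen n g)).deriv (J a) = vecR J (A j) a +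
      (coAdMat (n := n) J ((uComp E G (B j))⁻¹ * uComp E G (A j)) • vecR J (B j)) a := by
  refine Derivation.ext fun F => SmoothFun.ext fun u => ?_
  have hs : ContMDiff (𝓘(ℝ, E).prod 𝓘(ℝ, E)) 𝓘(ℝ, ℂ) ∞
      (Function.uncurry fun k h : G => F (Function.update (Function.update u (A j) (u (A j) * k))
        (B j) (u (A j) * h * (u (A j))⁻¹ * u (B j)))) :=
    F.smooth.comp (contMDiff_update ((contMDiff_update_const u _).comp
      (contMDiff_const.mul contMDiff_fst))
      (((contMDiff_const.mul contMDiff_snd).mul contMDiff_const).mul contMDiff_const) _)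
  refine (derivOne_diag hs (J a)).trans ?_
  have h := Derivation.smoothFun_sum_smul_apply
    (fun b => coAdFun J ((uComp E G (B j))⁻¹ * uComp E G (A j)) a b)
    (fun b => vecR J (B j : Gen n g) b) F u
  refine Eq.trans ?_ (congrArg (vecR J (A j) a F u + ·) h.symm)
  have hr : ContMDiff 𝓘(ℝ, E) 𝓘(ℝ, ℂ) ∞ fun h => F (Function.update u (B j) (u (B j) * h)) :=
    (rightFamily E G (B j)).smooth_curry F u
  refine congrArg₂ (· + ·) ?_ (Eq.trans ?_ (derivOne_conj_basis J hr ((u (B j))⁻¹ * u (A j)) a))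
  · rw [vecR_apply]
    congr 1
    funext h
    refine congrArg F.1 (funext fun Z => ?_)
    rcases Z with l | l | l <;> simp [Function.update_apply]
    rintro rfl
    rfl
  · congr 1
    funext h
    rw [mul_one, Function.update_eq_self]
    group

end VectorFields

/-! ### The coupling of generators, for values in an arbitrary module -/

section Coupled

variable {E : Type*} [NormedAddCommGroup E] [NormedSpace ℝ E] [FiniteDimensional ℝ E]
  {G : Type*} [TopologicalSpace G] [ChartedSpace E G] [Group G] [LieGroup 𝓘(ℝ, E) ∞ G]
  {n g : ℕ} {κ : Type*} [Fintype κ] [DecidableEq κ]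
  {R : Type*} [CommRing R] {N : Type*} [AddCommGroup N] [Module R N]

/-- The combination `T^k` of the decoupled generators `j`, for matrices `ad w` in the role of
`Ad^*(w)`. -/
def coupledHandle (ad : Word E G n g → Matrix κ κ R) (j : Gen n g → κ → N) (k : Fin g) : κ → N :=
  (1 - ad (uComp E G (A k))⁻¹) • j (A k) +
    (ad (uComp E G (A k))⁻¹ - ad ((uComp E G (B k))⁻¹ * uComp E G (A k))) • j (B k)

/-- The coupled generators, expressed through the decoupled generators `j`, for matrices `ad w` in
the role of `Ad^*(w)`. -/
def coupled (ad : Word E G n g → Matrix κ κ R) (j : Gen n g → κ → N) : Gen n g → κ → N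
  | Sum.inl i => j (M i) + (1 - ad (uComp E G (M i))) •
      (∑ k ∈ Finset.Ioi i, j (M k) + ∑ k, coupledHandle ad j k)
  | Sum.inr (Sum.inl i) => j (A i) - ad (uComp E G (A i))⁻¹ • (j (A i) - j (B i)) +
      (1 - ad (uComp E G (A i))) • ∑ k ∈ Finset.Ioi i, coupledHandle ad j k
  | Sum.inr (Sum.inr i) => j (B i) - ad (uComp E G (A i))⁻¹ • (j (A i) - j (B i)) +
      (1 - ad (uComp E G (B i))) • ∑ k ∈ Finset.Ioi i, coupledHandle ad j k

section Map

variable {R' : Type*} [CommRing R'] {N' : Type*} [AddCommGroup N'] [Module R' N'] {σ : R →+* R'}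

theorem Matrix.Module.map_smul_comp (f : N →ₛₗ[σ] N') (m : Matrix κ κ R) (v : κ → N) :
    f ∘ (m • v) = m.map σ • (f ∘ v) := by
  funext a
  simp only [Function.comp_apply, Matrix.Module.smul_apply, map_sum, map_smulₛₗ, Matrix.map_apply]

theorem comp_add_fun (f : N →ₛₗ[σ] N') (v w : κ → N) : f ∘ (v + w) = f ∘ v + f ∘ w :=
  funext fun _ => map_add f _ _

theorem comp_sub_fun (f : N →ₛₗ[σ] N') (v w : κ → N) : f ∘ (v - w) = f ∘ v - f ∘ w :=
  funext fun _ => map_sub f _ _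

theorem comp_sum_fun {ι : Type*} (f : N →ₛₗ[σ] N') (s : Finset ι) (v : ι → κ → N) :
    f ∘ (∑ i ∈ s, v i) = ∑ i ∈ s, f ∘ v i :=
  funext fun _ => by simp

theorem Matrix.map_one_sub (m : Matrix κ κ R) : (1 - m).map σ = 1 - m.map σ := by
  rw [Matrix.map_sub (hf := map_sub σ), Matrix.map_one _ (map_zero σ) (map_one σ)]

variable (f : N →ₛₗ[σ] N') (ad : Word E G n g → Matrix κ κ R) (j : Gen n g → κ → N)

theorem comp_coupledHandle (k : Fin g) :
    f ∘ coupledHandle ad j k = coupledHandle (fun w => (ad w).map σ) (fun X => f ∘ j X) k := by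
  simp only [coupledHandle, comp_add_fun, Matrix.Module.map_smul_comp,
    Matrix.map_sub (f := σ) (hf := map_sub σ), Matrix.map_one _ (map_zero σ) (map_one σ)]

/-- The coupling consists of sums and matrix actions only. The semilinear form is needed for
conjugation by $h$, which also moves the coefficient functions; linear maps are the case of the
identity. -/
theorem comp_coupled (X : Gen n g) :
    f ∘ coupled ad j X = coupled (fun w => (ad w).map σ) (fun X => f ∘ j X) X := by
  rcases X with i | i | i <;>
    simp only [coupled, comp_add_fun, comp_sub_fun, comp_sum_fun, Matrix.Module.map_smul_comp,
      Matrix.map_one_sub, comp_coupledHandle]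

end Map

theorem map_coupled {N' : Type*} [AddCommGroup N'] [Module R N'] (f : N →ₗ[R] N')
    (ad : Word E G n g → Matrix κ κ R) (j : Gen n g → κ → N) (X : Gen n g) (a : κ) :
    f (coupled ad j X a) = coupled ad (fun X a => f (j X a)) X a :=
  congrFun (comp_coupled f ad j X) a

section Smul

variable {ad ad' : Word E G n g → Matrix κ κ R} {Λ : Matrix κ κ R} {H : Subgroup (Word E G n g)}
  (hH : ∀ X, uComp E G X ∈ H) (h : ∀ w ∈ H, ad' w * Λ = Λ * ad w) (j : Gen n g → κ → N)
include hH h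

theorem coupledHandle_smul (k : Fin g) :
    coupledHandle ad' (fun X => Λ • j X) k = Λ • coupledHandle ad j k := by
  have h1 := h _ (inv_mem (hH (A k)))
  have h2 := h _ (mul_mem (inv_mem (hH (B k))) (hH (A k)))
  simp only [coupledHandle, smul_add, ← mul_smul, sub_mul, mul_sub, h1, h2, one_mul, mul_one]

/-- A change of frame $\Lambda$ that intertwines the two families of matrices passes through the
coupling. Only the words $u_X$, $u_A^{-1}$ and $u_B^{-1}u_A$ occur there, and they lie in every
subgroup that contains the components, so intertwining on $H$ is enough. It is applied to $\Lambda =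
\mathrm{Ad}^*(h)$. -/
theorem coupled_smul (X : Gen n g) : coupled ad' (fun X => Λ • j X) X = Λ • coupled ad j X := by
  have hs : ∀ s : Finset (Fin g), ∑ k ∈ s, coupledHandle ad' (fun X => Λ • j X) k =
      Λ • ∑ k ∈ s, coupledHandle ad j k := fun s => by
    rw [Finset.smul_sum]
    exact Finset.sum_congr rfl fun k _ => coupledHandle_smul hH h j k
  have h1 := fun X => h _ (hH X)
  have h2 := fun X => h _ (inv_mem (hH X))
  rcases X with i | i | i <;>
    simp only [coupled, hs, ← smul_sub, ← Finset.smul_sum, ← smul_add, ← mul_smul, sub_mul, h1, h2,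
      one_mul] <;>
    simp only [smul_add, smul_sub, sub_smul, mul_smul, one_smul]

end Smul

section Span

variable (ad : Word E G n g → Matrix κ κ R) (j : Gen n g → κ → N)

theorem Matrix.Module.smul_mem (p : Submodule R N) (m : Matrix κ κ R) {v : κ → N}
    (hv : ∀ a, v a ∈ p) (a : κ) : (m • v) a ∈ p :=
  sum_mem fun b _ => p.smul_mem _ (hv b)

theorem coupledHandle_mem (p : Submodule R N) {k : Fin g} (hA : ∀ a, j (A k) a ∈ p)
    (hB : ∀ a, j (B k) a ∈ p) (a : κ) : coupledHandle ad j k a ∈ p :=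
  add_mem (Matrix.Module.smul_mem p _ hA a) (Matrix.Module.smul_mem p _ hB a)

theorem sum_fun_mem {ι : Type*} (p : Submodule R N) {s : Finset ι} {v : ι → κ → N}
    (hv : ∀ i ∈ s, ∀ a, v i a ∈ p) (a : κ) : (∑ i ∈ s, v i) a ∈ p := by
  rw [Finset.sum_apply]
  exact sum_mem fun i hi => hv i hi a

/-- This serves as a transfer principle: when `p` encodes a property that is linear over the
functions, the property passes from the decoupled generators to the coupled ones. -/
theorem coupled_mem (p : Submodule R N) (hj : ∀ X a, j X a ∈ p) (X : Gen n g) (a : κ) :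
    coupled ad j X a ∈ p := by
  have hT : ∀ s : Finset (Fin g), ∀ a, (∑ k ∈ s, coupledHandle ad j k) a ∈ p := fun s =>
    sum_fun_mem p fun k _ => coupledHandle_mem ad j p (hj _) (hj _)
  rcases X with i | i | i
  · exact add_mem (hj _ _) (Matrix.Module.smul_mem p _
      (fun a => add_mem (sum_fun_mem p (fun k _ => hj _) a) (hT _ a)) a)
  · exact add_mem (sub_mem (hj _ _) (Matrix.Module.smul_mem p _
      (fun a => sub_mem (hj _ _) (hj _ _)) a)) (Matrix.Module.smul_mem p _ (hT _) a)
  · exact add_mem (sub_mem (hj _ _) (Matrix.Module.smul_mem p _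
      (fun a => sub_mem (hj _ _) (hj _ _)) a)) (Matrix.Module.smul_mem p _ (hT _) a)

/-- The system is triangular, because the tail of each coupled generator involves only larger
indices. Downward induction settles the handles before the $M_i$. The matrices
$1-\mathrm{Ad}^*(u_X)$ need not be invertible, since they only multiply terms already known to lie
in `p`. -/
theorem mem_of_coupled_mem (p : Submodule R N) (hj : ∀ X a, coupled ad j X a ∈ p) :
    ∀ X a, j X a ∈ p := by
  have hAB : ∀ i : Fin g, (∀ a, j (A i) a ∈ p) ∧ ∀ a, j (B i) a ∈ p := by
    intro i
    induction i using WellFoundedGT.induction with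
    | ind i ih =>
      have hT : ∀ a, (∑ k ∈ Finset.Ioi i, coupledHandle ad j k) a ∈ p :=
        sum_fun_mem p fun k hk =>
          coupledHandle_mem ad j p (ih k (Finset.mem_Ioi.mp hk)).1 (ih k (Finset.mem_Ioi.mp hk)).2
      have hA : ∀ a, (j (A i) - ad (uComp E G (A i))⁻¹ • (j (A i) - j (B i))) a ∈ p := fun a =>
        (Submodule.add_mem_iff_left p (Matrix.Module.smul_mem p _ hT a)).mp (hj (A i) a)
      have hB : ∀ a, (j (B i) - ad (uComp E G (A i))⁻¹ • (j (A i) - j (B i))) a ∈ p := fun a =>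
        (Submodule.add_mem_iff_left p (Matrix.Module.smul_mem p _ hT a)).mp (hj (B i) a)
      -- Without their tails, the two coupled generators of a handle carry the same correction
      -- $\mathrm{Ad}^*(u_A^{-1})(j^{A'}-j^{B'})$. It cancels in the difference, and is then known
      -- to lie in `p` itself.
      have hd : ∀ a, (j (A i) - j (B i)) a ∈ p := fun a => by
        have h := sub_mem (hA a) (hB a)
        simpa using h
      exact ⟨fun a => (Submodule.sub_mem_iff_left p (Matrix.Module.smul_mem p _ hd a)).mp (hA a),
        fun a => (Submodule.sub_mem_iff_left p (Matrix.Module.smul_mem p _ hd a)).mp (hB a)⟩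
  have hM : ∀ (i : Fin n) a, j (M i) a ∈ p := by
    intro i
    induction i using WellFoundedGT.induction with
    | ind i ih =>
      intro a
      have hT : ∀ a, (∑ k, coupledHandle ad j k) a ∈ p :=
        sum_fun_mem p fun k _ => coupledHandle_mem ad j p (hAB k).1 (hAB k).2
      exact (Submodule.add_mem_iff_left p (Matrix.Module.smul_mem p _ (fun a => add_mem
        (sum_fun_mem p (fun k hk => ih k (Finset.mem_Ioi.mp hk)) a) (hT a)) a)).mp (hj (M i) a)
  rintro (i | i | i)
  exacts [hM i, (hAB i).1, (hAB i).2]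

end Span

variable (J : Module.Basis κ ℝ (GroupLieAlgebra 𝓘(ℝ, E) G))

theorem handleTerm_eq (k : Fin g) : handleTerm (n := n) J k =
    coupledHandle (coAdMat J) (fun X a => jPrime E G X a) k := by
  funext b
  simp only [handleTerm, coupledHandle, Finset.sum_add_distrib, kron_eq_one_apply]
  rfl

theorem decoupleGen_eq (i : Gen n g × κ) :
    decoupleGen J i = coupled (coAdMat J) (fun X a => jPrime E G X a) i.1 i.2 := by
  rcases i with ⟨i | i | i, a⟩ <;>
    simp only [decoupleGen, handleTerm_eq, kron_eq_one_apply, coupled, Pi.add_apply, Pi.sub_apply,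
      Matrix.Module.smul_apply, Finset.sum_apply, Matrix.sub_apply] <;> rfl

end Coupled

/-! ### The vector fields generated by the coupled generators -/

section Anchor

variable {E : Type*} [NormedAddCommGroup E] [NormedSpace ℝ E] [FiniteDimensional ℝ E]
  {G : Type*} [TopologicalSpace G] [ChartedSpace E G] [Group G] [LieGroup 𝓘(ℝ, E) ∞ G]
  {n g : ℕ} {κ : Type*} [Fintype κ] [DecidableEq κ]
  (J : Module.Basis κ ℝ (GroupLieAlgebra 𝓘(ℝ, E) G))

/-- The derivations `F ↦ -{j^{X'}_a, F}`. -/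
def decoupledVec : Gen n g → κ → Derivation ℂ (SmoothFun E G (Gen n g)) (SmoothFun E G (Gen n g))
  | Sum.inl i, a => (decoupledFamily E G (M i)).deriv (J a)
  | Sum.inr (Sum.inl i), a =>
    (decoupledFamily E G (A i)).deriv (J a) + (decoupledFamily E G (B i)).deriv (J a)
  | Sum.inr (Sum.inr i), a => (decoupledFamily E G (B i)).deriv (J a)

theorem decoupledVec_M (i : Fin n) :
    decoupledVec J (M i : Gen n g) = vecR J (M i) + vecL J (M i) :=
  funext fun a => decoupledFamily_deriv_M J i a

theorem decoupledVec_A (i : Fin g) :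
    decoupledVec J (A i : Gen n g) = vecR J (A i) +
      coAdMat (n := n) J ((uComp E G (B i))⁻¹ * uComp E G (A i)) • vecR J (B i) +
        vecR J (B i) :=
  funext fun a => congrArg (· + vecR J (B i) a) (decoupledFamily_deriv_A J i a)

theorem decoupledVec_B (i : Fin g) : decoupledVec J (B i : Gen n g) = vecR J (B i) := rfl

/-- The combination $T^k$ generates the simultaneous conjugation of $u_{A_k}$ and $u_{B_k}$, which
is why it produces the tails of the Poisson brackets. The key relation is the matrix product
$\mathrm{Ad}^*(u_A^{-1})\,\mathrm{Ad}^*(u_B^{-1}u_A) = \mathrm{Ad}^*(u_B^{-1})$, which turns right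
translations of $u_B$ into left ones. -/
theorem coupledHandle_decoupledVec (k : Fin g) :
    coupledHandle (coAdMat J) (decoupledVec J) k =
      (vecR J (A k) + vecL J (A k) + (vecR J (B k) + vecL J (B k)) :
        κ → Derivation ℂ (SmoothFun E G (Gen n g)) (SmoothFun E G (Gen n g))) := by
  rw [coupledHandle, decoupledVec_A, decoupledVec_B, vecL_eq, vecL_eq]
  have h : coAdMat J ((uComp E G (A k : Gen n g)))⁻¹ *
      coAdMat J ((uComp E G (B k))⁻¹ * uComp E G (A k)) = coAdMat J (uComp E G (B k))⁻¹ := by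
    rw [← coAdMat_mul, mul_inv_cancel_right]
  simp only [smul_add, ← mul_smul, sub_mul, h, one_mul]
  simp only [sub_smul, one_smul]
  abel

theorem sum_above_M {N : Type*} [AddCommMonoid N] (i : Fin n) (f : Gen n g → N) :
    ∑ Y ∈ (M i : Gen n g).above, f Y =
      ∑ k ∈ Finset.Ioi i, f (M k) + ∑ k, (f (A k) + f (B k)) := by
  rw [above, Finset.sum_filter, Fintype.sum_sum_type, Fintype.sum_sum_type,
    Finset.sum_add_distrib, ← Finset.sum_filter]
  have h1 : Finset.filter (fun k : Fin n => (M i : Gen n g).pos < (M k : Gen n g).pos) Finset.univ =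
      Finset.Ioi i := by
    ext k; simp [pos]
  have h2 : ∀ k : Fin g, (M i : Gen n g).pos < (A k : Gen n g).pos := fun k => by
    simp only [pos]; omega
  have h3 : ∀ k : Fin g, (M i : Gen n g).pos < (B k : Gen n g).pos := fun k => by
    simp only [pos]; omega
  simp only [h1, h2, h3, if_true]

/-- The incomparable indices $A_i$ and $B_i$ share the position $n+i$, so one statement covers both.
The strict inequality excludes the whole $i$-th handle from the sum. -/
theorem sum_above_handle {N : Type*} [AddCommMonoid N] {X : Gen n g} {i : Fin g}
    (hX : X.pos = n + i) (f : Gen n g → N) :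
    ∑ Y ∈ X.above, f Y = ∑ k ∈ Finset.Ioi i, (f (A k) + f (B k)) := by
  rw [above, Finset.sum_filter, Fintype.sum_sum_type, Fintype.sum_sum_type,
    Finset.sum_add_distrib]
  have h1 : ∀ k : Fin n, ¬ X.pos < (M k : Gen n g).pos := fun k => by
    rw [hX]; simp only [pos]; omega
  have h2 : Finset.filter (fun k : Fin g => X.pos < (A k : Gen n g).pos) Finset.univ =
      Finset.Ioi i := by
    ext k
    rw [Finset.mem_filter, hX]
    simp [pos]
  have h3 : Finset.filter (fun k : Fin g => X.pos < (B k : Gen n g).pos) Finset.univ =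
      Finset.Ioi i := by
    ext k
    rw [Finset.mem_filter, hX]
    simp [pos]
  rw [← Finset.sum_filter (s := Finset.univ) (fun k : Fin g => X.pos < (A k : Gen n g).pos),
    ← Finset.sum_filter (s := Finset.univ) (fun k : Fin g => X.pos < (B k : Gen n g).pos), h2, h3]
  simp only [h1, if_false, Finset.sum_const_zero, zero_add]

/-- `bracketTail`, as a derivation. -/
def tailVec (X : Gen n g) : κ → Derivation ℂ (SmoothFun E G (Gen n g)) (SmoothFun E G (Gen n g)) :=
  (1 - coAdMat J (uComp E G X)) • ∑ Y ∈ X.above, (vecR J Y + vecL J Y)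

theorem Derivation.coe_sum_apply {R A M ι : Type*} [CommRing R] [CommRing A] [Algebra R A]
    [AddCommGroup M] [Module R M] [Module A M] (s : Finset ι) (D : ι → Derivation R A M) (x : A) :
    (∑ i ∈ s, D i) x = ∑ i ∈ s, D i x := by
  change Derivation.coeFnAddMonoidHom (∑ i ∈ s, D i) x = _
  rw [map_sum, Finset.sum_apply]
  rfl

theorem tailVec_apply (X : Gen n g) (a : κ) (F : SmoothFun E G (Gen n g)) :
    tailVec J X a F = bracketTail J X a F := by
  rw [tailVec, bracketTail, Matrix.Module.smul_apply, Derivation.coe_sum_apply]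
  refine Finset.sum_congr rfl fun b _ => ?_
  rw [Derivation.smul_apply, Finset.sum_apply, Derivation.coe_sum_apply, smul_eq_mul,
    kron_eq_one_apply]
  rfl

/-- The anchor of the coupled generators is the Poisson bracket of the flower algebra. -/
theorem coupled_decoupledVec_apply (X : Gen n g) (a : κ) (F : SmoothFun E G (Gen n g)) :
    coupled (coAdMat J) (decoupledVec J) X a F = -bracketJF J X a F := by
  -- The correction term common to $j^{A_i}$ and $j^{B_i}$ contributes exactly the left translations
  -- of $u_{A_i}$ and $u_{B_i}$.
  have hA : ∀ i : Fin g, coAdMat J ((uComp E G (A i : Gen n g)))⁻¹ •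
      (decoupledVec J (A i : Gen n g) - decoupledVec J (B i)) =
        -(vecL J (A i) + vecL J (B i)) := fun i => by
    rw [decoupledVec_A, decoupledVec_B, add_sub_cancel_right, smul_add, ← mul_smul,
      ← coAdMat_mul, mul_inv_cancel_right, vecL_eq, vecL_eq, neg_add, neg_neg, neg_neg]
  rcases X with i | i | i
  · have h : coupled (coAdMat J) (decoupledVec J) (M i : Gen n g) =
        vecR J (M i) + vecL J (M i) + tailVec J (M i) := by
      rw [coupled, tailVec, sum_above_M, decoupledVec_M]
      simp only [decoupledVec_M, coupledHandle_decoupledVec]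
    refine (congrFun (congrArg DFunLike.coe (congrFun h a)) F).trans ?_
    change vecR J (M i) a F + vecL J (M i) a F + tailVec J (M i) a F = _
    rw [tailVec_apply, bracketJF]
    ring
  · have h : coupled (coAdMat J) (decoupledVec J) (A i : Gen n g) =
        vecR J (A i) + coAdMat (n := n) J ((uComp E G (B i))⁻¹ * uComp E G (A i)) • vecR J (B i) +
          vecR J (B i) + (vecL J (A i) + vecL J (B i)) + tailVec J (A i) := by
      rw [coupled, tailVec, sum_above_handle (i := i) rfl, hA, sub_neg_eq_add, decoupledVec_A]
      simp only [coupledHandle_decoupledVec]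
    refine (congrFun (congrArg DFunLike.coe (congrFun h a)) F).trans ?_
    change vecR J (A i) a F +
      (∑ b, coAdFun (n := n) J ((uComp E G (B i))⁻¹ * uComp E G (A i)) a b • vecR J (B i) b) F +
      vecR J (B i) a F + (vecL J (A i) a F + vecL J (B i) a F) + tailVec J (A i) a F = _
    rw [tailVec_apply, bracketJF, Derivation.coe_sum_apply]
    simp only [Derivation.smul_apply, smul_eq_mul]
    ring
  · have h : coupled (coAdMat J) (decoupledVec J) (B i : Gen n g) =
        vecR J (B i) + (vecL J (A i) + vecL J (B i)) + tailVec J (B i) := by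
      rw [coupled, tailVec, sum_above_handle (i := i) rfl, hA, sub_neg_eq_add, decoupledVec_B]
      simp only [coupledHandle_decoupledVec]
    refine (congrFun (congrArg DFunLike.coe (congrFun h a)) F).trans ?_
    change vecR J (B i) a F + (vecL J (A i) a F + vecL J (B i) a F) + tailVec J (B i) a F = _
    rw [tailVec_apply, bracketJF]
    ring

end Anchor

/-! ### Simultaneous conjugation as automorphisms of the quantum flower algebra -/

section Conjugation

variable {E : Type*} [NormedAddCommGroup E] [NormedSpace ℝ E] [FiniteDimensional ℝ E]
  {G : Type*} [TopologicalSpace G] [ChartedSpace E G] [Group G] [LieGroup 𝓘(ℝ, E) ∞ G]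
  {n g : ℕ}

variable (E G n g) in
/-- The words that are equivariant under simultaneous conjugation. -/
def equivariantWords : Subgroup (Word E G n g) where
  carrier := {w | ∀ (h : G) (u : Gen n g → G), w (fun X => h⁻¹ * u X * h) = h⁻¹ * w u * h}
  mul_mem' {v w} hv hw h u := by
    change v _ * w _ = h⁻¹ * (v u * w u) * h
    rw [hv, hw]
    group
  one_mem' h u := by
    change (1 : G) = h⁻¹ * 1 * h
    group
  inv_mem' {w} hw h u := by
    change (w _)⁻¹ = h⁻¹ * (w u)⁻¹ * h
    rw [hw]
    group

theorem uComp_mem_equivariantWords (X : Gen n g) : uComp E G X ∈ equivariantWords E G n g :=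
  fun _ _ => rfl

/-- $\Phi_\infty$ is a product of components and their inverses. Its equivariance makes the
conjugation of $f\circ\Phi_\infty$ match the semidirect product law. -/
theorem uTotal_mem_equivariantWords : uTotal E G n g ∈ equivariantWords E G n g := by
  refine mul_mem (list_prod_mem fun w hw => ?_) (list_prod_mem fun w hw => ?_)
  · obtain ⟨j, rfl⟩ := (List.mem_ofFn' _ _).mp hw
    have h := uComp_mem_equivariantWords (E := E) (G := G) (n := n) (g := g)
    exact mul_mem (mul_mem (mul_mem (h _) (inv_mem (h _))) (inv_mem (h _))) (h _)
  · obtain ⟨j, rfl⟩ := (List.mem_ofFn' _ _).mp hw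
    exact uComp_mem_equivariantWords _

theorem conjPullback_apply (h : G) (F : SmoothFun E G (Gen n g)) (u : Gen n g → G) :
    conjPullback E G n g h F u = F fun X => h⁻¹ * u X * h := rfl

theorem conjPullback_one (F : SmoothFun E G (Gen n g)) : conjPullback E G n g 1 F = F :=
  SmoothFun.ext fun u => by
    rw [conjPullback_apply]
    simp only [inv_one, one_mul, mul_one]

theorem conjPullback_mul (h k : G) (F : SmoothFun E G (Gen n g)) :
    conjPullback E G n g (h * k) F = conjPullback E G n g h (conjPullback E G n g k F) :=
  SmoothFun.ext fun u => by
    rw [conjPullback_apply, conjPullback_apply, conjPullback_apply]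
    simp only [mul_inv_rev, mul_assoc]

/-- Covariance of the matrices `Ad^*(w)` under simultaneous conjugation. -/
theorem coAdMat_map_conjPullback {κ : Type*} [Fintype κ] [DecidableEq κ]
    (J : Module.Basis κ ℝ (GroupLieAlgebra 𝓘(ℝ, E) G)) (h : G) {w : Word E G n g}
    (hw : w ∈ equivariantWords E G n g) :
    (coAdMat J w).map (conjPullback E G n g h : _ →+* _) *
        Matrix.of (fun a b => algebraMap ℂ (SmoothFun E G (Gen n g)) (coAd J h a b)) =
      Matrix.of (fun a b => algebraMap ℂ (SmoothFun E G (Gen n g)) (coAd J h a b)) *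
        coAdMat J w := by
  ext a b
  refine SmoothFun.ext fun u => ?_
  rw [Matrix.mul_apply, Matrix.mul_apply, SmoothFun.sum_apply, SmoothFun.sum_apply]
  change ∑ c, (coAd J (w fun X => h⁻¹ * u X * h) a c : ℂ) * (coAd J h c b : ℂ) =
    ∑ c, (coAd J h a c : ℂ) * (coAd J (w u) c b : ℂ)
  -- The covariance is the identity $h\,(h^{-1}wh) = wh$, with $\mathrm{Ad}^*$ expanded on both
  -- sides.
  have h1 := coAd_mul J h (h⁻¹ * w u * h) a b
  have h2 := coAd_mul J (w u) h a b
  rw [show h * (h⁻¹ * w u * h) = w u * h by group, h2] at h1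
  rw [hw h u]
  exact_mod_cast h1.symm

/-- The simultaneous adjoint action on the copies of the Lie algebra. -/
def powAd (h : G) : PowLie (Gen n g) (GroupLieAlgebra 𝓘(ℝ, E) G) →ₗ[ℝ]
    PowLie (Gen n g) (GroupLieAlgebra 𝓘(ℝ, E) G) where
  toFun x := fun X => adRep h (x.comp X)
  map_add' _ _ := funext fun _ => map_add (adRep h) _ _
  map_smul' _ _ := funext fun _ => map_smul (adRep h) _ _

theorem powAd_lie (h : G) (x y : PowLie (Gen n g) (GroupLieAlgebra 𝓘(ℝ, E) G)) :
    powAd h ⁅x, y⁆ = ⁅powAd h x, powAd h y⁆ :=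
  funext fun X => adRep_lie h (x.comp X) (y.comp X)

theorem powAd_single (h : G) (X : Gen n g) (a : GroupLieAlgebra 𝓘(ℝ, E) G) :
    powAd h (PowLie.single X a) = PowLie.single X (adRep h a) := by
  funext Y
  change adRep h (Pi.single (M := fun _ => GroupLieAlgebra 𝓘(ℝ, E) G) X a Y) =
    Pi.single (M := fun _ => GroupLieAlgebra 𝓘(ℝ, E) G) X (adRep h a) Y
  by_cases hY : Y = X
  · subst hY; simp
  · simp [Pi.single_eq_of_ne hY]

/-- The complexification of `powAd`. -/
def flowerAd (h : G) : FlowerLie E G n g →ₗ[ℂ] FlowerLie E G n g :=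
  ((TensorProduct.mk ℝ ℂ _ 1) ∘ₗ powAd h).liftBaseChange ℂ

theorem flowerAd_tmul (h : G) (z : ℂ) (x : PowLie (Gen n g) (GroupLieAlgebra 𝓘(ℝ, E) G)) :
    flowerAd h (z ⊗ₜ[ℝ] x) = z ⊗ₜ[ℝ] powAd h x := by
  rw [flowerAd, LinearMap.liftBaseChange_tmul]
  change z • ((1 : ℂ) ⊗ₜ[ℝ] powAd h x) = _
  rw [TensorProduct.smul_tmul', smul_eq_mul, mul_one]

theorem flowerAd_lie (h : G) (x y : FlowerLie E G n g) :
    flowerAd h ⁅x, y⁆ = ⁅flowerAd h x, flowerAd h y⁆ := by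
  refine LinearMap.liftBaseChange_lie _ (fun x y => ?_) x y
  change (1 : ℂ) ⊗ₜ[ℝ] powAd h ⁅x, y⁆ = ⁅(1 : ℂ) ⊗ₜ[ℝ] powAd h x, (1 : ℂ) ⊗ₜ[ℝ] powAd h y⁆
  rw [LieAlgebra.ExtendScalars.bracket_tmul, powAd_lie, one_mul]

/-- `flowerAd`, as a homomorphism of the rescaled Lie algebra. -/
def scaledAd (c : ℂ) (h : G) :
    ScaledLie c (FlowerLie E G n g) →ₗ⁅ℂ⁆ ScaledLie c (FlowerLie E G n g) where
  toLinearMap := (ScaledLie.of c _).toLinearMap ∘ₗ flowerAd h ∘ₗ (ScaledLie.of c _).symm.toLinearMap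
  map_lie' {x y} := by
    change ScaledLie.of c _ (flowerAd h (c • ⁅(ScaledLie.of c _).symm x, (ScaledLie.of c _).symm y⁆)) =
      ScaledLie.of c _ (c • ⁅flowerAd h ((ScaledLie.of c _).symm x),
        flowerAd h ((ScaledLie.of c _).symm y)⁆)
    rw [map_smul, flowerAd_lie]

theorem scaledAd_of (c : ℂ) (h : G) (x : FlowerLie E G n g) :
    scaledAd c h (ScaledLie.of c _ x) = ScaledLie.of c _ (flowerAd h x) := rfl

/-- The decoupled actions are given by words in the components and the parameter, so conjugating the
components and the parameter together conjugates the result. -/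
theorem decoupledFamily_conj (X : Gen n g) (h k : G) (u : Gen n g → G) :
    (fun Y => h⁻¹ * (decoupledFamily E G X).map u (h * k * h⁻¹) Y * h) =
      (decoupledFamily E G X).map (fun Y => h⁻¹ * u Y * h) k := by
  funext Z
  rcases X with i | i | i <;> rcases Z with l | l | l <;>
    simp only [decoupledFamily, rightFamily, Function.update_apply, reduceCtorEq, if_false,
      Sum.inr.injEq, Sum.inl.injEq] <;> split_ifs <;> group

theorem conjPullback_deriv (X : Gen n g) (h : G) (a : GroupLieAlgebra 𝓘(ℝ, E) G)
    (F : SmoothFun E G (Gen n g)) :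
    conjPullback E G n g h ((decoupledFamily E G X).deriv a F) =
      (decoupledFamily E G X).deriv (adRep h a) (conjPullback E G n g h F) := by
  refine SmoothFun.ext fun u => ?_
  rw [conjPullback_apply, SmoothFamily.deriv_apply, SmoothFamily.deriv_apply,
    ← derivOne_conj ((decoupledFamily E G X).smooth_curry _ u)]
  congr 1
  funext k
  exact congrArg F.1 (decoupledFamily_conj X h k u).symm

theorem conjPullback_decoupledDeriv (h : G) (x : PowLie (Gen n g) (GroupLieAlgebra 𝓘(ℝ, E) G))
    (F : SmoothFun E G (Gen n g)) :
    conjPullback E G n g h (decoupledDeriv E G n g x F) =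
      decoupledDeriv E G n g (powAd h x) (conjPullback E G n g h F) := by
  rw [decoupledDeriv_apply, decoupledDeriv_apply, Derivation.coe_sum_apply,
    Derivation.coe_sum_apply, map_sum]
  exact Finset.sum_congr rfl fun X _ => conjPullback_deriv X h _ F

/-- This is the compatibility that `SmashProduct.map` needs in order to be multiplicative. It is
checked on pure tensors, where it reduces to the single decoupled actions. -/
theorem conjPullback_quantumDeriv (ħ : ℝ) (h : G)
    (ξ : ScaledLie (-(Complex.I * ħ)) (FlowerLie E G n g)) (F : SmoothFun E G (Gen n g)) :
    conjPullback E G n g h (quantumDeriv E G n g ħ ξ F) =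
      quantumDeriv E G n g ħ (scaledAd _ h ξ) (conjPullback E G n g h F) := by
  have key : ∀ x : FlowerLie E G n g, conjPullback E G n g h (decoupledDerivC E G n g x F) =
      decoupledDerivC E G n g (flowerAd h x) (conjPullback E G n g h F) := by
    intro x
    induction x using TensorProduct.induction_on with
    | zero => simp
    | add x y hx hy => simp only [map_add, Derivation.add_apply, hx, hy]
    | tmul z x =>
      rw [flowerAd_tmul, decoupledDerivC, LinearMap.liftBaseChange_tmul,
        LinearMap.liftBaseChange_tmul, Derivation.smul_apply, Derivation.smul_apply, map_smul,
        conjPullback_decoupledDeriv]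
  change conjPullback E G n g h
      ((-(Complex.I * (ħ : ℂ))) • decoupledDerivC E G n g ((ScaledLie.of _ _).symm ξ) F) =
    (-(Complex.I * (ħ : ℂ))) • decoupledDerivC E G n g
      (flowerAd h ((ScaledLie.of _ _).symm ξ)) (conjPullback E G n g h F)
  rw [map_smul, key]

variable (E G n g) in
/-- The automorphisms of the quantum flower algebra defined by simultaneous conjugation. -/
def conjAut (ħ : ℝ) : G →* (QuantumFlower E G n g ħ →ₐ[ℂ] QuantumFlower E G n g ħ) where
  toFun h := SmashProduct.map (scaledAd _ h) (conjPullback E G n g h)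
    (conjPullback_quantumDeriv ħ h)
  map_one' := by
    refine SmashProduct.algHom_ext _ (fun F => ?_) (fun ξ => ?_)
    · rw [SmashProduct.map_ofFun, conjPullback_one]; rfl
    · rw [SmashProduct.map_ofLie]
      have key : ∀ x : FlowerLie E G n g, flowerAd 1 x = x := by
        intro x
        induction x using TensorProduct.induction_on with
        | zero => simp
        | add x y hx hy => rw [map_add, hx, hy]
        | tmul z x =>
          rw [flowerAd_tmul]
          exact congrArg _ (funext fun X => adRep_one _)
      exact congrArg _ (key ξ)
  map_mul' h k := by
    refine SmashProduct.algHom_ext _ (fun F => ?_) (fun ξ => ?_)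
    · rw [SmashProduct.map_ofFun, conjPullback_mul, AlgHom.mul_apply, SmashProduct.map_ofFun,
        SmashProduct.map_ofFun]
    · rw [SmashProduct.map_ofLie, AlgHom.mul_apply, SmashProduct.map_ofLie,
        SmashProduct.map_ofLie]
      have key : ∀ x : FlowerLie E G n g, flowerAd (h * k) x = flowerAd h (flowerAd k x) := by
        intro x
        induction x using TensorProduct.induction_on with
        | zero => simp
        | add x y hx hy => simp only [map_add, hx, hy]
        | tmul z x =>
          rw [flowerAd_tmul, flowerAd_tmul, flowerAd_tmul]
          exact congrArg _ (funext fun X => adRep_mul _ _ _)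
      exact congrArg _ (key ξ)

theorem conjAut_ofFun (ħ : ℝ) (h : G) (F : SmoothFun E G (Gen n g)) :
    conjAut E G n g ħ h (SmashProduct.ofFun _ F) =
      SmashProduct.ofFun _ (conjPullback E G n g h F) :=
  SmashProduct.map_ofFun _ _ (conjPullback_quantumDeriv ħ h) F

theorem conjAut_ofLie (ħ : ℝ) (h : G) (ξ : ScaledLie (-(Complex.I * ħ)) (FlowerLie E G n g)) :
    conjAut E G n g ħ h (SmashProduct.ofLie _ ξ) = SmashProduct.ofLie _ (scaledAd _ h ξ) :=
  SmashProduct.map_ofLie _ _ (conjPullback_quantumDeriv ħ h) ξ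

end Conjugation

/-! ### Exponentials of smooth functions -/

section Exponential

variable {E : Type*} [NormedAddCommGroup E] [NormedSpace ℝ E] [FiniteDimensional ℝ E]
  {G : Type*} [TopologicalSpace G] [ChartedSpace E G] [Group G] [LieGroup 𝓘(ℝ, E) ∞ G]

/-- The exponential of a smooth function. -/
def SmoothFun.exp {ι : Type*} [Fintype ι] (F : SmoothFun E G ι) : SmoothFun E G ι :=
  SmoothFun.mk (fun u => Complex.exp (F u))
    ((Complex.contDiff_exp (𝕜 := ℝ) (n := ∞)).contMDiff.comp F.smooth)

theorem SmoothFun.exp_add {ι : Type*} [Fintype ι] (F K : SmoothFun E G ι) :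
    SmoothFun.exp (F + K) = SmoothFun.exp F * SmoothFun.exp K :=
  SmoothFun.ext fun _ => Complex.exp_add _ _

theorem SmoothFun.exp_zero {ι : Type*} [Fintype ι] : SmoothFun.exp (0 : SmoothFun E G ι) = 1 :=
  SmoothFun.ext fun _ => Complex.exp_zero

theorem derivOne_exp {φ : G → ℂ} (hφ : ContMDiff 𝓘(ℝ, E) 𝓘(ℝ, ℂ) ∞ φ)
    (a : GroupLieAlgebra 𝓘(ℝ, E) G) :
    derivOne (fun h => Complex.exp (φ h)) a = Complex.exp (φ 1) * derivOne φ a := by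
  have h1 : HasFDerivAt Complex.exp
      ((ContinuousLinearMap.toSpanSingleton ℂ (Complex.exp (φ 1))).restrictScalars ℝ) (φ 1) :=
    (Complex.hasDerivAt_exp (φ 1)).hasFDerivAt.restrictScalars ℝ
  have h := h1.hasMFDerivAt.comp (1 : G) ((hφ 1).mdifferentiableAt (by simp)).hasMFDerivAt
  refine (DFunLike.congr_fun h.mfderiv a).trans ?_
  exact mul_comm (derivOne φ a) _

theorem SmoothFamily.deriv_exp {ι : Type*} [Fintype ι] (Φ : SmoothFamily E G ι)
    (a : GroupLieAlgebra 𝓘(ℝ, E) G) (F : SmoothFun E G ι) :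
    Φ.deriv a (SmoothFun.exp F) = SmoothFun.exp F * Φ.deriv a F :=
  SmoothFun.ext fun u => by
    refine (derivOne_exp (Φ.smooth_curry F u) a).trans ?_
    rw [Φ.map_one]
    rfl

end Exponential

/-! ### The left module structure over the functions -/

section LeftModule

variable {K L A : Type*} [CommRing K] [LieRing L] [LieAlgebra K L] [CommRing A] [Algebra K A]

namespace SmashProduct

/-- `U(L) ⋉ A` as a left module over `A`. -/
instance leftModule (D : L →ₗ⁅K⁆ Derivation K A A) : Module A (SmashProduct D) :=
  Module.compHom _ (ofFunHom D).toRingHom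

variable (D : L →ₗ⁅K⁆ Derivation K A A)

theorem left_smul_def (F : A) (x : SmashProduct D) : F • x = ofFun D F * x := rfl

instance : IsScalarTower K A (SmashProduct D) where
  smul_assoc c F x := by
    rw [left_smul_def, left_smul_def, ofFun, tmul_smul, smul_mul_assoc]
    rfl

end SmashProduct

end LeftModule

/-! ### Quantum coupled generators, gauge transformations and the group action -/

section Quantum

variable {E : Type*} [NormedAddCommGroup E] [NormedSpace ℝ E] [FiniteDimensional ℝ E]
  {G : Type*} [TopologicalSpace G] [ChartedSpace E G] [Group G] [LieGroup 𝓘(ℝ, E) ∞ G]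
  {n g : ℕ} {κ : Type*} [Fintype κ] [DecidableEq κ] (ħ : ℝ)
  (J : Module.Basis κ ℝ (GroupLieAlgebra 𝓘(ℝ, E) G))

/-- The image of the generator `j^X_a` in the quantum flower algebra. -/
def jCoupled (X : Gen n g) (a : κ) : QuantumFlower E G n g ħ :=
  coupled (coAdMat J) (fun X a => jHat ħ J (X, a)) X a

theorem quantumDeriv_single (X : Gen n g) (a : GroupLieAlgebra 𝓘(ℝ, E) G) :
    quantumDeriv E G n g ħ (ScaledLie.of _ _ (1 ⊗ₜ[ℝ] PowLie.single X a)) =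
      (-(Complex.I * (ħ : ℂ))) • (decoupledFamily E G X).deriv a := by
  change (-(Complex.I * (ħ : ℂ))) • decoupledDerivC E G n g (1 ⊗ₜ[ℝ] PowLie.single X a) = _
  rw [decoupledDerivC, LinearMap.liftBaseChange_tmul, one_smul, decoupledDeriv_apply,
    Finset.sum_eq_single X]
  · congr 2
    exact Pi.single_eq_same (M := fun _ => GroupLieAlgebra 𝓘(ℝ, E) G) X a
  · intro Y _ hY
    have h : (PowLie.single X a).comp Y = 0 :=
      Pi.single_eq_of_ne (M := fun _ => GroupLieAlgebra 𝓘(ℝ, E) G) hY a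
    rw [h]
    exact map_zero (decoupledFamily E G Y).derivLin
  · simp

/-- The pairs `(x, d)` such that the commutator with `x` acts on functions by `-iħ d`. -/
def commutatorPairs : Submodule (SmoothFun E G (Gen n g)) (QuantumFlower E G n g ħ ×
    Derivation ℂ (SmoothFun E G (Gen n g)) (SmoothFun E G (Gen n g))) where
  carrier := {p | ∀ F, p.1 * SmashProduct.ofFun _ F = SmashProduct.ofFun _ F * p.1 +
    SmashProduct.ofFun _ ((-(Complex.I * (ħ : ℂ))) • p.2 F)}
  add_mem' {p q} hp hq F := by
    rw [Prod.fst_add, Prod.snd_add, Derivation.add_apply, smul_add, SmashProduct.ofFun_add, add_mul,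
      mul_add, hp, hq]
    abel
  zero_mem' F := by
    simp only [Prod.fst_zero, Prod.snd_zero, Derivation.zero_apply, smul_zero, zero_mul, mul_zero,
      zero_add]
    exact (map_zero (SmashProduct.ofFunHom (quantumDeriv E G n g ħ))).symm
  smul_mem' K p hp F := by
    rw [Prod.smul_fst, Prod.smul_snd, Derivation.smul_apply, smul_eq_mul,
      SmashProduct.left_smul_def, mul_assoc, hp, mul_add, ← mul_assoc, ← mul_assoc,
      ← SmashProduct.ofFun_mul, ← SmashProduct.ofFun_mul, ← SmashProduct.ofFun_mul, mul_comm K F,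
      mul_smul_comm]

theorem kHat_mem_commutatorPairs (X : Gen n g) (a : κ) :
    (kHat ħ J X a, (decoupledFamily E G X).deriv (J a)) ∈ commutatorPairs (E := E) (G := G) ħ := by
  intro F
  change SmashProduct.ofLie _ _ * _ = _ * SmashProduct.ofLie _ _ + _
  rw [SmashProduct.ofLie_mul_ofFun, quantumDeriv_single]
  rfl

theorem jHat_mem_commutatorPairs (X : Gen n g) (a : κ) :
    (jHat ħ J (X, a), decoupledVec J X a) ∈ commutatorPairs (E := E) (G := G) ħ := by
  rcases X with i | i | i
  · exact kHat_mem_commutatorPairs ħ J _ _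
  · exact add_mem (kHat_mem_commutatorPairs ħ J (A i) a) (kHat_mem_commutatorPairs ħ J (B i) a)
  · exact kHat_mem_commutatorPairs ħ J _ _

/-- The commutator of a generator and a function is `iħ` times their Poisson bracket. -/
theorem jCoupled_mul_ofFun (X : Gen n g) (a : κ) (F : SmoothFun E G (Gen n g)) :
    jCoupled ħ J X a * SmashProduct.ofFun _ F = SmashProduct.ofFun _ F * jCoupled ħ J X a +
      SmashProduct.ofFun _ ((Complex.I * (ħ : ℂ)) • bracketJF J X a F) := by
  -- Quantum generators and vector fields are coupled simultaneously, as pairs. The pairs with the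
  -- right commutator form a submodule over the functions, so the decoupled case implies the coupled
  -- one, and the two projections recover the separate couplings.
  have h := coupled_mem (coAdMat J) (fun X a => (jHat ħ J (X, a), decoupledVec J X a))
    (commutatorPairs (E := E) (G := G) ħ) (jHat_mem_commutatorPairs ħ J) X a F
  have h1 := map_coupled (LinearMap.fst (SmoothFun E G (Gen n g)) (QuantumFlower E G n g ħ)
    (Derivation ℂ (SmoothFun E G (Gen n g)) (SmoothFun E G (Gen n g)))) (coAdMat J)
    (fun X a => (jHat ħ J (X, a), decoupledVec J X a)) X a
  have h2 := map_coupled (LinearMap.snd (SmoothFun E G (Gen n g)) (QuantumFlower E G n g ħ)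
    (Derivation ℂ (SmoothFun E G (Gen n g)) (SmoothFun E G (Gen n g)))) (coAdMat J)
    (fun X a => (jHat ħ J (X, a), decoupledVec J X a)) X a
  simp only [LinearMap.fst_apply] at h1
  simp only [LinearMap.snd_apply] at h2
  rw [h1, h2] at h
  refine h.trans ?_
  congr 2
  have h3 := coupled_decoupledVec_apply J X a F
  refine (congrArg _ h3).trans ?_
  rw [smul_neg, neg_smul, neg_neg]

/-- The chain rule for the exponential is available for derivatives along smooth families. The
derivations that satisfy it at a fixed $F$ form a submodule, so it extends to the coupled vector
fields, which give the bracket up to sign. -/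
theorem bracketJF_exp (X : Gen n g) (a : κ) (F : SmoothFun E G (Gen n g)) :
    bracketJF J X a (SmoothFun.exp F) = SmoothFun.exp F * bracketJF J X a F := by
  let p : Submodule (SmoothFun E G (Gen n g))
      (Derivation ℂ (SmoothFun E G (Gen n g)) (SmoothFun E G (Gen n g))) :=
    { carrier := {d | d (SmoothFun.exp F) = SmoothFun.exp F * d F}
      add_mem' := fun {d d'} hd hd' => by
        rw [Set.mem_ofPred_eq] at *
        rw [Derivation.add_apply, Derivation.add_apply, hd, hd', mul_add]
      zero_mem' := by simp
      smul_mem' := fun K d hd => by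
        rw [Set.mem_ofPred_eq] at *
        rw [Derivation.smul_apply, Derivation.smul_apply, hd, smul_eq_mul, smul_eq_mul,
          mul_left_comm] }
  have hk : ∀ (X : Gen n g) (a : κ), (decoupledFamily E G X).deriv (J a) ∈ p := fun X a =>
    SmoothFamily.deriv_exp _ _ F
  have h : coupled (coAdMat J) (decoupledVec J) X a ∈ p := by
    refine coupled_mem (coAdMat J) (decoupledVec J) p (fun X a => ?_) X a
    rcases X with i | i | i
    · exact hk _ _
    · exact add_mem (hk (A i) a) (hk (B i) a)
    · exact hk _ _
  have h1 : coupled (coAdMat J) (decoupledVec J) X a (SmoothFun.exp F) =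
    SmoothFun.exp F * coupled (coAdMat J) (decoupledVec J) X a F := h
  rw [coupled_decoupledVec_apply, coupled_decoupledVec_apply, mul_neg, neg_inj] at h1
  exact h1

/-- The function `exp(f ∘ Φ_∞ / (iħ))`. -/
def gaugeFun (f : C^∞⟮𝓘(ℝ, E), G; ℝ⟯) : SmoothFun E G (Gen n g) :=
  SmoothFun.exp ((Complex.I * (ħ : ℂ))⁻¹ • compTotal f)

theorem gaugeFun_add (f f' : C^∞⟮𝓘(ℝ, E), G; ℝ⟯) :
    gaugeFun (n := n) (g := g) ħ (f + f') = gaugeFun ħ f * gaugeFun ħ f' := by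
  have h : compTotal (n := n) (g := g) (f + f') = compTotal f + compTotal f' :=
    SmoothFun.ext fun u => Complex.ofReal_add _ _
  rw [gaugeFun, h, smul_add, SmoothFun.exp_add]
  rfl

theorem gaugeFun_zero : gaugeFun (n := n) (g := g) ħ (0 : C^∞⟮𝓘(ℝ, E), G; ℝ⟯) = 1 := by
  have h : compTotal (n := n) (g := g) (0 : C^∞⟮𝓘(ℝ, E), G; ℝ⟯) = 0 :=
    SmoothFun.ext fun u => Complex.ofReal_zero
  rw [gaugeFun, h, smul_zero, SmoothFun.exp_zero]

theorem gaugeFun_neg_mul (f : C^∞⟮𝓘(ℝ, E), G; ℝ⟯) :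
    gaugeFun (n := n) (g := g) ħ (-f) * gaugeFun ħ f = 1 := by
  rw [← gaugeFun_add, neg_add_cancel, gaugeFun_zero]

theorem gaugeFun_mul_neg (f : C^∞⟮𝓘(ℝ, E), G; ℝ⟯) :
    gaugeFun (n := n) (g := g) ħ f * gaugeFun ħ (-f) = 1 := by
  rw [mul_comm, gaugeFun_neg_mul]

theorem conjPullback_gaugeFun (h : G) (f : C^∞⟮𝓘(ℝ, E), G; ℝ⟯) :
    conjPullback E G n g h (gaugeFun ħ f) = gaugeFun ħ (conjFun E G h f) :=
  SmoothFun.ext fun u => by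
    change Complex.exp (_ * (f (uTotal E G n g fun X => h⁻¹ * u X * h) : ℂ)) =
      Complex.exp (_ * (f (h⁻¹ * uTotal E G n g u * h) : ℂ))
    rw [uTotal_mem_equivariantWords h u]

variable (n g) in
/-- Conjugation `x ↦ e^{-ψ} x e^ψ` with `ψ = f ∘ Φ_∞ / (iħ)`. -/
def gaugeAut (f : C^∞⟮𝓘(ℝ, E), G; ℝ⟯) : QuantumFlower E G n g ħ →ₐ[ℂ] QuantumFlower E G n g ħ where
  toFun x := SmashProduct.ofFun _ (gaugeFun ħ (-f)) * x * SmashProduct.ofFun _ (gaugeFun ħ f)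
  map_one' := by
    rw [mul_one, ← SmashProduct.ofFun_mul, gaugeFun_neg_mul, SmashProduct.ofFun_one]
  map_mul' x y := by
    have h : SmashProduct.ofFun (quantumDeriv E G n g ħ) (gaugeFun ħ f) *
        SmashProduct.ofFun _ (gaugeFun ħ (-f)) = 1 := by
      rw [← SmashProduct.ofFun_mul, gaugeFun_mul_neg, SmashProduct.ofFun_one]
    calc _ = SmashProduct.ofFun _ (gaugeFun ħ (-f)) * x *
          1 * y * SmashProduct.ofFun _ (gaugeFun ħ f) := by simp only [mul_one, mul_assoc]
      _ = _ := by rw [← h]; simp only [mul_assoc]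
  map_zero' := by rw [mul_zero, zero_mul]
  map_add' x y := by rw [mul_add, add_mul]
  commutes' c := by
    rw [← Algebra.commutes c, mul_assoc, ← SmashProduct.ofFun_mul, gaugeFun_neg_mul,
      SmashProduct.ofFun_one, mul_one]

theorem gaugeAut_apply (f : C^∞⟮𝓘(ℝ, E), G; ℝ⟯) (x : QuantumFlower E G n g ħ) :
    gaugeAut n g ħ f x =
      SmashProduct.ofFun _ (gaugeFun ħ (-f)) * x * SmashProduct.ofFun _ (gaugeFun ħ f) := rfl

theorem gaugeAut_ofFun (f : C^∞⟮𝓘(ℝ, E), G; ℝ⟯) (F : SmoothFun E G (Gen n g)) :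
    gaugeAut n g ħ f (SmashProduct.ofFun _ F) = SmashProduct.ofFun _ F := by
  rw [gaugeAut_apply, ← SmashProduct.ofFun_mul, ← SmashProduct.ofFun_mul, mul_right_comm,
    gaugeFun_neg_mul, one_mul]

/-- Moving $e^{\psi}$ to the left past the generator leaves the commutator
$i\hbar\,e^{\psi}\{j,\psi\}$. The factor $i\hbar$ cancels against the one in $\psi =
f\circ\Phi_\infty/(i\hbar)$, and $e^{\psi}$ against $e^{-\psi}$. There are no higher-order terms. -/
theorem gaugeAut_jCoupled {ħ : ℝ} (hħ : ħ ≠ 0) (f : C^∞⟮𝓘(ℝ, E), G; ℝ⟯) (X : Gen n g) (a : κ) :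
    gaugeAut n g ħ f (jCoupled ħ J X a) =
      jCoupled ħ J X a + SmashProduct.ofFun _ (bracketJF J X a (compTotal f)) := by
  have hc : Complex.I * (ħ : ℂ) ≠ 0 :=
    mul_ne_zero Complex.I_ne_zero (Complex.ofReal_ne_zero.mpr hħ)
  -- Homogeneity of the bracket in the function is read off from the derivation that represents it
  -- up to sign.
  have hl : bracketJF J X a ((Complex.I * (ħ : ℂ))⁻¹ • compTotal f) =
      (Complex.I * (ħ : ℂ))⁻¹ • bracketJF J X a (compTotal f) := by
    rw [← neg_inj, ← coupled_decoupledVec_apply, ← smul_neg, ← coupled_decoupledVec_apply,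
      Derivation.map_smul]
  rw [gaugeAut_apply, mul_assoc, jCoupled_mul_ofFun, mul_add, ← mul_assoc,
    ← SmashProduct.ofFun_mul, ← SmashProduct.ofFun_mul, gaugeFun_neg_mul, SmashProduct.ofFun_one,
    one_mul, gaugeFun.eq_def ħ f, bracketJF_exp, hl, mul_smul_comm, mul_smul_comm,
    mul_smul_comm, smul_smul, mul_inv_cancel₀ hc,
    one_smul, ← mul_assoc, ← gaugeFun.eq_def ħ f, gaugeFun_neg_mul, one_mul]

/-- This commutation rule is the one that defines $G\ltimes C^\infty(G)$, so the composites in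
`symEnd` multiply as required. -/
theorem conjAut_gaugeAut (h : G) (f : C^∞⟮𝓘(ℝ, E), G; ℝ⟯) (x : QuantumFlower E G n g ħ) :
    conjAut E G n g ħ h (gaugeAut n g ħ f x) =
      gaugeAut n g ħ (conjFun E G h f) (conjAut E G n g ħ h x) := by
  rw [gaugeAut_apply, gaugeAut_apply, map_mul, map_mul, conjAut_ofFun, conjAut_ofFun,
    conjPullback_gaugeFun, conjPullback_gaugeFun]
  rfl

theorem gaugeAut_add (f f' : C^∞⟮𝓘(ℝ, E), G; ℝ⟯) (x : QuantumFlower E G n g ħ) :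
    gaugeAut n g ħ (f + f') x = gaugeAut n g ħ f (gaugeAut n g ħ f' x) := by
  rw [gaugeAut_apply, gaugeAut_apply, gaugeAut_apply, neg_add, gaugeFun_add, add_comm f,
    gaugeFun_add, SmashProduct.ofFun_mul, SmashProduct.ofFun_mul]
  simp only [mul_assoc]

variable (E G n g) in
/-- The action of the group `G ⋉ C^∞(G)` on the quantum flower algebra by endomorphisms. -/
def symEnd : SymGroup E G →* (QuantumFlower E G n g ħ →ₐ[ℂ] QuantumFlower E G n g ħ) where
  toFun s := (gaugeAut n g ħ s.left.toAdd).comp (conjAut E G n g ħ s.right)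
  map_one' := AlgHom.ext fun x => by
    change gaugeAut n g ħ 0 (conjAut E G n g ħ 1 x) = x
    rw [map_one, gaugeAut_apply, neg_zero, gaugeFun_zero, SmashProduct.ofFun_one, one_mul, mul_one]
    rfl
  map_mul' s t := AlgHom.ext fun x => by
    change gaugeAut n g ħ (s.left.toAdd + conjFun E G s.right t.left.toAdd)
      (conjAut E G n g ħ (s.right * t.right) x) = gaugeAut n g ħ s.left.toAdd
        (conjAut E G n g ħ s.right (gaugeAut n g ħ t.left.toAdd (conjAut E G n g ħ t.right x)))
    rw [gaugeAut_add, conjAut_gaugeAut, map_mul]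
    rfl

variable (E G n g) in
/-- The action of the group `G ⋉ C^∞(G)` on the quantum flower algebra by automorphisms. -/
def symAut : SymGroup E G →* (QuantumFlower E G n g ħ ≃ₐ[ℂ] QuantumFlower E G n g ħ) :=
  -- A homomorphism from a group to a monoid takes values in the units, and the units of the
  -- endomorphism monoid are the automorphisms. Bijectivity thus needs no separate argument.
  (AlgEquiv.algHomUnitsEquiv ℂ (QuantumFlower E G n g ħ)).toMonoidHom.comp
    (symEnd E G n g ħ).toHomUnits

theorem symAut_mk_apply (h : G) (f : C^∞⟮𝓘(ℝ, E), G; ℝ⟯) (x : QuantumFlower E G n g ħ) :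
    symAut E G n g ħ (SymGroup.mk h f) x = gaugeAut n g ħ f (conjAut E G n g ħ h x) := rfl

theorem conjAut_kHat (h : G) (X : Gen n g) (a : κ) :
    conjAut E G n g ħ h (kHat ħ J X a) = ∑ b, (coAd J h a b : ℂ) • kHat ħ J X b := by
  rw [kHat, conjAut_ofLie, scaledAd_of, flowerAd_tmul, powAd_single, adRep_basis]
  let V : GroupLieAlgebra 𝓘(ℝ, E) G →ₗ[ℝ] PowLie (Gen n g) (GroupLieAlgebra 𝓘(ℝ, E) G) :=
    LinearMap.single ℝ (fun _ : Gen n g => GroupLieAlgebra 𝓘(ℝ, E) G) X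
  change SmashProduct.ofLieLin _ (ScaledLie.of _ _ (1 ⊗ₜ[ℝ] V (∑ b, coAd J h a b • J b))) = _
  rw [map_sum, TensorProduct.tmul_sum, map_sum, map_sum]
  refine Finset.sum_congr rfl fun b _ => ?_
  -- The coefficients of $\mathrm{Ad}(h)$ are real. They become complex scalars in the complexified
  -- Lie algebra before the complex-linear maps are applied.
  rw [map_smul, TensorProduct.tmul_smul, ← algebraMap_smul ℂ (coAd J h a b), map_smul, map_smul]
  rfl

theorem conjAut_jHat (h : G) (X : Gen n g) (a : κ) :
    conjAut E G n g ħ h (jHat ħ J (X, a)) = ∑ b, (coAd J h a b : ℂ) • jHat ħ J (X, b) := by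
  rcases X with i | i | i
  · exact conjAut_kHat ħ J h _ a
  · simp only [jHat, map_add, conjAut_kHat, smul_add, Finset.sum_add_distrib]
  · exact conjAut_kHat ħ J h _ a

/-- Conjugation is semilinear over the functions, so it turns the coupling into the one with
conjugated matrices, applied to the decoupled generators rotated by the constant matrix $\Lambda =
\mathrm{Ad}^*(h)$. Covariance of the matrices lets $\Lambda$ be pulled out by `coupled_smul`. -/
theorem conjAut_jCoupled (h : G) (X : Gen n g) (a : κ) :
    conjAut E G n g ħ h (jCoupled ħ J X a) = ∑ b, (coAd J h a b : ℂ) • jCoupled ħ J X b := by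
  let σ : SmoothFun E G (Gen n g) →+* SmoothFun E G (Gen n g) := conjPullback E G n g h
  let S : QuantumFlower E G n g ħ →ₛₗ[σ] QuantumFlower E G n g ħ :=
    { toFun := conjAut E G n g ħ h
      map_add' := map_add _
      map_smul' := fun F x => by
        rw [SmashProduct.left_smul_def, map_mul, conjAut_ofFun]
        rfl }
  let Λ : Matrix κ κ (SmoothFun E G (Gen n g)) :=
    Matrix.of fun a b => algebraMap ℂ (SmoothFun E G (Gen n g)) (coAd J h a b)
  have h0 : ∀ (v : κ → QuantumFlower E G n g ħ) (a : κ),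
      (Λ • v) a = ∑ b, (coAd J h a b : ℂ) • v b := fun v a =>
    Finset.sum_congr rfl fun b _ =>
      algebraMap_smul (SmoothFun E G (Gen n g)) (coAd J h a b : ℂ) (v b)
  have h1 := comp_coupled S (coAdMat J) (fun X a => jHat ħ J (X, a)) X
  have h2 : (fun X : Gen n g => S ∘ fun a => jHat ħ J (X, a)) =
      fun X => Λ • fun a => jHat ħ J (X, a) :=
    funext fun X => funext fun a => (conjAut_jHat ħ J h X a).trans (h0 _ a).symm
  rw [h2, coupled_smul (ad := coAdMat J) (H := equivariantWords E G n g)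
    uComp_mem_equivariantWords (fun w hw => coAdMat_map_conjPullback J h hw)] at h1
  exact (congrFun h1 a).trans (h0 _ a)

end Quantum

/-! ### Polynomials of degree at most one -/

section DegreeOne

/-- The polynomial `F₀ + ∑ cᵢ Xᵢ`. -/
def MvPolynomial.affine (σ R : Type*) [Fintype σ] [CommRing R] :
    (R × (σ → R)) →ₗ[R] MvPolynomial σ R :=
  (LinearMap.toSpanSingleton R _ 1).coprod (Fintype.linearCombination R MvPolynomial.X)

theorem MvPolynomial.affine_apply {σ R : Type*} [Fintype σ] [CommRing R] (F : R) (c : σ → R) :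
    MvPolynomial.affine σ R (F, c) = F • 1 + ∑ i, c i • MvPolynomial.X i := rfl

theorem MvPolynomial.affine_mem {σ R : Type*} [Fintype σ] [CommRing R] (v : R × (σ → R)) :
    MvPolynomial.affine σ R v ∈ MvPolynomial.restrictTotalDegree σ R 1 := by
  rw [← Prod.mk.eta (p := v), affine_apply]
  refine add_mem (Submodule.smul_mem _ _ ?_) (sum_mem fun i _ => Submodule.smul_mem _ _
    (X_mem_restrictTotalDegree i))
  exact C_mem_restrictTotalDegree 1

/-- A monomial with nonzero coefficient has degree at most one, so it is either trivial or a single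
variable. -/
theorem MvPolynomial.exists_eq_affine {σ R : Type*} [Fintype σ] [CommRing R] {p : MvPolynomial σ R}
    (hp : p ∈ MvPolynomial.restrictTotalDegree σ R 1) :
    p = MvPolynomial.affine σ R (p.coeff 0, fun i => p.coeff (Finsupp.single i 1)) := by
  classical
  rw [mem_restrictTotalDegree] at hp
  ext m
  rw [affine_apply, coeff_add, coeff_sum, coeff_smul, coeff_one]
  simp only [coeff_smul, coeff_X, smul_eq_mul, mul_ite, mul_one, mul_zero]
  by_cases h0 : m = 0
  · subst h0
    rw [if_pos rfl, Finset.sum_eq_zero, add_zero]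
    intro i _
    rw [if_neg]
    exact fun h => one_ne_zero ((Finsupp.single_eq_zero).mp h)
  · rw [if_neg (Ne.symm h0), zero_add]
    by_cases h1 : ∃ i, m = Finsupp.single i 1
    · obtain ⟨i, rfl⟩ := h1
      rw [Finset.sum_eq_single i]
      · rw [if_pos rfl]
      · intro j _ hj
        rw [if_neg]
        exact fun h => hj (Finsupp.single_left_injective one_ne_zero h)
      · simp
    · rw [Finset.sum_eq_zero]
      · by_contra hc
        have hd := (le_totalDegree (mem_support_iff.mpr hc)).trans hp
        obtain ⟨i, hi⟩ : ∃ i, m i ≠ 0 := by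
          by_contra! h
          exact h0 (Finsupp.ext h)
        refine h1 ⟨i, ?_⟩
        have hle : Finsupp.single i 1 ≤ m :=
          Finsupp.single_le_iff.mpr (Nat.one_le_iff_ne_zero.mpr hi)
        -- A variable that occurs in `m` is split off. It uses up the whole degree, so the remaining
        -- exponents vanish, contrary to `h1`.
        have hs : m - Finsupp.single i 1 + Finsupp.single i 1 = m := tsub_add_cancel_of_le hle
        rw [← hs, Finsupp.sum_add_index' (fun _ => rfl) (fun _ _ _ => rfl),
          Finsupp.sum_single_index rfl] at hd
        have hz : m - Finsupp.single i 1 = 0 := by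
          ext k
          by_contra hk
          have := Finset.single_le_sum (f := fun k => (m - Finsupp.single i 1 : σ →₀ ℕ) k)
            (fun _ _ => Nat.zero_le _) (Finsupp.mem_support_iff.mpr hk)
          change _ ≤ (m - Finsupp.single i 1 : σ →₀ ℕ).sum fun _ e => e at this
          have h3 : (m - Finsupp.single i 1 : σ →₀ ℕ) k = 0 := by omega
          exact hk h3
        rw [← hs, hz, zero_add]
      · intro i _
        rw [if_neg]
        exact fun h => h1 ⟨i, h.symm⟩

end DegreeOne

/-! ### Linear independence of the quantum generators over the functions -/

section Independence

variable {E : Type*} [NormedAddCommGroup E] [NormedSpace ℝ E] [FiniteDimensional ℝ E]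
  {G : Type*} [TopologicalSpace G] [ChartedSpace E G] [Group G] [LieGroup 𝓘(ℝ, E) ∞ G]
  {n g : ℕ}

variable (E G n g) in
/-- The derivations of `C^∞(G^{n+2g}, ℂ)` along the left-invariant vector fields. -/
def rightDeriv : PowLie (Gen n g) (GroupLieAlgebra 𝓘(ℝ, E) G) →ₗ[ℝ]
    Derivation ℂ (SmoothFun E G (Gen n g)) (SmoothFun E G (Gen n g)) where
  toFun x := ∑ X, (rightFamily E G X).derivLin (x.comp X)
  map_add' x y := by
    rw [← Finset.sum_add_distrib]
    exact Finset.sum_congr rfl fun X _ => map_add (rightFamily E G X).derivLin (x.comp X) (y.comp X)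
  map_smul' r x := by
    rw [RingHom.id_apply, Finset.smul_sum]
    exact Finset.sum_congr rfl fun X _ => map_smul (rightFamily E G X).derivLin r (x.comp X)

theorem rightDeriv_apply (x : PowLie (Gen n g) (GroupLieAlgebra 𝓘(ℝ, E) G)) :
    rightDeriv E G n g x = ∑ X, (rightFamily E G X).deriv (x.comp X) := rfl

theorem rightDeriv_single (X : Gen n g) (a : GroupLieAlgebra 𝓘(ℝ, E) G) :
    rightDeriv E G n g (PowLie.single X a) = (rightFamily E G X).deriv a := by
  rw [rightDeriv_apply, Finset.sum_eq_single X]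
  · congr 1
    exact Pi.single_eq_same (M := fun _ => GroupLieAlgebra 𝓘(ℝ, E) G) X a
  · intro Y _ hY
    have h : (PowLie.single X a).comp Y = 0 :=
      Pi.single_eq_of_ne (M := fun _ => GroupLieAlgebra 𝓘(ℝ, E) G) hY a
    rw [h]
    exact map_zero (rightFamily E G Y).derivLin
  · simp

/-- A representation of $\bigoplus\mathfrak g$ on functions yields functionals on $U$ by evaluation
at the unit. The decoupled action does not suit this purpose, because conjugation fixes the unit and
the generators $k^{M_i}$ act by zero there. Right translations act freely, and in different
components they commute. -/
theorem rightDeriv_lie (x y : PowLie (Gen n g) (GroupLieAlgebra 𝓘(ℝ, E) G)) :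
    rightDeriv E G n g ⁅x, y⁆ = ⁅rightDeriv E G n g x, rightDeriv E G n g y⁆ := by
  simp only [rightDeriv_apply, sum_lie, lie_sum]
  refine Finset.sum_congr rfl fun X _ => ?_
  rw [Finset.sum_eq_single X]
  · refine SmoothFamily.deriv_lie _ (fun u h k => ?_) _ _
    simp [rightFamily, mul_assoc]
  · intro Y _ hY
    refine SmoothFamily.deriv_comm _ _ (fun u h k => ?_) (x.comp Y) (y.comp X)
    simp only [rightFamily, Function.update_of_ne hY, Function.update_of_ne hY.symm]
    exact Function.update_comm hY _ _ u
  · simp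

variable (E G n g) in
/-- The representation of the rescaled Lie algebra on functions by left-invariant vector fields. -/
def rightRep (c : ℂ) : ScaledLie c (FlowerLie E G n g) →ₗ⁅ℂ⁆
    Module.End ℂ (SmoothFun E G (Gen n g)) where
  toFun x := c • ((rightDeriv E G n g).liftBaseChange ℂ ((ScaledLie.of c _).symm x) :
    Derivation ℂ (SmoothFun E G (Gen n g)) (SmoothFun E G (Gen n g))).toLinearMap
  map_add' x y := by
    rw [map_add, map_add, Derivation.coe_add_linearMap, smul_add]
  map_smul' z x := by
    rw [map_smul, map_smul, Derivation.coe_smul_linearMap, smul_comm]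
    rfl
  map_lie' {x y} := by
    change c • ((rightDeriv E G n g).liftBaseChange ℂ
      (c • ⁅(ScaledLie.of c _).symm x, (ScaledLie.of c _).symm y⁆)).toLinearMap = _
    rw [map_smul, LinearMap.liftBaseChange_lie _ rightDeriv_lie, smul_lie, lie_smul,
      ← Derivation.commutator_coe_linear_map]
    rfl

theorem rightRep_single (c : ℂ) (X : Gen n g) (a : GroupLieAlgebra 𝓘(ℝ, E) G)
    (F : SmoothFun E G (Gen n g)) :
    rightRep E G n g c (ScaledLie.of c _ (1 ⊗ₜ[ℝ] PowLie.single X a)) F =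
      c • (rightFamily E G X).deriv a F := by
  change c • ((rightDeriv E G n g).liftBaseChange ℂ (1 ⊗ₜ[ℝ] PowLie.single X a)) F = _
  rw [LinearMap.liftBaseChange_tmul, one_smul, rightDeriv_single]

variable (ħ : ℝ)

/-- Evaluation at the unit of the elements of `U`, acting on a function `χ` by left-invariant
differential operators. -/
def evalU (χ : SmoothFun E G (Gen n g)) : UniversalEnvelopingAlgebra ℂ
    (ScaledLie (-(Complex.I * (ħ : ℂ))) (FlowerLie E G n g)) →ₗ[ℂ] ℂ where
  toFun θ := UniversalEnvelopingAlgebra.lift ℂ (rightRep E G n g _) θ χ 1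
  map_add' θ θ' := by rw [map_add]; rfl
  map_smul' c θ := by rw [map_smul]; rfl

/-- The functional `evalU`, extended to the quantum flower algebra. -/
def evalQ (χ : SmoothFun E G (Gen n g)) :
    QuantumFlower E G n g ħ →ₗ[SmoothFun E G (Gen n g)] SmoothFun E G (Gen n g) :=
  let e : QuantumFlower E G n g ħ →ₗ[ℂ] SmoothFun E G (Gen n g) :=
    TensorProduct.lift ((LinearMap.lsmul ℂ (SmoothFun E G (Gen n g))) ∘ₗ evalU ħ χ)
  { e with
    map_smul' := fun F x => by
      change e (F • x) = F * e x
      induction x using SmashProduct.induction_on with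
      | h0 => simp
      | ht θ K =>
        rw [SmashProduct.left_smul_def, SmashProduct.ofFun_mul_tmul]
        exact (mul_smul_comm (evalU ħ χ θ) F K).symm
      | ha x y hx hy => rw [smul_add, map_add, map_add, hx, hy, mul_add] }

theorem evalQ_tmul (χ : SmoothFun E G (Gen n g)) (θ) (F : SmoothFun E G (Gen n g)) :
    evalQ ħ χ (SmashProduct.tmul _ θ F) = evalU ħ χ θ • F := rfl

theorem evalQ_one (χ : SmoothFun E G (Gen n g)) : evalQ ħ χ 1 = χ 1 • 1 := by
  rw [SmashProduct.one_def, evalQ_tmul]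
  congr 1
  change UniversalEnvelopingAlgebra.lift ℂ (rightRep E G n g _) 1 χ 1 = _
  rw [map_one]
  rfl

variable {κ : Type*} [Fintype κ] [DecidableEq κ]
  (J : Module.Basis κ ℝ (GroupLieAlgebra 𝓘(ℝ, E) G))

theorem evalQ_kHat (χ : SmoothFun E G (Gen n g)) (X : Gen n g) (a : κ) :
    evalQ ħ χ (kHat ħ J X a) = (-(Complex.I * (ħ : ℂ)) * vecR J X a χ 1) • 1 := by
  rw [kHat, SmashProduct.ofLie, evalQ_tmul]
  congr 1
  change UniversalEnvelopingAlgebra.lift ℂ (rightRep E G n g _)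
    (UniversalEnvelopingAlgebra.ι ℂ _) χ 1 = _
  rw [UniversalEnvelopingAlgebra.lift_ι_apply, rightRep_single]
  rfl

/-- The function depends on the component $u_Y$ alone and has differential $P^b$ at the unit. The
functionals `evalQ` of these functions are, up to the factor $-i\hbar$, dual to the generators
`kHat`. -/
theorem exists_coordinate_function (Y : Gen n g) (b : κ) :
    ∃ χ : SmoothFun E G (Gen n g), ∀ (X : Gen n g) (a : κ),
      vecR J X a χ 1 = if (X, a) = (Y, b) then 1 else 0 := by
  obtain ⟨φ, hφ, hd⟩ := exists_derivOne_eq (E := E) (G := G) (J.coord b)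
  refine ⟨SmoothFun.mk (fun u => φ (u Y)) (hφ.comp (contMDiff_pow_proj Y)), fun X a => ?_⟩
  rw [vecR_apply]
  change derivOne (fun h => φ (Function.update (1 : Gen n g → G) X (1 * h) Y)) (J a) = _
  by_cases hX : X = Y
  · subst hX
    simp only [Function.update_self, one_mul, Prod.mk.injEq, true_and]
    refine (hd (J a)).trans ?_
    rw [Module.Basis.coord_apply, Module.Basis.repr_self, Finsupp.single_apply]
    split_ifs <;> simp
  · have h : ∀ h : G, Function.update (1 : Gen n g → G) X (1 * h) Y = 1 := fun h => by
      rw [Function.update_of_ne (Ne.symm hX)]; rfl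
    simp only [h, derivOne_const_fun, Prod.mk.injEq, hX, false_and, if_false]

/-- The functions and the decoupled generators are linearly independent over the functions. -/
theorem quantum_linearIndependent {ħ : ℝ} (hħ : ħ ≠ 0) {F : SmoothFun E G (Gen n g)}
    {c : Gen n g × κ → SmoothFun E G (Gen n g)}
    (h : F • (1 : QuantumFlower E G n g ħ) + ∑ i, c i • jHat ħ J i = 0) : F = 0 ∧ c = 0 := by
  have hne : -(Complex.I * (ħ : ℂ)) ≠ 0 :=
    neg_ne_zero.mpr (mul_ne_zero Complex.I_ne_zero (Complex.ofReal_ne_zero.mpr hħ))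
  have key : ∀ χ : SmoothFun E G (Gen n g),
      F * evalQ ħ χ 1 + ∑ i, c i * evalQ ħ χ (jHat ħ J i) = 0 := fun χ => by
    have h1 := congrArg (evalQ ħ χ) h
    rw [map_add, map_sum, map_zero, map_smul] at h1
    simpa only [map_smul, smul_eq_mul] using h1
  have hk1 : ∀ (X : Gen n g) (a : κ), evalQ ħ 1 (kHat ħ J X a) = 0 := fun X a => by
    rw [evalQ_kHat, Derivation.map_one_eq_zero]
    change (_ * (0 : ℂ)) • _ = _
    rw [mul_zero, zero_smul]
  -- The functional of the constant function $1$ annihilates all generators and isolates $F$.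
  have hF : F = 0 := by
    have h1 := key 1
    have h2 : ∀ i : Gen n g × κ, evalQ ħ 1 (jHat ħ J i) = 0 := by
      rintro ⟨i | i | i, a⟩
      · exact hk1 _ _
      · rw [jHat, map_add, hk1, hk1, add_zero]
      · exact hk1 _ _
    simp only [h2, mul_zero, Finset.sum_const_zero, add_zero, evalQ_one] at h1
    change F * ((1 : ℂ) • 1) = 0 at h1
    rwa [one_smul, mul_one] at h1
  refine ⟨hF, ?_⟩
  choose χ hχ using fun Y : Gen n g => fun b => exists_coordinate_function J Y b
  have hk : ∀ Y b X a, evalQ ħ (χ Y b) (kHat ħ J X a) =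
      if (X, a) = (Y, b) then (-(Complex.I * (ħ : ℂ))) • 1 else 0 := fun Y b X a => by
    rw [evalQ_kHat, hχ]
    split_ifs <;> simp
  have hcancel : ∀ K : SmoothFun E G (Gen n g), K * ((-(Complex.I * (ħ : ℂ))) • 1) = 0 → K = 0 :=
    fun K hK => by
      rw [mul_smul_comm, mul_one] at hK
      exact (smul_eq_zero_iff_right hne).mp hK
  have hM : ∀ (i : Fin n) b, c (M i, b) = 0 := fun i b => by
    have h1 := key (χ (M i) b)
    rw [hF, zero_mul, zero_add, Finset.sum_eq_single (M i, b)] at h1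
    · rw [jHat, hk, if_pos rfl] at h1
      exact hcancel _ h1
    · rintro ⟨j | j | j, a⟩ _ hj
      · rw [jHat, hk, if_neg hj, mul_zero]
      · rw [jHat, map_add, hk, hk, if_neg (by simp), if_neg (by simp), add_zero, mul_zero]
      · rw [jHat, hk, if_neg (by simp), mul_zero]
    · simp
  -- Since $j^{A'} = k^A + k^B$, the functional dual to $k^A$ sees only $j^{A'}$, whereas the one
  -- dual to $k^B$ sees both $j^{A'}$ and $j^{B'}$. The coefficients at $A$ must therefore be
  -- removed before those at $B$.
  have hA : ∀ (i : Fin g) b, c (A i, b) = 0 := fun i b => by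
    have h1 := key (χ (A i) b)
    rw [hF, zero_mul, zero_add, Finset.sum_eq_single (A i, b)] at h1
    · rw [jHat, map_add, hk, hk, if_pos rfl, if_neg (by simp), add_zero] at h1
      exact hcancel _ h1
    · rintro ⟨j | j | j, a⟩ _ hj
      · rw [jHat, hk, if_neg (by simp), mul_zero]
      · rw [jHat, map_add, hk, hk, if_neg hj, if_neg (by simp), add_zero, mul_zero]
      · rw [jHat, hk, if_neg (by simp), mul_zero]
    · simp
  have hB : ∀ (i : Fin g) b, c (B i, b) = 0 := fun i b => by
    have h1 := key (χ (B i) b)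
    rw [hF, zero_mul, zero_add, Finset.sum_eq_single (B i, b)] at h1
    · rw [jHat, hk, if_pos rfl] at h1
      exact hcancel _ h1
    · rintro ⟨j | j | j, a⟩ _ hj
      · rw [jHat, hk, if_neg (by simp), mul_zero]
      · rw [hA, zero_mul]
      · rw [jHat, hk, if_neg hj, mul_zero]
    · simp
  funext ⟨X, b⟩
  rcases X with i | i | i
  exacts [hM i b, hA i b, hB i b]

end Independence

/-! ### Bijectivity of the quantisation map and transport of the action -/

section Quantisation

variable {E : Type*} [NormedAddCommGroup E] [NormedSpace ℝ E] [FiniteDimensional ℝ E]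
  {G : Type*} [TopologicalSpace G] [ChartedSpace E G] [Group G] [LieGroup 𝓘(ℝ, E) ∞ G]
  {n g : ℕ} {κ : Type*} [Fintype κ] [DecidableEq κ] (ħ : ℝ)
  (J : Module.Basis κ ℝ (GroupLieAlgebra 𝓘(ℝ, E) G))

/-- The extension of `quantise` to all polynomials, linear over the functions. -/
def quantiseLin : ClassicalFlower E G n g κ →ₗ[SmoothFun E G (Gen n g)] QuantumFlower E G n g ħ :=
  (LinearMap.toSpanSingleton _ _ 1) ∘ₗ MvPolynomial.lcoeff _ 0 +
    ∑ i, (LinearMap.toSpanSingleton _ _ (jHat ħ J i)) ∘ₗ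
      MvPolynomial.lcoeff _ (Finsupp.single i 1)

theorem quantiseLin_apply (p : ClassicalFlower E G n g κ) :
    quantiseLin ħ J p = p.coeff 0 • (1 : QuantumFlower E G n g ħ) +
      ∑ i, p.coeff (Finsupp.single i 1) • jHat ħ J i := by
  simp [quantiseLin]

theorem quantise_eq (p : ClassicalFlowerOne E G n g κ) :
    (quantise ħ J p : QuantumFlower E G n g ħ) = quantiseLin ħ J p := by
  rw [quantiseLin_apply, SmashProduct.left_smul_def, mul_one]
  rfl

theorem quantiseLin_X (i : Gen n g × κ) : quantiseLin ħ J (MvPolynomial.X i) = jHat ħ J i := by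
  rw [quantiseLin_apply, MvPolynomial.coeff_zero_X, zero_smul, zero_add, Finset.sum_eq_single i]
  · rw [MvPolynomial.coeff_X, if_pos rfl, one_smul]
  · intro j _ hj
    rw [MvPolynomial.coeff_X, if_neg, zero_smul]
    exact fun h => hj (Finsupp.single_left_injective one_ne_zero h).symm
  · simp

theorem quantiseLin_one :
    quantiseLin ħ J (1 : ClassicalFlower E G n g κ) = (1 : QuantumFlower E G n g ħ) := by
  rw [quantiseLin_apply, MvPolynomial.coeff_zero_one, one_smul, Finset.sum_eq_zero, add_zero]
  intro i _
  rw [MvPolynomial.coeff_one, if_neg, zero_smul]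
  exact fun h => one_ne_zero (Finsupp.single_eq_zero.mp h.symm)

theorem quantiseLin_decoupleGen (X : Gen n g) (a : κ) :
    quantiseLin ħ J (decoupleGen J (X, a)) = jCoupled ħ J X a := by
  rw [decoupleGen_eq, map_coupled]
  simp only [jPrime, quantiseLin_X]
  rfl

theorem substHom_C {σ R : Type*} [CommRing R] [Algebra ℂ R] (φ : R →ₐ[ℂ] R)
    (p : σ → MvPolynomial σ R) (F : R) :
    substHom φ p (MvPolynomial.C F) = MvPolynomial.C (φ F) :=
  MvPolynomial.eval₂_C _ _ _

theorem substHom_X {σ R : Type*} [CommRing R] [Algebra ℂ R] (φ : R →ₐ[ℂ] R)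
    (p : σ → MvPolynomial σ R) (i : σ) : substHom φ p (MvPolynomial.X i) = p i :=
  MvPolynomial.eval₂_X _ _ _

theorem substHom_smul {σ R : Type*} [CommRing R] [Algebra ℂ R] (φ : R →ₐ[ℂ] R)
    (p : σ → MvPolynomial σ R) (F : R) (q : MvPolynomial σ R) :
    substHom φ p (F • q) = φ F • substHom φ p q := by
  rw [MvPolynomial.smul_eq_C_mul, map_mul, substHom_C, MvPolynomial.smul_eq_C_mul]

/-- The map `Q|_{01}`, extended to all polynomials. -/
def QLin : ClassicalFlower E G n g κ →ₗ[SmoothFun E G (Gen n g)] QuantumFlower E G n g ħ :=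
  quantiseLin ħ J ∘ₗ
    { toFun := decouple J
      map_add' := map_add _
      map_smul' := substHom_smul _ _ }

theorem Q01_eq (p : ClassicalFlowerOne E G n g κ) :
    (Q01 ħ J p : QuantumFlower E G n g ħ) = QLin ħ J p :=
  quantise_eq ħ J _

theorem QLin_X (X : Gen n g) (a : κ) : QLin ħ J (MvPolynomial.X (X, a)) = jCoupled ħ J X a := by
  change quantiseLin ħ J (decouple J _) = _
  rw [decouple, substHom_X, quantiseLin_decoupleGen]

theorem QLin_one : QLin ħ J (1 : ClassicalFlower E G n g κ) = (1 : QuantumFlower E G n g ħ) := by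
  change quantiseLin ħ J (decouple J _) = _
  rw [map_one, quantiseLin_one]

theorem QLin_C (F : SmoothFun E G (Gen n g)) :
    QLin ħ J (MvPolynomial.C F : ClassicalFlower E G n g κ) = SmashProduct.ofFun _ F := by
  rw [← mul_one (MvPolynomial.C F), ← MvPolynomial.smul_eq_C_mul, map_smul, QLin_one,
    SmashProduct.left_smul_def, mul_one]

theorem QLin_affine (F : SmoothFun E G (Gen n g)) (c : Gen n g × κ → SmoothFun E G (Gen n g)) :
    QLin ħ J (MvPolynomial.affine _ _ (F, c)) =
      F • 1 + ∑ i : Gen n g × κ, c i • jCoupled ħ J i.1 i.2 := by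
  rw [MvPolynomial.affine_apply, map_add, map_smul, QLin_one, map_sum]
  congr 1
  refine Finset.sum_congr rfl fun i _ => ?_
  rw [map_smul, QLin_X]

/-- The elements obtained from affine polynomials form a submodule over the functions that contains
$1$ and the coupled generators. By downward elimination it contains the decoupled generators, hence
all $k^X_a$, hence $L\otimes C^\infty$. -/
theorem Q01_surjective :
    Function.Surjective (Q01 ħ J : ClassicalFlowerOne E G n g κ → QuantumFlowerOne E G n g ħ) := by
  let P : Submodule (SmoothFun E G (Gen n g)) (QuantumFlower E G n g ħ) :=
    LinearMap.range (QLin ħ J ∘ₗ MvPolynomial.affine (Gen n g × κ) (SmoothFun E G (Gen n g)))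
  have hF : ∀ F, SmashProduct.ofFun _ F ∈ P := fun F => ⟨(F, 0), by
    change QLin ħ J (MvPolynomial.affine _ _ (F, 0)) = _
    rw [QLin_affine]
    simp only [Pi.zero_apply, zero_smul, Finset.sum_const_zero, add_zero]
    rw [SmashProduct.left_smul_def, mul_one]⟩
  have hj : ∀ X a, jCoupled ħ J X a ∈ P := fun X a => ⟨(0, Pi.single (X, a) 1), by
    change QLin ħ J (MvPolynomial.affine _ _ (0, _)) = _
    rw [QLin_affine, zero_smul, zero_add, Finset.sum_eq_single (X, a)]
    · rw [Pi.single_eq_same, one_smul]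
    · intro i _ hi
      rw [Pi.single_eq_of_ne hi, zero_smul]
    · simp⟩
  have hjHat : ∀ (X : Gen n g) (a : κ), jHat ħ J (X, a) ∈ P :=
    mem_of_coupled_mem (coAdMat J) (fun X a => jHat ħ J (X, a)) P hj
  have hk : ∀ (X : Gen n g) (a : κ), kHat ħ J X a ∈ P := by
    rintro (i | i | i) a
    · exact hjHat (M i) a
    · have h := sub_mem (hjHat (A i) a) (hjHat (B i) a)
      rwa [jHat, jHat, add_sub_cancel_right] at h
    · exact hjHat (B i) a
  -- Elements of the complexified Lie algebra are complex combinations of the basis vectors, and the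
  -- filtration is a complex span, so the same set is needed as a complex subspace.
  let PC : Submodule ℂ (QuantumFlower E G n g ħ) := P.restrictScalars ℂ
  have hL : ∀ x : FlowerLie E G n g, SmashProduct.ofLieLin _ (ScaledLie.of _ _ x) ∈ PC := by
    intro x
    induction x using TensorProduct.induction_on with
    | zero => rw [map_zero, map_zero]; exact zero_mem _
    | add x y hx hy => rw [map_add, map_add]; exact add_mem hx hy
    | tmul z x =>
      have hx : x = ∑ X, LinearMap.single ℝ (fun _ : Gen n g => GroupLieAlgebra 𝓘(ℝ, E) G) X
          (∑ a, J.repr (x X) a • J a) := by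
        funext Y
        simp only [J.sum_repr]
        exact (congrFun (Finset.univ_sum_single
          (M := fun _ : Gen n g => GroupLieAlgebra 𝓘(ℝ, E) G) x) Y).symm
      have hz : z ⊗ₜ[ℝ] x = ∑ X, ∑ a, (z * (J.repr (x X) a : ℂ)) •
          ((1 : ℂ) ⊗ₜ[ℝ] (PowLie.single X (J a) :
            PowLie (Gen n g) (GroupLieAlgebra 𝓘(ℝ, E) G))) := by
        refine (congrArg (fun y : PowLie (Gen n g) (GroupLieAlgebra 𝓘(ℝ, E) G) =>
          z ⊗ₜ[ℝ] y) hx).trans ?_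
        refine (TensorProduct.tmul_sum z _ _).trans (Finset.sum_congr rfl fun X _ => ?_)
        rw [map_sum]
        refine (TensorProduct.tmul_sum z _ _).trans (Finset.sum_congr rfl fun a _ => ?_)
        rw [map_smul, TensorProduct.smul_tmul', smul_eq_mul, mul_one, mul_comm,
          ← Complex.real_smul]
        exact (TensorProduct.smul_tmul _ _ _).symm
      rw [hz, map_sum, map_sum]
      refine sum_mem fun X _ => ?_
      rw [map_sum, map_sum]
      refine sum_mem fun a _ => ?_
      rw [map_smul, map_smul]
      exact PC.smul_mem _ (hk X a)
  have hle : SmashProduct.filtration (quantumDeriv E G n g ħ) 1 ≤ PC := by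
    refine SmashProduct.filtration_one_le _ hF fun ξ F => ?_
    rw [SmashProduct.tmul_eq_ofFun_mul]
    exact P.smul_mem F (hL ((ScaledLie.of _ _).symm ξ))
  rintro ⟨x, hx⟩
  obtain ⟨v, hv⟩ := hle hx
  exact ⟨⟨MvPolynomial.affine _ _ v, MvPolynomial.affine_mem v⟩,
    Subtype.ext ((Q01_eq ħ J _).trans hv)⟩

/-- On coefficients, expressing the coupled generators through the decoupled ones is an endomorphism
`m` of a finite free module over the functions. Downward elimination shows that it is onto, so it is
injective, and its inverse is never written down. What remains is the independence of the decoupled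
generators. -/
theorem Q01_injective {ħ : ℝ} (hħ : ħ ≠ 0) :
    Function.Injective (Q01 ħ J : ClassicalFlowerOne E G n g κ → QuantumFlowerOne E G n g ħ) := by
  let R := SmoothFun E G (Gen n g)
  let j : Gen n g → κ → (Gen n g × κ → R) := fun X a => Pi.single (X, a) 1
  let m : (Gen n g × κ → R) →ₗ[R] (Gen n g × κ → R) :=
    Fintype.linearCombination R fun i => coupled (coAdMat J) j i.1 i.2
  have hm : Function.Surjective m := by
    have hj := mem_of_coupled_mem (coAdMat J) j (LinearMap.range m) fun X a =>
      ⟨Pi.single (X, a) 1, by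
        rw [Fintype.linearCombination_apply_single, one_smul]⟩
    intro v
    have hv : v = ∑ i, v i • j i.1 i.2 := by
      funext k
      rw [Finset.sum_apply, Finset.sum_eq_single k]
      · simp [j]
      · intro i _ hi
        simp [j, Pi.single_eq_of_ne (Ne.symm hi)]
      · simp
    rw [hv]
    exact sum_mem (S := LinearMap.range m) fun i _ => Submodule.smul_mem _ _ (hj _ _)
  have hmi : Function.Injective m := OrzechProperty.injective_of_surjective_endomorphism m hm
  let T : (Gen n g × κ → R) →ₗ[R] QuantumFlower E G n g ħ :=
    Fintype.linearCombination R fun i => jHat ħ J i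
  have hT : ∀ X a, T (coupled (coAdMat J) j X a) = jCoupled ħ J X a := by
    intro X a
    rw [map_coupled]
    have h : (fun X a => T (j X a)) = fun X a => jHat ħ J (X, a) := by
      funext X a
      rw [Fintype.linearCombination_apply_single, one_smul]
    rw [h]
    rfl
  refine (injective_iff_map_eq_zero (Q01 ħ J)).mpr fun p hp => ?_
  have h1 : QLin ħ J p.1 = 0 := (Q01_eq ħ J p).symm.trans (congrArg Subtype.val hp)
  set c : Gen n g × κ → R := fun i => p.1.coeff (Finsupp.single i 1) with hc
  have hpc : p.1 = MvPolynomial.affine _ _ (p.1.coeff 0, c) := MvPolynomial.exists_eq_affine p.2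
  rw [hpc, QLin_affine] at h1
  -- `T` realises coordinate vectors as combinations of the decoupled quantum generators, and it
  -- commutes with the coupling because it is linear over the functions.
  have h2 : ∑ i : Gen n g × κ, c i • jCoupled ħ J i.1 i.2 = T (m c) := by
    have hmc : m c = ∑ i, c i • coupled (coAdMat J) j i.1 i.2 :=
      Fintype.linearCombination_apply R _ c
    rw [hmc, map_sum]
    exact Finset.sum_congr rfl fun i _ => by rw [map_smul, hT]
  rw [h2, Fintype.linearCombination_apply] at h1
  obtain ⟨h3, h4⟩ := quantum_linearIndependent J hħ h1
  have h5 : c = 0 := hmi (h4.trans (map_zero m).symm)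
  refine Subtype.ext (hpc.trans ?_)
  rw [h3, h5]
  exact map_zero (MvPolynomial.affine _ _)

/-- The action on the quantum flower algebra corresponds to the action on the classical one. -/
theorem symAut_Q01 {ħ : ℝ} (hħ : ħ ≠ 0) (h : G) (f : C^∞⟮𝓘(ℝ, E), G; ℝ⟯)
    (p : ClassicalFlowerOne E G n g κ) :
    symAut E G n g ħ (SymGroup.mk h f) (Q01 ħ J p) = Q01 ħ J (actionOne J h f p) := by
  -- Both sides are semilinear over the functions for the same pullback, since the gauge part fixes
  -- functions. Hence only the values on $1$ and on the generators have to be compared.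
  have hsmul : ∀ (F : SmoothFun E G (Gen n g)) (x : QuantumFlower E G n g ħ),
      symAut E G n g ħ (SymGroup.mk h f) (F • x) =
        conjPullback E G n g h F • symAut E G n g ħ (SymGroup.mk h f) x := fun F x => by
    rw [SmashProduct.left_smul_def, map_mul, symAut_mk_apply, conjAut_ofFun, gaugeAut_ofFun]
    rfl
  have hgen : ∀ (X : Gen n g) (a : κ), symAut E G n g ħ (SymGroup.mk h f) (jCoupled ħ J X a) =
      QLin ħ J (actionGen J h f (X, a)) := fun X a => by
    rw [symAut_mk_apply, conjAut_jCoupled, map_sum, actionGen, map_sum]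
    refine Finset.sum_congr rfl fun b _ => ?_
    rw [map_smul, gaugeAut_jCoupled J hħ,
      ← algebraMap_smul (SmoothFun E G (Gen n g)) (coAd J h a b : ℂ)
        (MvPolynomial.X (X, b) + MvPolynomial.C (bracketJF J X b (compTotal f)) :
          ClassicalFlower E G n g κ), map_smul, map_add, QLin_X, QLin_C, algebraMap_smul]
  rw [Q01_eq, Q01_eq]
  change _ = QLin ħ J (action J h f p.1)
  rw [MvPolynomial.exists_eq_affine p.2, QLin_affine, MvPolynomial.affine_apply, map_add, map_add,
    map_add, hsmul, map_one, action, substHom_smul, map_one, map_smul, QLin_one, map_sum, map_sum,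
    map_sum]
  congr 1
  refine Finset.sum_congr rfl fun i _ => ?_
  rw [hsmul, hgen, substHom_smul, substHom_X, map_smul]

/-- The elements of degree at most one generate the semidirect product algebra. -/
theorem SmashProduct.algHom_ext_degreeLeOne {K L A : Type*} [CommRing K] [LieRing L]
    [LieAlgebra K L] [CommRing A] [Algebra K A] {D : L →ₗ⁅K⁆ Derivation K A A}
    {B : Type*} [Ring B] [Algebra K B] {f f' : SmashProduct D →ₐ[K] B}
    (h : ∀ x : degreeLeOne D, f x = f' x) : f = f' :=
  algHom_ext D (fun F => h ⟨ofFun D F, ofFun_mem D F⟩)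
    (fun ξ => h ⟨ofLie D ξ, tmul_ι_mem D ξ 1⟩)

/-- An algebra automorphism that preserves a Lie subalgebra in both directions restricts to a Lie
algebra automorphism. -/
def AlgEquiv.restrictLie {K B : Type*} [CommRing K] [Ring B] [Algebra K B] (S : LieSubalgebra K B)
    (e : B ≃ₐ[K] B) (he : ∀ x ∈ S, e x ∈ S) (he' : ∀ x ∈ S, e.symm x ∈ S) : S ≃ₗ⁅K⁆ S where
  toFun x := ⟨e x, he x x.2⟩
  invFun x := ⟨e.symm x, he' x x.2⟩
  map_add' x y := Subtype.ext (map_add e _ _)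
  map_smul' c x := Subtype.ext (map_smul e _ _)
  map_lie' {x y} := Subtype.ext (by
    change e ⁅(x : B), (y : B)⁆ = ⁅e x, e y⁆
    rw [LieRing.of_associative_ring_bracket, LieRing.of_associative_ring_bracket, map_sub, map_mul,
      map_mul])
  left_inv x := Subtype.ext (e.symm_apply_apply _)
  right_inv x := Subtype.ext (e.apply_symm_apply _)

end Quantisation

end

/-! ### The main theorem -/

theorem mainTheorem9 {E : Type*} [NormedAddCommGroup E] [NormedSpace ℝ E] [FiniteDimensional ℝ E]
    {G : Type*} [TopologicalSpace G] [ChartedSpace E G] [Group G] [LieGroup 𝓘(ℝ, E) ∞ G]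
    {κ : Type*} [Fintype κ] [DecidableEq κ]
    (J : Module.Basis κ ℝ (GroupLieAlgebra 𝓘(ℝ, E) G)) (n g : ℕ) (ħ : ℝ) (hħ : ħ ≠ 0) :
    ∃ Q : ClassicalFlowerOne E G n g κ ≃ₗ[ℂ] QuantumFlowerOne E G n g ħ,
      (∀ p, Q p = Q01 ħ J p) ∧
      (∀ (h : G) (f : C^∞⟮𝓘(ℝ, E), G; ℝ⟯),
        ∃ Θ : QuantumFlowerOne E G n g ħ ≃ₗ⁅ℂ⁆ QuantumFlowerOne E G n g ħ,
          ∀ x, Θ x = Q (actionOne J h f (Q.symm x))) ∧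
      ∃ ρ : SymGroup E G →* (QuantumFlower E G n g ħ ≃ₐ[ℂ] QuantumFlower E G n g ħ),
        ∀ (h : G) (f : C^∞⟮𝓘(ℝ, E), G; ℝ⟯),
          (∀ x : QuantumFlowerOne E G n g ħ,
            ρ (SymGroup.mk h f) x = Q (actionOne J h f (Q.symm x))) ∧
          ∀ Ψ : QuantumFlower E G n g ħ →ₐ[ℂ] QuantumFlower E G n g ħ,
            (∀ x : QuantumFlowerOne E G n g ħ, Ψ x = Q (actionOne J h f (Q.symm x))) →
              ∀ y, Ψ y = ρ (SymGroup.mk h f) y := by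
  let Q : ClassicalFlowerOne E G n g κ ≃ₗ[ℂ] QuantumFlowerOne E G n g ħ :=
    LinearEquiv.ofBijective (Q01 ħ J) ⟨Q01_injective J hħ, Q01_surjective ħ J⟩
  have hρ : ∀ (h : G) (f : C^∞⟮𝓘(ℝ, E), G; ℝ⟯) (x : QuantumFlowerOne E G n g ħ),
      symAut E G n g ħ (SymGroup.mk h f) x = Q (actionOne J h f (Q.symm x)) := by
    intro h f x
    have h1 := symAut_Q01 J hħ h f (Q.symm x)
    rwa [show Q01 ħ J (Q.symm x) = x from Q.apply_symm_apply x] at h1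
  -- On degree at most one the automorphism equals a map with values in that subspace, so the
  -- subspace is preserved. This is stated for all group elements because the inverse automorphism
  -- belongs to the inverse element.
  have hmem : ∀ (s : SymGroup E G), ∀ x ∈ QuantumFlowerOne E G n g ħ,
      symAut E G n g ħ s x ∈ QuantumFlowerOne E G n g ħ := fun s x hx => by
    have h1 := hρ s.right s.left.toAdd ⟨x, hx⟩
    exact h1.symm ▸ Subtype.property _
  refine ⟨Q, fun p => rfl, fun h f => ?_, symAut E G n g ħ, fun h f => ⟨hρ h f, fun Ψ hΨ y => ?_⟩⟩
  · refine ⟨AlgEquiv.restrictLie _ (symAut E G n g ħ (SymGroup.mk h f)) (hmem _) (fun x hx => ?_),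
      fun x => Subtype.ext (hρ h f x)⟩
    have h1 := hmem (SymGroup.mk h f)⁻¹ x hx
    rwa [map_inv] at h1
  · exact DFunLike.congr_fun (SmashProduct.algHom_ext_degreeLeOne (f := Ψ)
      (f' := (symAut E G n g ħ (SymGroup.mk h f) : _ →ₐ[ℂ] _))
      fun x => (hΨ x).trans (hρ h f x).symm) y
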